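/- **Theorem (batch-dynamic $H$-balanced orientation).** For a directed graph let $\delta^+(v)$ be the out-degree of $v$. For an integer $H\ge 1$, an orientation of an undirected graph is called *$H$-balanced* if $\min(\delta^+(u),H)\le \min(\delta^+(v),H)+1$ for every directed edge $u\to v$. There is a deterministic parallel batch-dynamic data structure $\mathrm{Balanced}(H)$ which, given the number $n$ of vertices and an integer parameter $H\ge 1$, starts from the empty graph on $\{0,\dots,n-1\}$, processes an arbitrary sequence of batches of edge insertions and batches of edge deletions to a simple undirected graph $G$, and after the initialization and after each batch explicitly stores an $H$-balanced orientation of the current edge set of $G$. There is an absolute constant $C$ such that, in the worst case, - the initialization from the empty graph takes work at most $C$ and depth at most $C$; - every batch of $k\ge 1$ edge insertions (distinct edges not in $G$) takes work at most $C\,H^6\log n$ per inserted edge, i.e. at most $C\,H^6\,k\log n$ in total, and depth at most $C\,H^6\log n$; - every batch of $k\ge 1$ edge deletions (distinct edges of $G$) takes work at most $C\,H^5\log n$ per deleted edge, i.e. at most $C\,H^5\,k\log n$ in total, and depth at most $C\,H^5\log n$. Here the machine is a synchronous CRCW PRAM (concurrent reads and writes; of several processors writing to one cell an arbitrary one succeeds)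 with zero-initialized shared memory and unit-cost arithmetic on $w$-bit words, for any $w$ with $2^w\ge (n+H)^c$, where $c$ is an absolute constant. The programs of the data structure do not depend on $n$, $H$ or $w$. Work is the total number of instructions over all processors, and depth is the number of parallel time steps. The orientation is stored as an adjacency matrix in the shared memory. -/

import Mathlib

/-!
## Orientations of an undirected graph
-/

/-- `D` is an orientation of the undirected graph `G`: every edge of `G` receives exactly one of
its two directions, and `D` has no other edges. -/
def IsOrientationOf {V : Type*} (D : Digraph V) (G : SimpleGraph V) : Prop :=
  (∀ u v, G.Adj u v ↔ D.Adj u v ∨ D.Adj v u) ∧ ∀ u v, D.Adj u v → ¬ D.Adj v u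

/-- The out-degree `δ⁺(v)`. -/
noncomputable def outDeg {V : Type*} (D : Digraph V) (v : V) : ℕ :=
  Set.ncard {x | D.Adj v x}

/-- `D` is `H`-balanced: `min(δ⁺(u), H) ≤ min(δ⁺(v), H) + 1` for every edge `u → v`. -/
def IsHBalanced {V : Type*} (D : Digraph V) (H : ℕ) : Prop :=
  ∀ u v, D.Adj u v → min (outDeg D u) H ≤ min (outDeg D v) H + 1

/-!
## A synchronous CRCW PRAM with word size `w`, in work-depth presentation

The shared memory consists of named arrays (a program mentions finitely many of them), each with
cells `0, …, 2 ^ w - 1` that hold `w`-bit words. A program is a while-program whose basic step is a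
parallel round: processors `0, …, p - 1` synchronously evaluate fixed expressions, reading the
shared memory as it was before the round, and then write. Concurrent reads and concurrent writes
are allowed; when several processors write to the same cell, an arbitrary one of them succeeds.
Every node of an expression is one unit-cost instruction (word arithmetic or a memory read).
-/

namespace PRAM

/-- The shared memory: `m a i` is the content of cell `i` of array `a`. -/
abbrev Mem := ℕ → ℕ → ℕ

/-- Unit-cost instructions on words. -/
inductive Op
  | add | sub | mul | div | mod | lt | eq

/-- The result of an instruction, reduced to a `w`-bit word (`sub` is truncated at `0`,
division by `0` gives `0`, comparisons give `1` or `0`). -/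
def Op.eval (w : ℕ) (o : Op) (x y : ℕ) : ℕ :=
  match o with
  | .add => (x + y) % 2 ^ w
  | .sub => (x - y) % 2 ^ w
  | .mul => (x * y) % 2 ^ w
  | .div => (x / y) % 2 ^ w
  | .mod => (x % y) % 2 ^ w
  | .lt => (if x < y then 1 else 0) % 2 ^ w
  | .eq => (if x = y then 1 else 0) % 2 ^ w

/-- Expressions that a processor evaluates. -/
inductive Expr
  | const (k : ℕ)
  | pid
  | load (arr : ℕ) (addr : Expr)
  | bin (o : Op) (x y : Expr)

/-- The value of an expression for the processor with identifier `i`. -/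
def Expr.eval (w : ℕ) (m : Mem) (i : ℕ) : Expr → ℕ
  | .const k => k % 2 ^ w
  | .pid => i
  | .load arr addr => m arr (addr.eval w m i)
  | .bin o x y => o.eval w (x.eval w m i) (y.eval w m i)

/-- The number of unit-cost instructions needed to evaluate an expression. -/
def Expr.cost : Expr → ℕ
  | .const _ => 1
  | .pid => 1
  | .load _ addr => addr.cost + 1
  | .bin _ x y => x.cost + y.cost + 1

/-- Programs. `round count guard arr addr val` is the parallel round in which every processor
`i < count` whose `guard` is nonzero writes the word `val` to cell `addr` of array `arr`; `count`
and the tests of `ite` and `loop` are evaluated by processor `0`. -/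
inductive Prog
  | round (count guard : Expr) (arr : ℕ) (addr val : Expr)
  | seq (p q : Prog)
  | ite (test : Expr) (p q : Prog)
  | loop (test : Expr) (body : Prog)

/-- The processors among `0, …, p - 1` that write to cell `x`. -/
def writers (p : ℕ) (guard addr : ℕ → ℕ) (x : ℕ) : Finset ℕ :=
  (Finset.range p).filter fun i => guard i ≠ 0 ∧ addr i = x

/-- The content of cell `x` after the concurrent writes of a round. The processor `s` is the one
favoured by the machine; if it does not write to `x`, the first processor that does succeeds.
As `s` is arbitrary, so is the successful writer. -/
def resolve (p : ℕ) (guard addr val : ℕ → ℕ) (old : ℕ) (s : ℕ) (x : ℕ) : ℕ :=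
  if s ∈ writers p guard addr x then val s
  else if h : (writers p guard addr x).Nonempty then val ((writers p guard addr x).min' h)
  else old

/-- The memory after a parallel round with `p` processors. -/
def roundMem (w p : ℕ) (σ : ℕ → ℕ) (guard : Expr) (arr : ℕ) (addr val : Expr) (m : Mem) : Mem :=
  Function.update m arr fun x =>
    resolve p (guard.eval w m) (addr.eval w m) (val.eval w m) (m arr x) (σ x) x

/-- `Exec w σ P t m m' W D`: on the machine with `w`-bit words, the program `P`, started at time
`t` in memory `m`, terminates in memory `m'` after total work `W` (number of instructions, summed
over the processors) and depth `D` (number of parallel time steps). The policy `σ` resolves the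
write conflicts: `σ t x` is the processor favoured at cell `x` in a round that starts at time
`t`. -/
inductive Exec (w : ℕ) (σ : ℕ → ℕ → ℕ) : Prog → ℕ → Mem → Mem → ℕ → ℕ → Prop
  | round (count guard : Expr) (arr : ℕ) (addr val : Expr) (t : ℕ) (m : Mem) :
      Exec w σ (.round count guard arr addr val) t m
        (roundMem w (count.eval w m 0) (σ t) guard arr addr val m)
        (count.cost + count.eval w m 0 * (guard.cost + addr.cost + val.cost + 1))
        (count.cost + (guard.cost + addr.cost + val.cost + 1))
  | seq {P Q : Prog} {t : ℕ} {m m₁ m₂ : Mem} {W₁ D₁ W₂ D₂ : ℕ} :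
      Exec w σ P t m m₁ W₁ D₁ → Exec w σ Q (t + D₁) m₁ m₂ W₂ D₂ →
      Exec w σ (.seq P Q) t m m₂ (W₁ + W₂) (D₁ + D₂)
  | ite_true {test : Expr} {P Q : Prog} {t : ℕ} {m m₁ : Mem} {W D : ℕ} :
      test.eval w m 0 ≠ 0 → Exec w σ P (t + test.cost) m m₁ W D →
      Exec w σ (.ite test P Q) t m m₁ (test.cost + W) (test.cost + D)
  | ite_false {test : Expr} {P Q : Prog} {t : ℕ} {m m₁ : Mem} {W D : ℕ} :
      test.eval w m 0 = 0 → Exec w σ Q (t + test.cost) m m₁ W D →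
      Exec w σ (.ite test P Q) t m m₁ (test.cost + W) (test.cost + D)
  | loop_done {test : Expr} {P : Prog} {t : ℕ} {m : Mem} :
      test.eval w m 0 = 0 → Exec w σ (.loop test P) t m m test.cost test.cost
  | loop_step {test : Expr} {P : Prog} {t : ℕ} {m m₁ m₂ : Mem} {W₁ D₁ W₂ D₂ : ℕ} :
      test.eval w m 0 ≠ 0 → Exec w σ P (t + test.cost) m m₁ W₁ D₁ →
      Exec w σ (.loop test P) (t + test.cost + D₁) m₁ m₂ W₂ D₂ →
      Exec w σ (.loop test P) t m m₂ (test.cost + W₁ + W₂) (test.cost + D₁ + D₂)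

end PRAM

/-!
## Batch-dynamic data structures for orientations
-/

namespace BatchDynamic

open PRAM

/-- A deterministic parallel batch-dynamic data structure: one program for each operation. -/
structure DataStructure where
  init : Prog
  insert : Prog
  delete : Prog

/-- A batch: a list of edges on the vertices `0, …, n - 1`, each given by its two endpoints in
either order. -/
abbrev Batch (n : ℕ) := List (Fin n × Fin n)

/-- The undirected edges of a batch, as a list. -/
def Batch.edgeList {n : ℕ} (b : Batch n) : List (Sym2 (Fin n)) := b.map fun p => s(p.1, p.2)

/-- The set of undirected edges of a batch. -/
def Batch.edges {n : ℕ} (b : Batch n) : Set (Sym2 (Fin n)) := {e | e ∈ b.edgeList}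

/-- `b` is a batch of insertions for `G`: nonempty, without repetitions, and made of non-loops that
are not yet edges of `G`. -/
def IsInsertion {n : ℕ} (G : SimpleGraph (Fin n)) (b : Batch n) : Prop :=
  b ≠ [] ∧ b.edgeList.Nodup ∧ ∀ p ∈ b, p.1 ≠ p.2 ∧ ¬ G.Adj p.1 p.2

/-- `b` is a batch of deletions for `G`: nonempty, without repetitions, and made of edges
of `G`. -/
def IsDeletion {n : ℕ} (G : SimpleGraph (Fin n)) (b : Batch n) : Prop :=
  b ≠ [] ∧ b.edgeList.Nodup ∧ ∀ p ∈ b, G.Adj p.1 p.2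

/-- The graph after the insertion of a batch. -/
def insertBatch {n : ℕ} (G : SimpleGraph (Fin n)) (b : Batch n) : SimpleGraph (Fin n) :=
  G ⊔ SimpleGraph.fromEdgeSet b.edges

/-- The graph after the deletion of a batch. -/
def deleteBatch {n : ℕ} (G : SimpleGraph (Fin n)) (b : Batch n) : SimpleGraph (Fin n) :=
  G.deleteEdges b.edges

/-- The memory in which an operation is started. The input is placed in the arrays `0`, `1`, `2`:
array `0` holds `n`, `H` and the size of the batch, arrays `1` and `2` hold the first and the second
endpoints of its edges (and `0` elsewhere). All other arrays are as the previous operation left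
them. -/
def withInput (w n H : ℕ) (b : Batch n) (m : Mem) : Mem := fun a i =>
  match a with
  | 0 => [n, H, b.length].getD i 0 % 2 ^ w
  | 1 => (b.map fun p => (p.1 : ℕ)).getD i 0 % 2 ^ w
  | 2 => (b.map fun p => (p.2 : ℕ)).getD i 0 % 2 ^ w
  | a => m a i

/-- The orientation that the data structure exhibits, as an adjacency matrix stored in array `3`:
`u → v` is present iff cell `u * n + v` is nonzero. -/
def storedOrientation (n : ℕ) (m : Mem) : Digraph (Fin n) where
  Adj u v := m 3 ((u : ℕ) * n + (v : ℕ)) ≠ 0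

/-- `Reachable A w n H G m`: starting from the zero memory and the empty graph on `n` vertices,
the data structure `A` with parameter `H` on the machine with `w`-bit words can be in memory `m`
when the current graph is `G`, after the initialization and a finite sequence of batches of
insertions and deletions (for some resolution of the write conflicts). -/
inductive Reachable (A : DataStructure) (w n H : ℕ) : SimpleGraph (Fin n) → Mem → Prop
  | init {σ : ℕ → ℕ → ℕ} {m : Mem} {W D : ℕ} :
      Exec w σ A.init 0 (withInput w n H [] fun _ _ => 0) m W D →
      Reachable A w n H ⊥ m
  | insert {G : SimpleGraph (Fin n)} {b : Batch n} {σ : ℕ → ℕ → ℕ} {m m' : Mem} {W D : ℕ} :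
      Reachable A w n H G m → IsInsertion G b →
      Exec w σ A.insert 0 (withInput w n H b m) m' W D →
      Reachable A w n H (insertBatch G b) m'
  | delete {G : SimpleGraph (Fin n)} {b : Batch n} {σ : ℕ → ℕ → ℕ} {m m' : Mem} {W D : ℕ} :
      Reachable A w n H G m → IsDeletion G b →
      Exec w σ A.delete 0 (withInput w n H b m) m' W D →
      Reachable A w n H (deleteBatch G b) m'

/-- For every resolution `σ` of the write conflicts, the program `P` terminates when started in
memory `m`, with work at most `W` and depth at most `D`. -/
def RunsWithin (w : ℕ) (P : Prog) (m : Mem) (W D : ℝ) : Prop :=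
  ∀ σ : ℕ → ℕ → ℕ, ∃ (m' : Mem) (work depth : ℕ),
    Exec w σ P 0 m m' work depth ∧ (work : ℝ) ≤ W ∧ (depth : ℝ) ≤ D

end BatchDynamic

/-!
The orientation is maintained by playing token games in which `k` processors, one for each edge of
the batch, carry the tokens.

**Encoding.** Every vertex `u` has `H` slots. Array `3` holds, for every ordered pair `u, v`, its
class: `0` if there is no edge `u → v`, `s + 1` if the edge occupies slot `s` of `u` (a core edge),
and `H + 1` if it is a surplus edge, which is possible only if all slots of `u` are in use. Array
`4` holds the contents of the slots, and array `5` holds the degrees, where the degree of `u` is the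
number of its slots in use, hence its out-degree truncated at `H`. Array `6` holds tournament trees:
for every vertex and every class, they yield in constant time an in-neighbour of maximum degree in
this class (`root_spec`), and a surplus edge of the vertex (`top_spec`). After a change at a vertex,
the `O(H)` leaves that depend on it are refreshed in `O(H log n)` steps (`runs_refresh`,
`Inv.of_refreshed`); there are only `O(H)` of them because a surplus edge always has tail degree
`H`. The arrays from `10` on are registers, whose cell `i` belongs to processor `i`, and shared
scalars.

**Conflicts.** In a step of a game, all edges `x → v` that are reversed have the same class `j + 1`,
every vertex `v` asks for at most one edge, and the degree of `v` is smaller than that of `x` by at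
least two (`runs_moveAt`). For a core class `j < H`, every tail `x` loses at most one edge, because
its slot `j` holds only one. The surplus edges can be reversed all at once, since this does not
affect the degrees of their tails. When a core edge leaves its slot, a surplus edge of the same
vertex takes its place if there is one (`runs_flip`). So the degree of each vertex changes by at
most one.

**Token games.** Let `b` denote the degrees before a modification that changes each degree by at
most one. After a deletion, the tokens are the vertices with degree `b v - 1`; the violations of
balance are the edges `x → v` from a free vertex to a token with `b x = b v + 1`, and reversing such
an edge moves the token from `v` to `x`. After an insertion, the tokens are the vertices with degree
`b u + 1`; the violations are the edges `u → c` from a token to a free vertex with `b u = b c + 1`,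
and reversing such an edge moves the token from `u` to `c`. A game is played in rounds, and a round
treats the classes in decreasing order. An active path is a chain of edges with occupied start and
free end. Every vertex has a potential, which never increases and which decreases whenever the
vertex gains or loses a token. An active path after a step extends to an active path before the
step, by following the moves that changed its ends (`Slack.step`). As each active path contains a
possible move, it can survive a round only if one of its vertices changes its occupation. So the
maximum potential of an active path decreases from round to round (`Slack.next`). As `b` is strictly
monotone along the path and the potential of a vertex is at most `2 * H + 1`, the initial value is
at most `(H + 1) * (2 * H + 1)` (`Slack.init`), and this number of rounds, plus one, restores the
balance (`runs_rebalance`).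

The class of an edge that is not reversed changes only when a surplus edge is promoted to a slot. As
the surplus edges are treated first in every round, no edge escapes its treatment in this way.

**Deletion.** All edges of the batch are removed at once, but their slots remain in use, so that no
degree changes. For each slot number in turn, the edges that occupied this slot leave it, which
lowers each degree by at most one, and a game is played. That makes `H` games.

**Insertion.** In each of `2 * (H ^ 2 + 2 * H) + 1` sub-batches, every pending edge is proposed to
its end of smaller degree, every vertex of degree less than `H` accepts one proposal, and a game is
played. Each vertex has a credit of at most `H ^ 2 + 2 * H`, which never decreases and which
increases whenever the vertex accepts an edge (`credit_mono`). As long as an edge is pending and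
does not join two vertices of degree `H`, in each sub-batch one of its ends accepts an edge. So in
the end all pending edges join two vertices of degree `H`, and they are added as surplus edges.

**Costs.** A step of a game has depth `O(H log n)`, a round has `H + 1` steps, and a game has
`O(H^2)` rounds. So a game has depth `O(H^4 log n)`, a deletion `O(H^5 log n)`, and an insertion
`O(H^6 log n)`. As at most `k` processors are at work at any time, the work is at most `k` times the
depth. No overflow occurs, as all numbers are less than `(n + H) ^ 24`; this is a syntactic property
of the expressions (`Expr.nat_lt_and_eval_eq`).
-/

namespace PRAM

/-! ### A program logic for the machine -/

theorem Exec.det {w : ℕ} {σ : ℕ → ℕ → ℕ} {P : Prog} {t : ℕ} {m m₁ : Mem} {W₁ D₁ : ℕ}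
    (h₁ : Exec w σ P t m m₁ W₁ D₁) :
    ∀ {m₂ : Mem} {W₂ D₂ : ℕ}, Exec w σ P t m m₂ W₂ D₂ → m₁ = m₂ ∧ W₁ = W₂ ∧ D₁ = D₂ := by
  induction h₁ with
  | round => intro _ _ _ h; cases h; exact ⟨rfl, rfl, rfl⟩
  | seq _ _ ih₁ ih₂ =>
    intro _ _ _ h
    cases h with
    | seq a b =>
      obtain ⟨rfl, rfl, rfl⟩ := ih₁ a
      obtain ⟨rfl, rfl, rfl⟩ := ih₂ b
      exact ⟨rfl, rfl, rfl⟩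
  | ite_true ht _ ih =>
    intro _ _ _ h
    cases h with
    | ite_true _ a => obtain ⟨rfl, rfl, rfl⟩ := ih a; exact ⟨rfl, rfl, rfl⟩
    | ite_false h' _ => exact absurd h' ht
  | ite_false ht _ ih =>
    intro _ _ _ h
    cases h with
    | ite_true h' _ => exact absurd ht h'
    | ite_false _ a => obtain ⟨rfl, rfl, rfl⟩ := ih a; exact ⟨rfl, rfl, rfl⟩
  | loop_done ht =>
    intro _ _ _ h
    cases h with
    | loop_done => exact ⟨rfl, rfl, rfl⟩
    | loop_step h' _ _ => exact absurd ht h'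
  | loop_step ht _ _ ih₁ ih₂ =>
    intro _ _ _ h
    cases h with
    | loop_done h' => exact absurd h' ht
    | loop_step _ a b =>
      obtain ⟨rfl, rfl, rfl⟩ := ih₁ a
      obtain ⟨rfl, rfl, rfl⟩ := ih₂ b
      exact ⟨rfl, rfl, rfl⟩

/-- The result of an instruction on unbounded natural numbers. -/
def Op.nat (o : Op) (x y : ℕ) : ℕ :=
  match o with
  | .add => x + y
  | .sub => x - y
  | .mul => x * y
  | .div => x / y
  | .mod => x % y
  | .lt => if x < y then 1 else 0
  | .eq => if x = y then 1 else 0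

/-- The value of an expression, computed in unbounded natural numbers. -/
def Expr.nat (m : Mem) (i : ℕ) : Expr → ℕ
  | .const c => c
  | .pid => i
  | .load a e => m a (e.nat m i)
  | .bin o x y => o.nat (x.nat m i) (y.nat m i)

/-- The arrays that hold large words (values and node addresses of the search trees, and loop
counters); all other arrays hold words below `Q ^ 2`. -/
def arrGrade (a : ℕ) : ℕ := if a = 6 ∨ 40 ≤ a then 12 else 2

/-- Every cell of array `a` is below `Q ^ arrGrade a`. -/
def Bounded (Q : ℕ) (m : Mem) : Prop := ∀ a i, m a i < Q ^ arrGrade a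

/-- A syntactic bound: in a `Bounded Q` memory, the value is below `Q ^ e.grade`. -/
def Expr.grade : Expr → ℕ
  | .const c => c
  | .pid => 2
  | .load a _ => arrGrade a
  | .bin .add x y => max x.grade y.grade + 1
  | .bin .sub x _ => x.grade
  | .bin .mul x y => x.grade + y.grade
  | .bin .div x _ => x.grade
  | .bin .mod x _ => x.grade
  | .bin .lt _ _ => 1
  | .bin .eq _ _ => 1

/-- The expression and all its subexpressions have grade at most `24`, so that no overflow can
occur on words that hold the numbers below `Q ^ 24`. -/
def Expr.safe : Expr → Bool
  | .const c => c ≤ 24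
  | .pid => true
  | .load _ e => e.safe
  | .bin o x y => x.safe && y.safe && (Expr.bin o x y).grade ≤ 24

theorem Expr.nat_lt_and_eval_eq {w Q : ℕ} {m : Mem} {i : ℕ} (hQ : 2 ≤ Q) (hw : Q ^ 24 ≤ 2 ^ w)
    (hm : Bounded Q m) (hi : i < Q ^ 2) :
    ∀ e : Expr, e.safe = true → e.nat m i < Q ^ e.grade ∧ e.eval w m i = e.nat m i := by
  have hle : ∀ {x g : ℕ}, g ≤ 24 → x < Q ^ g → x < 2 ^ w := fun hg hx =>
    hx.trans_le ((Nat.pow_le_pow_right (by omega) hg).trans hw)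
  intro e
  induction e with
  | const c =>
    intro h
    have hc : c < Q ^ c := (Nat.lt_two_pow_self).trans_le (Nat.pow_le_pow_left hQ c)
    refine ⟨hc, Nat.mod_eq_of_lt (hle ?_ hc)⟩
    simpa [Expr.safe] using h
  | pid => intro _; exact ⟨hi, rfl⟩
  | load a e ih =>
    intro h
    simp only [Expr.safe] at h
    refine ⟨hm _ _, ?_⟩
    simp only [Expr.eval, Expr.nat, (ih h).2]
  | bin o x y ihx ihy =>
    intro h
    simp only [Expr.safe, Bool.and_eq_true, decide_eq_true_eq] at h
    obtain ⟨⟨hx, hy⟩, hg⟩ := h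
    obtain ⟨hx1, hx2⟩ := ihx hx
    obtain ⟨hy1, hy2⟩ := ihy hy
    have key : (Expr.bin o x y).nat m i < Q ^ (Expr.bin o x y).grade := by
      simp only [Expr.nat]
      cases o
      · simp only [Op.nat, Expr.grade, pow_succ]
        have h1 : Q ^ x.grade ≤ Q ^ max x.grade y.grade :=
          Nat.pow_le_pow_right (by omega) (le_max_left _ _)
        have h2 : Q ^ y.grade ≤ Q ^ max x.grade y.grade :=
          Nat.pow_le_pow_right (by omega) (le_max_right _ _)
        nlinarith
      · exact (Nat.sub_le _ _).trans_lt hx1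
      · simp only [Op.nat, Expr.grade, pow_add]
        exact Nat.mul_lt_mul'' hx1 hy1
      · exact (Nat.div_le_self _ _).trans_lt hx1
      · exact (Nat.mod_le _ _).trans_lt hx1
      all_goals
        simp only [Op.nat, Expr.grade, pow_one]
        split_ifs <;> omega
    refine ⟨key, ?_⟩
    have := hle hg key
    simp only [Expr.eval, Expr.nat, hx2, hy2] at this ⊢
    cases o <;> exact Nat.mod_eq_of_lt this

/-- The parameters of an operation on a batch: `n` vertices, threshold `H`, batch size `k`, and
word size `w`. -/
structure Env where
  n : ℕ
  H : ℕ
  k : ℕ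
  w : ℕ
  two_le_n : 2 ≤ n
  one_le_H : 1 ≤ H
  one_le_k : 1 ≤ k
  k_le : k ≤ n ^ 2
  word : (n + H) ^ 24 ≤ 2 ^ w

namespace Env

variable (E : Env)

/-- The base of all bounds on words. -/
abbrev Q : ℕ := E.n + E.H

/-- The memory holds the parameters of the operation and is bounded. -/
structure Ok (m : Mem) : Prop where
  n : m 0 0 = E.n
  H : m 0 1 = E.H
  k : m 0 2 = E.k
  bdd : Bounded E.Q m

/-- Started in memory `m`, for every resolution of the write conflicts the program `P` ends after at
most `D` time steps in a memory satisfying `R`, and at every time step at most `k` processors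
work. -/
def Runs (P : Prog) (m : Mem) (D : ℕ) (R : Mem → Prop) : Prop :=
  ∀ σ t, ∃ m' W' D', Exec E.w σ P t m m' W' D' ∧ W' ≤ E.k * D' ∧ D' ≤ D ∧ R m'

variable {E}

theorem Runs.mono {P : Prog} {m : Mem} {D D' : ℕ} {R R' : Mem → Prop} (h : E.Runs P m D R)
    (hD : D ≤ D') (hR : ∀ m', R m' → R' m') : E.Runs P m D' R' := fun σ t => by
  obtain ⟨m', W, T, h1, h2, h3, h4⟩ := h σ t
  exact ⟨m', W, T, h1, h2, h3.trans hD, hR _ h4⟩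

theorem Runs.seq {P P' : Prog} {m : Mem} {D D' : ℕ} {R R' : Mem → Prop} (h : E.Runs P m D R)
    (h' : ∀ m', R m' → E.Runs P' m' D' R') : E.Runs (.seq P P') m (D + D') R' := fun σ t => by
  obtain ⟨m₁, W, T, h1, h2, h3, h4⟩ := h σ t
  obtain ⟨m₂, W', T', h1', h2', h3', h4'⟩ := h' m₁ h4 σ (t + T)
  exact ⟨m₂, _, _, .seq h1 h1', by rw [mul_add]; omega, by omega, h4'⟩

theorem Q_ge : 3 ≤ E.Q := by have := E.two_le_n; have := E.one_le_H; unfold Q; omega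

theorem two_le_Q : 2 ≤ E.Q := (by norm_num : 2 ≤ 3).trans E.Q_ge

theorem k_lt : E.k < E.Q ^ 2 := by
  have h1 := E.k_le; have h2 := E.one_le_H; have h3 := E.two_le_n
  have : E.n ^ 2 < (E.n + E.H) ^ 2 := Nat.pow_lt_pow_left (by omega) (by omega)
  exact h1.trans_lt this

theorem Ok.nat_lt {m : Mem} (hm : E.Ok m) {i : ℕ} (hi : i < E.k) {e : Expr}
    (he : e.safe = true) : e.nat m i < E.Q ^ e.grade :=
  (Expr.nat_lt_and_eval_eq E.two_le_Q E.word hm.bdd (hi.trans E.k_lt) e he).1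

theorem Ok.eval_eq {m : Mem} (hm : E.Ok m) {i : ℕ} (hi : i < E.k) {e : Expr}
    (he : e.safe = true) : e.eval E.w m i = e.nat m i :=
  (Expr.nat_lt_and_eval_eq E.two_le_Q E.word hm.bdd (hi.trans E.k_lt) e he).2

theorem Ok.lt_of_grade {m : Mem} (hm : E.Ok m) {i : ℕ} (hi : i < E.k) {e : Expr} {a : ℕ}
    (he : (e.safe && decide (e.grade ≤ arrGrade a)) = true) : e.nat m i < E.Q ^ arrGrade a := by
  simp only [Bool.and_eq_true, decide_eq_true_eq] at he
  exact (hm.nat_lt hi he.1).trans_le (Nat.pow_le_pow_right (zero_lt_two.trans_le E.two_le_Q) he.2)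

/-- What a parallel round with `p` processors can do to an array with old content `old`. -/
def Written (p : ℕ) (guard addr val : ℕ → ℕ) (old f : ℕ → ℕ) : Prop :=
  ∀ x, (∃ i < p, guard i ≠ 0 ∧ addr i = x ∧ f x = val i) ∨
    ((∀ i < p, guard i ≠ 0 → addr i ≠ x) ∧ f x = old x)

theorem written_resolve (p : ℕ) (guard addr val old : ℕ → ℕ) (s : ℕ → ℕ) :
    Written p guard addr val old fun x => resolve p guard addr val (old x) (s x) x := by
  intro x
  have hmem : ∀ i, i ∈ writers p guard addr x ↔ i < p ∧ guard i ≠ 0 ∧ addr i = x := by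
    intro i; simp [writers]
  simp only [resolve]
  split_ifs with h1 h2
  · obtain ⟨a, b, c⟩ := (hmem _).1 h1
    exact .inl ⟨_, a, b, c, rfl⟩
  · obtain ⟨a, b, c⟩ := (hmem _).1 (Finset.min'_mem _ h2)
    exact .inl ⟨_, a, b, c, rfl⟩
  · refine .inr ⟨fun i hi hg ha => h2 ⟨i, (hmem _).2 ⟨hi, hg, ha⟩⟩, rfl⟩

theorem Written.congr {p : ℕ} {guard addr val guard' addr' val' old f : ℕ → ℕ}
    (h : Written p guard addr val old f) (hg : ∀ i < p, guard i = guard' i)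
    (ha : ∀ i < p, addr i = addr' i) (hv : ∀ i < p, val i = val' i) :
    Written p guard' addr' val' old f := by
  intro x
  rcases h x with ⟨i, hi, h1, h2, h3⟩ | ⟨h1, h2⟩
  · exact .inl ⟨i, hi, hg i hi ▸ h1, ha i hi ▸ h2, hv i hi ▸ h3⟩
  · exact .inr ⟨fun i hi => by rw [← hg i hi, ← ha i hi]; exact h1 i hi, h2⟩

theorem Runs.round {count guard addr val : Expr} {arr : ℕ} {m : Mem} {R : Mem → Prop} {p D : ℕ}
    (hm : E.Ok m)
    (hsafe : (count.safe && guard.safe && addr.safe && val.safe && decide (arr ≠ 0)) = true)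
    (hcount : count.nat m 0 = p) (hp : p ≤ E.k)
    (hD : count.cost + (guard.cost + addr.cost + val.cost + 1) ≤ D)
    (hval : ∀ i < p, guard.nat m i ≠ 0 → val.nat m i < E.Q ^ arrGrade arr)
    (hR : ∀ f, Written p (guard.nat m) (addr.nat m) (val.nat m) (m arr) f →
      E.Ok (Function.update m arr f) → R (Function.update m arr f)) :
    E.Runs (.round count guard arr addr val) m D R := by
  simp only [Bool.and_eq_true, decide_eq_true_eq] at hsafe
  obtain ⟨⟨⟨⟨s1, s2⟩, s3⟩, s4⟩, s5⟩ := hsafe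
  intro σ t
  have hk := E.one_le_k
  have hc : count.eval E.w m 0 = p := by rw [hm.eval_eq (by omega) s1, hcount]
  refine ⟨_, _, _, .round count guard arr addr val t m, ?_, hD, ?_⟩
  · rw [hc, mul_add E.k]
    exact Nat.add_le_add (Nat.le_mul_of_pos_left _ (by omega)) (Nat.mul_le_mul_right _ hp)
  · have hw : Written p (guard.nat m) (addr.nat m) (val.nat m) (m arr)
        (fun x => resolve p (guard.eval E.w m) (addr.eval E.w m) (val.eval E.w m) (m arr x)
          (σ t x) x) :=
      (written_resolve _ _ _ _ _ _).congr (fun i hi => hm.eval_eq (hi.trans_le hp) s2)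
        (fun i hi => hm.eval_eq (hi.trans_le hp) s3) (fun i hi => hm.eval_eq (hi.trans_le hp) s4)
    rw [roundMem, hc]
    refine hR _ hw ⟨?_, ?_, ?_, ?_⟩
    · rw [Function.update_of_ne (Ne.symm s5)]; exact hm.n
    · rw [Function.update_of_ne (Ne.symm s5)]; exact hm.H
    · rw [Function.update_of_ne (Ne.symm s5)]; exact hm.k
    · intro a x
      rcases eq_or_ne a arr with rfl | ha
      · rw [Function.update_self]
        rcases hw x with ⟨i, hi, h1, _, h3⟩ | ⟨_, h2⟩
        · exact h3.trans_lt (hval i hi h1)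
        · exact h2.trans_lt (hm.bdd _ _)
      · rw [Function.update_of_ne ha]; exact hm.bdd _ _

end Env

/-! ### Program building blocks -/

/-- The parameter `n`. -/
abbrev eN : Expr := .load 0 (.const 0)
/-- The parameter `H`. -/
abbrev eH : Expr := .load 0 (.const 1)
/-- The batch size, which is the number of processors in use. -/
abbrev eK : Expr := .load 0 (.const 2)
/-- The private register `r` of the processor: its own cell of array `r`. -/
abbrev reg (r : ℕ) : Expr := .load r .pid
/-- The shared scalar `r`, stored in cell `0` of array `r`. -/
abbrev sca (r : ℕ) : Expr := .load r (.const 0)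
abbrev eAdd (x y : Expr) : Expr := .bin .add x y
abbrev eSub (x y : Expr) : Expr := .bin .sub x y
abbrev eMul (x y : Expr) : Expr := .bin .mul x y
abbrev eDiv (x y : Expr) : Expr := .bin .div x y
abbrev eMod (x y : Expr) : Expr := .bin .mod x y
abbrev eLt (x y : Expr) : Expr := .bin .lt x y
abbrev eEq (x y : Expr) : Expr := .bin .eq x y

/-- Every processor whose guard holds writes to an array. -/
abbrev put (guard : Expr) (arr : ℕ) (addr val : Expr) : Prog := .round eK guard arr addr val
/-- Every processor whose guard holds sets its register. -/
abbrev setIf (guard : Expr) (r : ℕ) (val : Expr) : Prog := .round eK guard r .pid val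
/-- Every processor sets its register. -/
abbrev set (r : ℕ) (val : Expr) : Prog := .round eK (.const 1) r .pid val
/-- A shared scalar is set. -/
abbrev setSca (r : ℕ) (val : Expr) : Prog := .round (.const 1) (.const 1) r (.const 0) val
/-- The loop that counts the scalar `r` down to `0`. -/
abbrev countdown (r : ℕ) (body : Prog) : Prog :=
  .loop (sca r) (.seq (setSca r (eSub (sca r) (.const 1))) body)

namespace Env

variable {E : Env}

theorem Runs.put {guard addr val : Expr} {arr : ℕ} {m : Mem} {R : Mem → Prop} {D : ℕ}
    (hm : E.Ok m) (hsafe : (guard.safe && addr.safe && val.safe && decide (arr ≠ 0)) = true)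
    (hD : guard.cost + addr.cost + val.cost + 3 ≤ D)
    (hval : ∀ i < E.k, guard.nat m i ≠ 0 → val.nat m i < E.Q ^ arrGrade arr)
    (hR : ∀ f, Written E.k (guard.nat m) (addr.nat m) (val.nat m) (m arr) f →
      E.Ok (Function.update m arr f) → R (Function.update m arr f)) :
    E.Runs (put guard arr addr val) m D R := by
  refine Runs.round hm (p := E.k) ?_ hm.k le_rfl ?_ hval hR
  · simpa [Expr.safe] using hsafe
  · simp only [Expr.cost]; omega

theorem Runs.setIf {guard val : Expr} {r : ℕ} {m : Mem} {R : Mem → Prop} {D : ℕ}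
    (hm : E.Ok m) (hsafe : (guard.safe && val.safe && decide (r ≠ 0)) = true)
    (hD : guard.cost + val.cost + 4 ≤ D)
    (hval : ∀ i < E.k, guard.nat m i ≠ 0 → val.nat m i < E.Q ^ arrGrade r)
    (hR : ∀ m', E.Ok m' → (∀ a ≠ r, m' a = m a) →
      (∀ i < E.k, m' r i = if guard.nat m i ≠ 0 then val.nat m i else m r i) → R m') :
    E.Runs (setIf guard r val) m D R := by
  refine Runs.put hm ?_ ?_ hval fun f hf hok => hR _ hok (fun a ha => Function.update_of_ne ha _ _)
    fun i hi => ?_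
  · simpa [Expr.safe] using hsafe
  · simp only [Expr.cost]; omega
  · rw [Function.update_self]
    rcases hf i with ⟨j, _, h1, h2, h3⟩ | ⟨h1, h2⟩
    · obtain rfl : j = i := h2
      rw [if_pos h1, h3]
    · rw [if_neg fun h => h1 i hi h rfl, h2]

theorem Runs.set {val : Expr} {r : ℕ} {m : Mem} {R : Mem → Prop} {D : ℕ}
    (hm : E.Ok m) (hsafe : (val.safe && decide (r ≠ 0)) = true) (hD : val.cost + 5 ≤ D)
    (hval : ∀ i < E.k, val.nat m i < E.Q ^ arrGrade r)
    (hR : ∀ m', E.Ok m' → (∀ a ≠ r, m' a = m a) → (∀ i < E.k, m' r i = val.nat m i) → R m') :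
    E.Runs (set r val) m D R := by
  refine Runs.setIf hm ?_ ?_ (fun i hi _ => hval i hi) fun m' h1 h2 h3 => hR m' h1 h2 fun i hi => ?_
  · simpa [Expr.safe] using hsafe
  · simp only [Expr.cost]; omega
  · rw [h3 i hi, if_pos (by simp [Expr.nat])]

theorem Runs.setSca {val : Expr} {r : ℕ} {m : Mem} {R : Mem → Prop} {D : ℕ}
    (hm : E.Ok m) (hsafe : (val.safe && decide (r ≠ 0)) = true) (hD : val.cost + 4 ≤ D)
    (hval : val.nat m 0 < E.Q ^ arrGrade r)
    (hR : ∀ m', E.Ok m' → (∀ a ≠ r, m' a = m a) → m' r 0 = val.nat m 0 → R m') :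
    E.Runs (setSca r val) m D R := by
  refine Runs.round hm (p := 1) ?_ rfl E.one_le_k ?_ ?_ fun f hf hok => hR _ hok
    (fun a ha => Function.update_of_ne ha _ _) ?_
  · simpa [Expr.safe] using hsafe
  · simp only [Expr.cost]; omega
  · intro i hi _
    obtain rfl : i = 0 := by omega
    exact hval
  · rw [Function.update_self]
    rcases hf 0 with ⟨j, hj, h1, h2, h3⟩ | ⟨h1, h2⟩
    · obtain rfl : j = 0 := by omega
      exact h3
    · exact absurd rfl (h1 0 (by omega) (by simp [Expr.nat]))

/-- The rule for a loop that terminates after `N` iterations; `I q` holds when `q` iterations are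
left. -/
theorem Runs.loop {test : Expr} {body : Prog} {D : ℕ} {I : ℕ → Mem → Prop}
    (hok : ∀ q m, I q m → E.Ok m) (hs : test.safe = true)
    (hz : ∀ m, I 0 m → test.nat m 0 = 0) (hnz : ∀ q m, I (q + 1) m → test.nat m 0 ≠ 0)
    (hbody : ∀ q m, I (q + 1) m → E.Runs body m D (I q)) :
    ∀ N m, I N m → E.Runs (.loop test body) m (N * (D + test.cost) + test.cost) (I 0) := by
  have hk := E.one_le_k
  intro N
  induction N with
  | zero =>
    intro m h σ t
    refine ⟨m, _, _, .loop_done ?_, Nat.le_mul_of_pos_left _ (by omega), by omega, h⟩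
    rw [(hok _ _ h).eval_eq (by omega) hs, hz m h]
  | succ N ih =>
    intro m h σ t
    obtain ⟨m₁, W₁, D₁, a1, a2, a3, a4⟩ := hbody N m h σ (t + test.cost)
    obtain ⟨m₂, W₂, D₂, b1, b2, b3, b4⟩ := ih m₁ a4 σ (t + test.cost + D₁)
    refine ⟨m₂, _, _, .loop_step ?_ a1 b1, ?_, ?_, b4⟩
    · rw [(hok _ _ h).eval_eq (by omega) hs]; exact hnz N m h
    · have : test.cost ≤ E.k * test.cost := Nat.le_mul_of_pos_left _ (by omega)
      rw [mul_add, mul_add]; omega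
    · have : (N + 1) * (D + test.cost) = N * (D + test.cost) + (D + test.cost) := by ring
      omega

theorem Runs.countdown {r : ℕ} {body : Prog} {D : ℕ} {I : ℕ → Mem → Prop} (hr : r ≠ 0)
    (hok : ∀ q m, I q m → E.Ok m) (hc : ∀ q m, I q m → m r 0 = q)
    (hbody : ∀ q m m', I (q + 1) m → E.Ok m' → (∀ a ≠ r, m' a = m a) → m' r 0 = q →
      E.Runs body m' D (I q)) (N : ℕ) (m : Mem) (hI : I N m) :
    E.Runs (countdown r body) m (N * (D + 10) + 2) (I 0) := by
  refine (Runs.loop (I := I) (test := sca r) (D := 8 + D) hok rfl (fun m h => hc 0 m h)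
    (fun q m h => by simp only [Expr.nat]; rw [hc _ m h]; omega) (fun q m h => ?_) N m hI).mono
    ?_ fun _ h => h
  · refine Runs.seq (R := fun m' => E.Ok m' ∧ (∀ a ≠ r, m' a = m a) ∧ m' r 0 = q)
      (Runs.setSca (hok _ _ h) ?_ ?_ ?_ fun m' h1 h2 h3 => ⟨h1, h2, ?_⟩) fun m' h' =>
        hbody q m m' h h'.1 h'.2.1 h'.2.2
    · have : arrGrade r ≤ 24 := by unfold arrGrade; split_ifs <;> omega
      simp [Expr.safe, Expr.grade, hr, this]
    · simp [Expr.cost]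
    · simp only [Expr.nat, Op.nat]
      exact (Nat.sub_le _ _).trans_lt ((hok _ _ h).bdd r 0)
    · rw [h3]; simp only [Expr.nat, Op.nat]; rw [hc _ m h]; rfl
  · simp only [Expr.cost]
    have : N * (8 + D + (1 + 1)) = N * (D + 10) := by ring
    omega

end Env

/-! ### The memory layout and the search trees -/

namespace Env

variable (E : Env)

/-- The class of the ordered pair `(u, v)`: `0` if there is no edge `u → v`, `s + 1` if this edge
occupies the core slot `s < H` of `u`, and `H + 1` if it is a surplus edge of `u`. This matrix is
the stored orientation. -/
abbrev cls (m : Mem) (u v : ℕ) : ℕ := m 3 (u * E.n + v)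

/-- The content of slot `s < H` of `u`: `v + 1` if it is taken by the edge `u → v`, and `0` if it
is free. -/
abbrev out (m : Mem) (u s : ℕ) : ℕ := m 4 (u * E.H + s)

/-- The number of slots of `u` in use, which is the out-degree of `u` truncated at `H`. -/
abbrev deg (m : Mem) (u : ℕ) : ℕ := m 5 u

/-- Node `z` of the search tree with number `t`. The root is node `1`, the children of `z` are
`2 * z` and `2 * z + 1`, and the leaves are the nodes `n, …, 2 * n - 1`. -/
abbrev tree (m : Mem) (t z : ℕ) : ℕ := m 6 (t * (2 * E.n) + z)

/-- The number of the tree of vertex `y` and class `c ≤ H + 1`. -/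
abbrev tid (y c : ℕ) : ℕ := y * (E.H + 2) + c

/-- The value that leaf `x` of the tree of vertex `y` and class `c` should have. The tree of class
`c ≤ H` holds the in-neighbours `x` of `y` whose edge has class `c + 1`, ordered by degree;
the tree of class `H + 1` holds the heads `x` of the surplus edges of `y`. In both cases `x` is the
remainder modulo `n`. -/
def leafVal (m : Mem) (y c x : ℕ) : ℕ :=
  if c ≤ E.H then if E.cls m x y = c + 1 then (deg m x + 1) * E.n + x else 0
  else if E.cls m y x = E.H + 1 then E.n + x else 0

/-- The leaf `x` of the tree of vertex `y` and class `c` is up to date. -/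
def Good (m : Mem) (y c x : ℕ) : Prop := E.tree m (E.tid y c) (E.n + x) = E.leafVal m y c x

/-- Every inner node of every tree is the maximum of its two children. -/
def TreeOk (m : Mem) : Prop :=
  ∀ t z, 1 ≤ z → z < E.n → E.tree m t z = max (E.tree m t (2 * z)) (E.tree m t (2 * z + 1))

variable {E}

theorem leafVal_congr {m m' : Mem} (h3 : m' 3 = m 3) (h5 : m' 5 = m 5) (y c x : ℕ) :
    E.leafVal m' y c x = E.leafVal m y c x := by
  simp only [leafVal, cls, deg, h3, h5]

theorem pair_inj {a a' b c c' : ℕ} (hc : c < b) (hc' : c' < b) (h : a * b + c = a' * b + c') :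
    a = a' ∧ c = c' := by
  have h1 : (a * b + c) / b = a := by
    rw [Nat.add_comm, Nat.add_mul_div_right _ _ (by omega), Nat.div_eq_of_lt hc, Nat.zero_add]
  have h2 : (a' * b + c') / b = a' := by
    rw [Nat.add_comm, Nat.add_mul_div_right _ _ (by omega), Nat.div_eq_of_lt hc', Nat.zero_add]
  have : a = a' := by rw [← h1, ← h2, h]
  subst this
  exact ⟨rfl, by omega⟩

/-- A round that writes to cells `(A i, B i)` of a matrix with rows of length `b`. -/
theorem Written.matrix {p b : ℕ} {guard addr val old f A B : ℕ → ℕ}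
    (h : Written p guard addr val old f)
    (hB : ∀ i < p, guard i ≠ 0 → addr i = A i * b + B i ∧ B i < b) (a c : ℕ) (hc : c < b) :
    (∃ i < p, guard i ≠ 0 ∧ A i = a ∧ B i = c ∧ f (a * b + c) = val i) ∨
    ((∀ i < p, guard i ≠ 0 → ¬ (A i = a ∧ B i = c)) ∧ f (a * b + c) = old (a * b + c)) := by
  rcases h (a * b + c) with ⟨i, hi, hg, ha, hv⟩ | ⟨h1, h2⟩
  · obtain ⟨e, hb⟩ := hB i hi hg
    obtain ⟨e1, e2⟩ := pair_inj hb hc (e ▸ ha)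
    exact .inl ⟨i, hi, hg, e1, e2, hv⟩
  · refine .inr ⟨fun i hi hg hh => h1 i hi hg ?_, h2⟩
    rw [(hB i hi hg).1, hh.1, hh.2]

theorem tree_le_root {m : Mem} (hT : E.TreeOk m) (t : ℕ) :
    ∀ z, 1 ≤ z → z < 2 * E.n → E.tree m t z ≤ E.tree m t 1 := by
  intro z
  induction z using Nat.strong_induction_on with
  | _ z ih =>
    intro h1 h2
    rcases h1.eq_or_lt with rfl | h1
    · exact le_rfl
    · have := hT t (z / 2) (by omega) (by omega)
      refine le_trans ?_ (ih (z / 2) (by omega) (by omega) (by omega))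
      rw [this]
      rcases Nat.even_or_odd' z with ⟨q, rfl | rfl⟩
      · rw [show 2 * q / 2 = q by omega]; exact le_max_left _ _
      · rw [show (2 * q + 1) / 2 = q by omega]; exact le_max_right _ _

theorem exists_leaf_eq {m : Mem} (hT : E.TreeOk m) (t : ℕ) :
    ∀ d z, 2 * E.n - z = d → 1 ≤ z → z < 2 * E.n →
      ∃ x < E.n, E.tree m t z = E.tree m t (E.n + x) := by
  intro d
  induction d using Nat.strong_induction_on with
  | _ d ih =>
    intro z hd h1 h2
    by_cases hz : E.n ≤ z
    · exact ⟨z - E.n, by omega, by rw [Nat.add_sub_cancel' hz]⟩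
    · have := hT t z h1 (by omega)
      rcases max_choice (E.tree m t (2 * z)) (E.tree m t (2 * z + 1)) with h | h
      · obtain ⟨x, hx, e⟩ := ih _ (by omega) (2 * z) rfl (by omega) (by omega)
        exact ⟨x, hx, by rw [this, h, e]⟩
      · obtain ⟨x, hx, e⟩ := ih _ (by omega) (2 * z + 1) rfl (by omega) (by omega)
        exact ⟨x, hx, by rw [this, h, e]⟩

end Env

/-- The value of the leaf that is described by the registers `16` (vertex), `17` (class) and
`18` (leaf). -/
def leafExpr : Expr :=
  eAdd
    (eMul (eMul (eLt (reg 17) (eAdd eH (.const 1)))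
        (eEq (.load 3 (eAdd (eMul (reg 18) eN) (reg 16))) (eAdd (reg 17) (.const 1))))
      (eAdd (eMul (eAdd (.load 5 (reg 18)) (.const 1)) eN) (reg 18)))
    (eMul (eMul (eEq (reg 17) (eAdd eH (.const 1)))
        (eEq (.load 3 (eAdd (eMul (reg 16) eN) (reg 18))) (eAdd eH (.const 1))))
      (eAdd eN (reg 18)))

/-- One step of the walk from a leaf to the root: move to the parent node and recompute it. -/
def climb : Prog :=
  .seq (setSca 45 (eDiv (sca 45) (.const 2))) <|
  .seq (set 40 (eDiv (reg 40) (.const 2))) <|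
  put (reg 19) 6 (eAdd (reg 41) (reg 40))
    (eAdd (.load 6 (eAdd (reg 41) (eMul (.const 2) (reg 40))))
      (eSub (.load 6 (eAdd (eAdd (reg 41) (eMul (.const 2) (reg 40))) (.const 1)))
        (.load 6 (eAdd (reg 41) (eMul (.const 2) (reg 40))))))

/-- Every processor with nonzero register `19` brings the leaf given by its registers `16`, `17`,
`18`, and all ancestors of this leaf, up to date. -/
def touch : Prog :=
  .seq (set 40 (eAdd eN (reg 18))) <|
  .seq (set 41 (eMul (eAdd (eMul (reg 16) (eAdd eH (.const 2))) (reg 17)) (eMul (.const 2) eN))) <|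
  .seq (set 42 leafExpr) <|
  .seq (put (reg 19) 6 (eAdd (reg 41) (reg 40)) (reg 42)) <|
  .seq (setSca 45 eN) <|
  .loop (sca 45) climb

namespace Env

variable {E : Env}

theorem leafExpr_nat {m : Mem} (hm : E.Ok m) {i : ℕ} (hc : m 17 i ≤ E.H + 1) :
    leafExpr.nat m i = E.leafVal m (m 16 i) (m 17 i) (m 18 i) := by
  simp only [leafExpr, Expr.nat, Op.nat, leafVal, hm.n, hm.H]
  by_cases h : m 17 i ≤ E.H
  · rw [if_pos (by omega : m 17 i < E.H + 1), if_neg (by omega : ¬ m 17 i = E.H + 1), if_pos h]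
    split_ifs <;> simp
  · rw [if_neg (by omega : ¬ m 17 i < E.H + 1), if_pos (by omega : m 17 i = E.H + 1), if_neg h]
    split_ifs <;> simp

/-- The state of the trees after the walks have been at height `t`: an inner node is correct unless
it will still be visited. -/
structure Climbing (m₀ m : Mem) (t : ℕ) : Prop where
  ok : E.Ok m
  frame : ∀ a, a ∉ [6, 40, 45] → m a = m₀ a
  scalar : m 45 0 = E.n / 2 ^ t
  node : ∀ i < E.k, m 40 i = (E.n + m₀ 18 i) / 2 ^ t
  leaf : ∀ a z, E.n ≤ z → z < 2 * E.n → E.tree m a z = E.tree m₀ a z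
  inner : ∀ a z, 1 ≤ z → z < E.n →
    (∀ i < E.k, m₀ 19 i ≠ 0 → E.tid (m₀ 16 i) (m₀ 17 i) = a →
      ∀ t' > t, (E.n + m₀ 18 i) / 2 ^ t' ≠ z) →
    E.tree m a z = max (E.tree m a (2 * z)) (E.tree m a (2 * z + 1))

theorem runs_climb {m₀ m : Mem} {t : ℕ}
    (h41 : ∀ i < E.k, m₀ 41 i = E.tid (m₀ 16 i) (m₀ 17 i) * (2 * E.n))
    (hv : ∀ i < E.k, m₀ 19 i ≠ 0 → m₀ 18 i < E.n) (h : E.Climbing m₀ m t) :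
    E.Runs climb m 55 (fun m' => E.Climbing m₀ m' (t + 1)) := by
  have hhalf : ∀ x : ℕ, x / 2 ^ t / 2 = x / 2 ^ (t + 1) := fun x => by
    rw [Nat.div_div_eq_div_mul, pow_succ]
  unfold climb
  refine (Runs.seq (D := 8) (D' := 47) (R := fun m₁ => E.Ok m₁ ∧ (∀ a ≠ 45, m₁ a = m a) ∧
    m₁ 45 0 = E.n / 2 ^ (t + 1)) (Runs.setSca h.ok rfl (by simp [Expr.cost])
      (h.ok.lt_of_grade E.one_le_k rfl) fun m₁ a1 a2 a3 => ⟨a1, a2, ?_⟩) ?_).mono le_rfl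
    fun _ h => h
  · rw [a3]; simp only [Expr.nat, Op.nat]; rw [h.scalar, hhalf]
  rintro m₁ ⟨ok₁, f₁, s₁⟩
  refine Runs.seq (D := 9) (D' := 38) (R := fun m₂ => E.Ok m₂ ∧ (∀ a, a ∉ [45, 40] → m₂ a = m a) ∧
    m₂ 45 0 = E.n / 2 ^ (t + 1) ∧ ∀ i < E.k, m₂ 40 i = (E.n + m₀ 18 i) / 2 ^ (t + 1))
    (Runs.set ok₁ rfl (by simp [Expr.cost])
      (fun i hi => ok₁.lt_of_grade hi rfl) fun m₂ a1 a2 a3 => ⟨a1, ?_, ?_, ?_⟩) ?_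
  · intro a ha
    simp only [List.mem_cons, List.not_mem_nil, or_false, not_or] at ha
    rw [a2 a ha.2, f₁ a ha.1]
  · rw [a2 45 (by decide), s₁]
  · intro i hi
    rw [a3 i hi]; simp only [Expr.nat, Op.nat]
    rw [f₁ 40 (by decide), h.node i hi, hhalf]
  rintro m₂ ⟨ok₂, f₂, s₂, n₂⟩
  have r41 : ∀ i < E.k, m₂ 41 i = E.tid (m₀ 16 i) (m₀ 17 i) * (2 * E.n) := fun i hi => by
    rw [f₂ 41 (by decide), h.frame 41 (by decide), h41 i hi]
  have r19 : m₂ 19 = m₀ 19 := by rw [f₂ 19 (by decide), h.frame 19 (by decide)]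
  have r6 : m₂ 6 = m 6 := f₂ 6 (by decide)
  have e2 : ∀ i < E.k, Expr.nat m₂ i
      (eAdd (.load 6 (eAdd (reg 41) (eMul (.const 2) (reg 40))))
      (eSub (.load 6 (eAdd (eAdd (reg 41) (eMul (.const 2) (reg 40))) (.const 1)))
        (.load 6 (eAdd (reg 41) (eMul (.const 2) (reg 40)))))) =
      max (E.tree m (E.tid (m₀ 16 i) (m₀ 17 i)) (2 * ((E.n + m₀ 18 i) / 2 ^ (t + 1))))
        (E.tree m (E.tid (m₀ 16 i) (m₀ 17 i)) (2 * ((E.n + m₀ 18 i) / 2 ^ (t + 1)) + 1)) := by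
    intro i hi
    simp only [Expr.nat, Op.nat, r41 i hi, n₂ i hi, r6, tree, add_assoc]
    omega
  refine Runs.put ok₂ rfl (by simp [Expr.cost]) (fun i hi _ => ?_) fun f hf hok => ?_
  · rw [e2 i hi]
    exact max_lt (h.ok.bdd 6 _) (h.ok.bdd 6 _)
  -- the node that processor `i` recomputes
  have hnode : ∀ i < E.k, m₀ 19 i ≠ 0 → (E.n + m₀ 18 i) / 2 ^ (t + 1) < E.n := fun i hi hg => by
    have := hv i hi hg
    calc (E.n + m₀ 18 i) / 2 ^ (t + 1) ≤ (E.n + m₀ 18 i) / 2 ^ 1 :=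
          Nat.div_le_div_left (Nat.pow_le_pow_right (by omega) (by omega)) (by positivity)
      _ < E.n := by omega
  have hw := hf.matrix (b := 2 * E.n) (A := fun i => E.tid (m₀ 16 i) (m₀ 17 i))
    (B := fun i => (E.n + m₀ 18 i) / 2 ^ (t + 1)) fun i hi hg => by
      simp only [Expr.nat, Op.nat, r19] at hg ⊢
      refine ⟨by rw [r41 i hi, n₂ i hi], (hnode i hi hg).trans_le (by omega)⟩
  have hg' : ∀ i, Expr.nat m₂ i (reg 19) = m₀ 19 i := fun i => by simp only [Expr.nat, r19]
  have fr : ∀ a, a ∉ [6, 40, 45] → Function.update m₂ 6 f a = m₀ a := fun a ha => by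
    simp only [List.mem_cons, List.not_mem_nil, or_false, not_or] at ha
    rw [Function.update_of_ne ha.1, f₂ a (by simp [ha]), h.frame a (by simp [ha])]
  refine ⟨hok, fr, ?_, ?_, ?_, ?_⟩
  · rw [Function.update_of_ne (by decide), s₂]
  · intro i hi; rw [Function.update_of_ne (by decide), n₂ i hi]
  · intro a z h1 h2
    rw [← h.leaf a z h1 h2]
    simp only [tree, Function.update_self]
    rcases hw a z h2 with ⟨i, hi, hg, _, hB, _⟩ | ⟨_, h'⟩
    · rw [hg'] at hg; have := hnode i hi hg; omega
    · rw [h', r6]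
  · intro a z h1 h2 hfut
    have keep : ∀ z', (z' = 2 * z ∨ z' = 2 * z + 1) →
        f (a * (2 * E.n) + z') = m 6 (a * (2 * E.n) + z') := by
      intro z' hz'
      rcases hw a z' (by omega) with ⟨i, hi, hg, hA, hB, _⟩ | ⟨_, h'⟩
      · rw [hg'] at hg
        refine absurd ?_ (hfut i hi hg hA (t + 2) (by omega))
        rw [← hhalf2 (E.n + m₀ 18 i) t, hB]; omega
      · rw [h', r6]
    simp only [tree, Function.update_self]
    rw [keep _ (.inl rfl), keep _ (.inr rfl)]
    rcases hw a z (by omega) with ⟨i, hi, hg, hA, hB, hval⟩ | ⟨hno, h'⟩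
    · rw [hval, e2 i hi]
      rw [hA, hB]
    · rw [h', r6]
      refine h.inner a z h1 h2 fun i hi hg hA t' ht' => ?_
      rcases (Nat.succ_le_of_lt ht').eq_or_lt with rfl | hlt
      · intro hz; exact hno i hi (by rw [hg']; exact hg) ⟨hA, hz⟩
      · exact hfut i hi hg hA t' hlt
where
  hhalf2 (x t : ℕ) : x / 2 ^ (t + 1) / 2 = x / 2 ^ (t + 2) := by
    rw [Nat.div_div_eq_div_mul, ← pow_succ]

/-- The number of levels of the trees. -/
def levels (E : Env) : ℕ := Nat.log 2 E.n + 1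

theorem runs_touch {m : Mem} {R : Mem → Prop} (hm : E.Ok m) (hT : E.TreeOk m)
    (hv : ∀ i < E.k, m 19 i ≠ 0 → m 16 i < E.n ∧ m 17 i ≤ E.H + 1 ∧ m 18 i < E.n)
    (hR : ∀ m', E.Ok m' → E.TreeOk m' → (∀ a, a ∉ [6, 40, 41, 42, 45] → m' a = m a) →
      (∀ y c x, c ≤ E.H + 1 → x < E.n → E.Good m y c x → E.Good m' y c x) →
      (∀ i < E.k, m 19 i ≠ 0 → E.Good m' (m 16 i) (m 17 i) (m 18 i)) → R m') :
    E.Runs touch m (250 * E.levels) R := by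
  have hn := E.two_le_n
  unfold touch
  refine (Runs.seq (D := 10) (D' := 240 * E.levels) (R := fun m₁ => E.Ok m₁ ∧ (∀ a ≠ 40, m₁ a = m a) ∧
    ∀ i < E.k, m₁ 40 i = E.n + m 18 i) (Runs.set hm rfl (by simp [Expr.cost])
      (fun i hi => hm.lt_of_grade hi rfl) fun m₁ a1 a2 a3 => ⟨a1, a2, fun i hi => ?_⟩) ?_).mono
      (by unfold levels; omega) fun _ h => h
  · rw [a3 i hi]; simp only [Expr.nat, Op.nat, hm.n]
  rintro m₁ ⟨ok₁, f₁, n₁⟩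
  refine (Runs.seq (D := 30) (D' := 210 * E.levels) (R := fun m₂ => E.Ok m₂ ∧
    (∀ a, a ∉ [40, 41] → m₂ a = m a) ∧ (∀ i < E.k, m₂ 40 i = E.n + m 18 i) ∧
    ∀ i < E.k, m₂ 41 i = E.tid (m 16 i) (m 17 i) * (2 * E.n)) (Runs.set ok₁ rfl (by simp [Expr.cost])
      (fun i hi => ok₁.lt_of_grade hi rfl) fun m₂ a1 a2 a3 => ⟨a1, fun a ha => ?_, fun i hi => ?_,
        fun i hi => ?_⟩) ?_).mono (by unfold levels; omega) fun _ h => h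
  · simp only [List.mem_cons, List.not_mem_nil, or_false, not_or] at ha
    rw [a2 a ha.2, f₁ a ha.1]
  · rw [a2 40 (by decide), n₁ i hi]
  · rw [a3 i hi]
    simp only [Expr.nat, Op.nat, ok₁.n, ok₁.H]
    rw [f₁ 16 (by decide), f₁ 17 (by decide)]
  rintro m₂ ⟨ok₂, f₂, n₂, b₂⟩
  refine (Runs.seq (D := 100) (D' := 110 * E.levels) (R := fun m₃ => E.Ok m₃ ∧
    (∀ a, a ∉ [40, 41, 42] → m₃ a = m a) ∧ (∀ i < E.k, m₃ 40 i = E.n + m 18 i) ∧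
    (∀ i < E.k, m₃ 41 i = E.tid (m 16 i) (m 17 i) * (2 * E.n)) ∧
    ∀ i < E.k, m 19 i ≠ 0 → m₃ 42 i = E.leafVal m (m 16 i) (m 17 i) (m 18 i))
    (Runs.set ok₂ rfl (by simp [leafExpr, Expr.cost])
      (fun i hi => ok₂.lt_of_grade hi rfl) fun m₃ a1 a2 a3 => ⟨a1, fun a ha => ?_, fun i hi => ?_,
        fun i hi => ?_, fun i hi hg => ?_⟩) ?_).mono (by unfold levels; omega) fun _ h => h
  · simp only [List.mem_cons, List.not_mem_nil, or_false, not_or] at ha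
    rw [a2 a ha.2.2, f₂ a (by simp [ha])]
  · rw [a2 40 (by decide), n₂ i hi]
  · rw [a2 41 (by decide), b₂ i hi]
  · have e17 := f₂ 17 (by decide)
    rw [a3 i hi, leafExpr_nat ok₂ (by rw [e17]; exact (hv i hi hg).2.1), e17, f₂ 16 (by decide),
      f₂ 18 (by decide), leafVal_congr (f₂ 3 (by decide)) (f₂ 5 (by decide))]
  rintro m₃ ⟨ok₃, f₃, n₃, b₃, v₃⟩
  have r19 : m₃ 19 = m 19 := f₃ 19 (by decide)
  have r6 : m₃ 6 = m 6 := f₃ 6 (by decide)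
  refine (Runs.seq (D := 12) (D' := 98 * E.levels) (R := fun m₄ => E.Ok m₄ ∧
    (∀ a, a ∉ [6, 40, 41, 42] → m₄ a = m a) ∧ (∀ i < E.k, m₄ 40 i = E.n + m 18 i) ∧
    (∀ i < E.k, m₄ 41 i = E.tid (m 16 i) (m 17 i) * (2 * E.n)) ∧
    (∀ a z, z < 2 * E.n →
      (∃ i < E.k, m 19 i ≠ 0 ∧ E.tid (m 16 i) (m 17 i) = a ∧ E.n + m 18 i = z ∧
        E.tree m₄ a z = E.leafVal m (m 16 i) (m 17 i) (m 18 i)) ∨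
      ((∀ i < E.k, m 19 i ≠ 0 → ¬ (E.tid (m 16 i) (m 17 i) = a ∧ E.n + m 18 i = z)) ∧
        E.tree m₄ a z = E.tree m a z)))
    (Runs.put ok₃ rfl (by simp [Expr.cost])
      (fun i hi _ => ok₃.lt_of_grade hi rfl) fun f hf hok => ⟨hok, fun a ha => ?_, fun i hi => ?_,
        fun i hi => ?_, fun a z hz => ?_⟩) ?_).mono (by unfold levels; omega) fun _ h => h
  · simp only [List.mem_cons, List.not_mem_nil, or_false, not_or] at ha
    rw [Function.update_of_ne ha.1, f₃ a (by simp [ha])]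
  · rw [Function.update_of_ne (by decide), n₃ i hi]
  · rw [Function.update_of_ne (by decide), b₃ i hi]
  · have hw := hf.matrix (b := 2 * E.n) (A := fun i => E.tid (m 16 i) (m 17 i))
      (B := fun i => E.n + m 18 i) (fun i hi hg => by
        simp only [Expr.nat, Op.nat, r19] at hg ⊢
        have := hv i hi hg
        exact ⟨by rw [b₃ i hi, n₃ i hi], by omega⟩) a z hz
    simp only [tree, Function.update_self]
    rcases hw with ⟨i, hi, hg, hA, hB, h⟩ | ⟨hno, h⟩
    · simp only [Expr.nat, r19] at hg h
      exact .inl ⟨i, hi, hg, hA, hB, by rw [h, v₃ i hi hg]⟩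
    · refine .inr ⟨fun i hi hg => hno i hi ?_, by rw [h, r6]⟩
      simpa only [Expr.nat, r19] using hg
  rintro m₄ ⟨ok₄, f₄, n₄, b₄, w₄⟩
  refine (Runs.seq (D := 6) (D' := 92 * E.levels) (R := fun m₅ => E.Ok m₅ ∧
    (∀ a ≠ 45, m₅ a = m₄ a) ∧ m₅ 45 0 = E.n)
    (Runs.setSca ok₄ rfl (by simp [Expr.cost])
      (ok₄.lt_of_grade E.one_le_k rfl) fun m₅ a1 a2 a3 => ⟨a1, a2, ?_⟩) ?_).mono
      (by unfold levels; omega) fun _ h => h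
  · rw [a3]; simp only [Expr.nat, ok₄.n]
  rintro m₅ ⟨ok₅, f₅, s₅⟩
  have g : ∀ a, a ∉ [6, 40, 41, 42, 45] → m₅ a = m a := fun a ha => by
    simp only [List.mem_cons, List.not_mem_nil, or_false, not_or] at ha
    rw [f₅ a ha.2.2.2.2, f₄ a (by simp [ha])]
  have h0 : E.Climbing m₅ m₅ 0 := by
    refine ⟨ok₅, fun _ _ => rfl, by simp [s₅], fun i hi => ?_, fun _ _ _ _ => rfl, ?_⟩
    · rw [f₅ 40 (by decide), n₄ i hi, pow_zero, Nat.div_one, g 18 (by decide)]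
    · intro a z h1 h2 hfut
      have keep : ∀ z' < 2 * E.n, (z' / 2 = z ∨ z' = z) → E.tree m₅ a z' = E.tree m a z' := by
        intro z' h1' h2'
        rw [tree, f₅ 6 (by decide)]
        rcases w₄ a z' h1' with ⟨i, hi, hg, hA, hB, _⟩ | ⟨_, h⟩
        · rcases h2' with h2' | rfl
          · refine absurd ?_ (hfut i hi (by rwa [g 19 (by decide)])
              (by rw [g 16 (by decide), g 17 (by decide)]; exact hA) 1 (by omega))
            rw [g 18 (by decide), hB, pow_one, h2']
          · omega
        · exact h
      rw [keep z (by omega) (.inr rfl), keep _ (by omega) (.inl (by omega)),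
        keep _ (by omega) (.inl (by omega))]
      exact hT a z h1 h2
  refine (Runs.loop (D := 55) (test := sca 45)
    (I := fun q m' => q ≤ E.levels ∧ E.Climbing m₅ m' (E.levels - q))
    (fun q m' h => h.2.ok) rfl (fun m' h => ?_) (fun q m' h => ?_) (fun q m' h => ?_) E.levels m₅
    ⟨le_rfl, by rw [Nat.sub_self]; exact h0⟩).mono (by simp only [Expr.cost]; unfold levels; omega)
    fun m' h => ?_
  · simp only [Expr.nat]
    rw [h.2.scalar, Nat.sub_zero]
    exact Nat.div_eq_of_lt (Nat.lt_pow_succ_log_self (by omega) _)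
  · simp only [Expr.nat]
    rw [h.2.scalar]
    have h1 : 2 ^ (E.levels - (q + 1)) ≤ 2 ^ Nat.log 2 E.n :=
      Nat.pow_le_pow_right (by omega) (by unfold levels; omega)
    have h2 := Nat.pow_log_le_self 2 (x := E.n) (by omega)
    have := Nat.div_pos (h1.trans h2) (by positivity)
    omega
  · refine (runs_climb (fun i hi => ?_) (fun i hi hg => ?_) h.2).mono le_rfl
      fun m'' h' => ⟨by omega, ?_⟩
    · rw [f₅ 41 (by decide), b₄ i hi, g 16 (by decide), g 17 (by decide)]
    · rw [g 19 (by decide)] at hg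
      rw [g 18 (by decide)]; exact (hv i hi hg).2.2
    · rwa [show E.levels - (q + 1) + 1 = E.levels - q by omega] at h'
  · obtain ⟨_, h⟩ := h
    rw [Nat.sub_zero] at h
    have fr : ∀ a, a ∉ [6, 40, 41, 42, 45] → m' a = m a := fun a ha => by
      simp only [List.mem_cons, List.not_mem_nil, or_false, not_or] at ha
      rw [h.frame a (by simp [ha]), g a (by simp [ha])]
    have lv : ∀ y c x, E.leafVal m' y c x = E.leafVal m y c x :=
      leafVal_congr (fr 3 (by decide)) (fr 5 (by decide))
    have lf : ∀ a x, x < E.n → E.tree m' a (E.n + x) = E.tree m₄ a (E.n + x) := fun a x hx => by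
      rw [h.leaf a _ (by omega) (by omega), tree, f₅ 6 (by decide)]
    have inj : ∀ i < E.k, m 19 i ≠ 0 → ∀ y c, c ≤ E.H + 1 →
        E.tid (m 16 i) (m 17 i) = E.tid y c → m 16 i = y ∧ m 17 i = c := fun i hi hg y c hc e =>
      pair_inj (by have := hv i hi hg; omega) (by omega) e
    refine hR m' h.ok (fun a z h1 h2 => h.inner a z h1 h2 fun i hi hg _ t' ht' => ?_) fr
      (fun y c x hc hx hgood => ?_) fun i hi hg => ?_
    · rw [g 19 (by decide)] at hg
      rw [g 18 (by decide), Nat.div_eq_of_lt]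
      · omega
      · have h1 := (hv i hi hg).2.2
        have h2 : E.n < 2 ^ E.levels := Nat.lt_pow_succ_log_self (by omega) _
        have h3 : 2 ^ (E.levels + 1) ≤ 2 ^ t' := Nat.pow_le_pow_right (by omega) ht'
        rw [pow_succ] at h3
        omega
    · rw [Good, lf _ _ hx, lv]
      rcases w₄ (E.tid y c) (E.n + x) (by omega) with ⟨i, hi, hg, hA, hB, e⟩ | ⟨_, e⟩
      · obtain ⟨e1, e2⟩ := inj i hi hg y c hc hA
        have e3 : m 18 i = x := by omega
        rw [e, e1, e2, e3]
      · rw [e]; exact hgood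
    · have hvi := hv i hi hg
      rw [Good, lf _ _ hvi.2.2, lv]
      rcases w₄ (E.tid (m 16 i) (m 17 i)) (E.n + m 18 i) (by omega) with
        ⟨i', hi', hg', hA, hB, e⟩ | ⟨hno, _⟩
      · obtain ⟨e1, e2⟩ := inj i' hi' hg' _ _ hvi.2.1 hA
        have e3 : m 18 i' = m 18 i := by omega
        rw [e, e1, e2, e3]
      · exact absurd ⟨rfl, rfl⟩ (hno i hi hg)

end Env

/-! ### Refreshing the search trees after a change -/

/-- Every processor with nonzero register `15` refreshes the leaf given by the three expressions. -/
def touchAt (y c x : Expr) : Prog :=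
  .seq (set 16 y) <| .seq (set 17 c) <| .seq (set 18 x) <| .seq (set 19 (reg 15)) touch

/-- Every processor with nonzero register `15` refreshes the leaves that belong to the core edges of
the vertex in its register `r`. -/
def touchSlots (r : ℕ) : Prog :=
  .seq (setSca 31 eH) <| countdown 31 <|
  .seq (set 20 (.load 4 (eAdd (eMul (reg r) eH) (sca 31)))) <|
  .seq (set 16 (eSub (reg 20) (.const 1))) <| .seq (set 17 (sca 31)) <| .seq (set 18 (reg r)) <|
  .seq (set 19 (eMul (eLt (.const 0) (reg 15)) (eLt (.const 0) (reg 20)))) touch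

/-- Refresh all leaves that may have changed after edges between the vertices in the registers
`11`, `12` and `13` have been modified; register `14` is the former class of the edge from `12`
to `11`. -/
def refresh : Prog :=
  .seq (touchAt (reg 11) (reg 14) (reg 12)) <|
  .seq (touchAt (reg 12) (eAdd eH (.const 1)) (reg 11)) <|
  .seq (touchAt (reg 13) eH (reg 12)) <|
  .seq (touchAt (reg 12) (eAdd eH (.const 1)) (reg 13)) <|
  .seq (touchSlots 12) (touchSlots 11)

namespace Env

variable {E : Env}

theorem Runs.then {P P' : Prog} {m : Mem} {D D' D'' : ℕ} {R : Mem → Prop}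
    (hD : D + D' ≤ D'') (h : E.Runs P m D fun m' => E.Runs P' m' D' R) :
    E.Runs (.seq P P') m D'' R :=
  (Runs.seq h fun _ h => h).mono hD fun _ h => h

theorem one_le_levels : 1 ≤ E.levels := Nat.le_add_left _ _

/-- The arrays that `refresh` may modify. -/
def refreshArrs : List ℕ := [6, 16, 17, 18, 19, 20, 31, 40, 41, 42, 45]

variable (E) in
/-- In passing from `m` to `m'`, leaves of the search trees have been brought up to date, among them
those in `T`. -/
structure Refreshed (m m' : Mem) (T : ℕ → ℕ → ℕ → Prop) : Prop where
  ok : E.Ok m'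
  treeOk : E.TreeOk m'
  frame : ∀ a, a ∉ refreshArrs → m' a = m a
  keep : ∀ y c x, c ≤ E.H + 1 → x < E.n → E.Good m y c x → E.Good m' y c x
  fresh : ∀ y c x, c ≤ E.H + 1 → x < E.n → T y c x → E.Good m' y c x

theorem Refreshed.trans {m₁ m₂ m₃ : Mem} {T T' : ℕ → ℕ → ℕ → Prop} (h : E.Refreshed m₁ m₂ T)
    (h' : E.Refreshed m₂ m₃ T') :
    E.Refreshed m₁ m₃ fun y c x => T y c x ∨ T' y c x where
  ok := h'.ok
  treeOk := h'.treeOk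
  frame a ha := (h'.frame a ha).trans (h.frame a ha)
  keep y c x hc hx hg := h'.keep y c x hc hx (h.keep y c x hc hx hg)
  fresh y c x hc hx ht := ht.elim (fun ht => h'.keep y c x hc hx (h.fresh y c x hc hx ht))
    (h'.fresh y c x hc hx)

theorem Refreshed.weaken {m m' : Mem} {T T' : ℕ → ℕ → ℕ → Prop} (h : E.Refreshed m m' T)
    (hT : ∀ y c x, T' y c x → T y c x) : E.Refreshed m m' T' :=
  { h with fresh := fun y c x hc hx ht => h.fresh y c x hc hx (hT y c x ht) }

/-- A change of scratch registers of `refresh` counts as a refreshment of no leaves. -/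
theorem Refreshed.of_frame {m m' : Mem} (hok : E.Ok m') (hT : E.TreeOk m) (L : List ℕ)
    (hL : (L.all fun a => decide (a ∈ refreshArrs ∧ a ≠ 6)) = true)
    (hf : ∀ a, a ∉ L → m' a = m a) : E.Refreshed m m' fun _ _ _ => False := by
  simp only [List.all_eq_true, decide_eq_true_eq] at hL
  have h6 : m' 6 = m 6 := hf 6 fun h => (hL 6 h).2 rfl
  have hn : ∀ a, a ∉ refreshArrs → m' a = m a := fun a ha => hf a fun h => ha (hL a h).1
  refine ⟨hok, fun t z h1 h2 => ?_, hn, fun y c x _ _ hg => ?_, fun _ _ _ _ _ h => h.elim⟩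
  · simp only [tree, h6]; exact hT t z h1 h2
  · rw [Good, leafVal_congr (hn 3 (by decide)) (hn 5 (by decide)), tree, h6]; exact hg

theorem runs_touchAt {m : Mem} {y c x : Expr} {fy fc fx : ℕ → ℕ} (hm : E.Ok m) (hT : E.TreeOk m)
    (hs : (y.safe && c.safe && x.safe && decide (y.grade ≤ 2) && decide (x.grade ≤ 2) &&
      decide (y.cost ≤ 4) && decide (c.cost ≤ 4) && decide (x.cost ≤ 4)) = true)
    (hr : ∀ m', (∀ a, a ∉ refreshArrs → m' a = m a) → ∀ i, y.nat m' i = fy i ∧ c.nat m' i = fc i ∧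
      x.nat m' i = fx i)
    (hc : ∀ i < E.k, c.nat m i < E.Q ^ 2)
    (hv : ∀ i < E.k, m 15 i ≠ 0 → fy i < E.n ∧ fc i ≤ E.H + 1 ∧ fx i < E.n) :
    E.Runs (touchAt y c x) m (300 * E.levels) fun m' =>
      E.Refreshed m m' fun y' c' x' => ∃ i < E.k, m 15 i ≠ 0 ∧ y' = fy i ∧ c' = fc i ∧ x' = fx i := by
  simp only [Bool.and_eq_true, decide_eq_true_eq] at hs
  obtain ⟨⟨⟨⟨⟨⟨⟨sy, sc⟩, sx⟩, gy⟩, gx⟩, cy⟩, cc⟩, cx⟩ := hs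
  have hL := E.one_le_levels
  have hQ := E.two_le_Q
  have lift : ∀ {L : List ℕ} {m' : Mem}, (L.all fun a => decide (a ∈ refreshArrs)) = true →
      (∀ a, a ∉ L → m' a = m a) → ∀ a, a ∉ refreshArrs → m' a = m a := fun h1 h2 a ha =>
    h2 a fun h => ha (by simpa using List.all_eq_true.1 h1 a h)
  unfold touchAt
  refine Runs.then (D := 9) (D' := 291 * E.levels) (by omega) (Runs.set hm (by simp [sy]) (by omega)
    (fun i hi => (hm.nat_lt hi sy).trans_le (Nat.pow_le_pow_right (by omega) gy))
    fun m₁ ok₁ f₁ v₁ => ?_)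
  have l₁ : ∀ a, a ∉ refreshArrs → m₁ a = m a := lift (L := [16]) (by decide) (by simpa using f₁)
  refine Runs.then (D := 9) (D' := 282 * E.levels) (by omega) (Runs.set ok₁ (by simp [sc]) (by omega)
    (fun i hi => ?_) fun m₂ ok₂ f₂ v₂ => ?_)
  · rw [(hr m₁ l₁ i).2.1, ← (hr m (fun _ _ => rfl) i).2.1]; exact hc i hi
  have g₂ : ∀ a, a ∉ [16, 17] → m₂ a = m a := fun a ha => by
    simp only [List.mem_cons, List.not_mem_nil, or_false, not_or] at ha
    rw [f₂ a ha.2, f₁ a ha.1]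
  have l₂ := lift (by decide) g₂
  refine Runs.then (D := 9) (D' := 273 * E.levels) (by omega) (Runs.set ok₂ (by simp [sx]) (by omega)
    (fun i hi => (ok₂.nat_lt hi sx).trans_le (Nat.pow_le_pow_right (by omega) gx))
    fun m₃ ok₃ f₃ v₃ => ?_)
  have g₃ : ∀ a, a ∉ [16, 17, 18] → m₃ a = m a := fun a ha => by
    simp only [List.mem_cons, List.not_mem_nil, or_false, not_or] at ha
    rw [f₃ a ha.2.2, g₂ a (by simp [ha])]
  refine Runs.then (D := 9) (D' := 250 * E.levels) (by omega) (Runs.set ok₃ rfl (by decide)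
    (fun i hi => ok₃.bdd 15 i) fun m₄ ok₄ f₄ v₄ => ?_)
  have g₄ : ∀ a, a ∉ [16, 17, 18, 19] → m₄ a = m a := fun a ha => by
    simp only [List.mem_cons, List.not_mem_nil, or_false, not_or] at ha
    rw [f₄ a ha.2.2.2, g₃ a (by simp [ha])]
  have e16 : ∀ i < E.k, m₄ 16 i = fy i := fun i hi => by
    rw [f₄ 16 (by decide), f₃ 16 (by decide), f₂ 16 (by decide), v₁ i hi,
      (hr m (fun _ _ => rfl) i).1]
  have e17 : ∀ i < E.k, m₄ 17 i = fc i := fun i hi => by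
    rw [f₄ 17 (by decide), f₃ 17 (by decide), v₂ i hi, (hr m₁ l₁ i).2.1]
  have e18 : ∀ i < E.k, m₄ 18 i = fx i := fun i hi => by
    rw [f₄ 18 (by decide), v₃ i hi, (hr m₂ l₂ i).2.2]
  have e19 : ∀ i < E.k, m₄ 19 i = m 15 i := fun i hi => by
    rw [v₄ i hi]; simp only [Expr.nat]; rw [g₃ 15 (by decide)]
  have r₄ := Refreshed.of_frame ok₄ hT _ (by decide) g₄
  refine runs_touch ok₄ r₄.treeOk (fun i hi hg => ?_) fun m' ok' t' f' k' d' => ?_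
  · rw [e16 i hi, e17 i hi, e18 i hi]; exact hv i hi (by rwa [← e19 i hi])
  · refine (r₄.trans (T' := fun y' c' x' => ∃ i < E.k, m 15 i ≠ 0 ∧ y' = fy i ∧ c' = fc i ∧
      x' = fx i) ⟨ok', t', fun a ha => f' a fun h => ha ?_, k', ?_⟩).weaken fun _ _ _ h => .inr h
    · simp only [List.mem_cons, List.not_mem_nil, or_false] at h
      rcases h with rfl | rfl | rfl | rfl | rfl <;> decide
    · rintro _ _ _ - - ⟨i, hi, hg, rfl, rfl, rfl⟩
      have := d' i hi (by rwa [e19 i hi])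
      rwa [e16 i hi, e17 i hi, e18 i hi] at this

theorem runs_touchSlots {m : Mem} {r : ℕ} (hr : r ∈ [11, 12]) (hm : E.Ok m) (hT : E.TreeOk m)
    (hv : ∀ i < E.k, m 15 i ≠ 0 → m r i < E.n)
    (ho : ∀ u < E.n, ∀ s < E.H, E.out m u s ≤ E.n) :
    E.Runs (touchSlots r) m (400 * (E.H * E.levels)) fun m' =>
      E.Refreshed m m' fun y c x => ∃ i < E.k, m 15 i ≠ 0 ∧ x = m r i ∧ c < E.H ∧
        E.out m x c = y + 1 := by
  have hL := E.one_le_levels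
  have hH := E.one_le_H
  have hHL : 1 ≤ E.H * E.levels := Nat.mul_pos hH hL
  have gr : arrGrade r = 2 := by
    simp only [List.mem_cons, List.not_mem_nil, or_false] at hr
    rcases hr with rfl | rfl <;> rfl
  have hr' : r ∉ refreshArrs ∧ r ≠ 4 ∧ r ≠ 15 ∧ r ≠ 0 := by
    simp only [List.mem_cons, List.not_mem_nil, or_false] at hr
    rcases hr with rfl | rfl <;> decide
  have hne : ∀ a ∈ refreshArrs, r ≠ a := fun a ha h => hr'.1 (h ▸ ha)
  have h0 : ∀ a ∈ refreshArrs, (0 : ℕ) ≠ a := by decide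
  unfold touchSlots
  refine Runs.then (D := 6) (D' := 394 * (E.H * E.levels)) (by omega)
    (Runs.setSca hm rfl (by decide) (hm.lt_of_grade E.one_le_k rfl) fun m₀ ok₀ f₀ s₀ => ?_)
  have r₀ : E.Refreshed m m₀ _ := Refreshed.of_frame ok₀ hT [31] (by decide) (by simpa using f₀)
  simp only [Expr.nat, hm.H] at s₀
  refine (Runs.countdown (D := 320 * E.levels) (by decide) (I := fun q m' => m' 31 0 = q ∧ q ≤ E.H ∧
    E.Refreshed m m' fun y c x => ∃ i < E.k, m 15 i ≠ 0 ∧ x = m r i ∧ q ≤ c ∧ c < E.H ∧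
        E.out m x c = y + 1) (fun q m' h => h.2.2.ok) (fun q m' h => h.1) ?_ E.H m₀ ⟨s₀, le_rfl,
        r₀.weaken fun y c x => by rintro ⟨i, _, _, _, h1, h2, _⟩; omega⟩).mono ?_ ?_
  · rintro q m₁ m₂ ⟨-, hq, h₁⟩ ok₂ f₂ s₂
    have r₂ := h₁.trans (Refreshed.of_frame ok₂ h₁.treeOk [31] (by decide) (by simpa using f₂))
    have e15 : ∀ i, m₂ 15 i = m 15 i := fun i => by rw [r₂.frame 15 (by decide)]
    have er : ∀ i, m₂ r i = m r i := fun i => by rw [r₂.frame r hr'.1]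
    have e4 : m₂ 4 = m 4 := r₂.frame 4 (by decide)
    have hL' : 1 ≤ E.levels := hL
    refine Runs.then (D := 15) (D' := 305 * E.levels) (by omega) (Runs.set ok₂ (by
        simp [Expr.safe, Expr.grade, gr, show arrGrade 31 = 2 from rfl,
          show arrGrade 0 = 2 from rfl]) (by simp [Expr.cost])
      (fun i hi => ok₂.bdd 4 _) fun m₃ ok₃ f₃ v₃ => ?_)
    have g₃ : ∀ a, a ∉ [20] → m₃ a = m₂ a := by simpa using f₃
    have v20 : ∀ i < E.k, m₃ 20 i = E.out m (m r i) q := fun i hi => by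
      rw [v₃ i hi]; simp only [Expr.nat, Op.nat, er, ok₂.H, s₂, e4]
    refine Runs.then (D := 9) (D' := 296 * E.levels) (by omega) (Runs.set ok₃ rfl (by decide)
      (fun i hi => ok₃.lt_of_grade hi rfl) fun m₄ ok₄ f₄ v₄ => ?_)
    have g₄ : ∀ a, a ∉ [20, 16] → m₄ a = m₂ a := fun a ha => by
      simp only [List.mem_cons, List.not_mem_nil, or_false, not_or] at ha
      rw [f₄ a ha.2, g₃ a (by simp [ha])]
    refine Runs.then (D := 9) (D' := 287 * E.levels) (by omega) (Runs.set ok₄ rfl (by decide)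
      (fun i hi => ok₄.lt_of_grade hi rfl) fun m₅ ok₅ f₅ v₅ => ?_)
    have g₅ : ∀ a, a ∉ [20, 16, 17] → m₅ a = m₂ a := fun a ha => by
      simp only [List.mem_cons, List.not_mem_nil, or_false, not_or] at ha
      rw [f₅ a ha.2.2, g₄ a (by simp [ha])]
    refine Runs.then (D := 9) (D' := 278 * E.levels) (by omega) (Runs.set ok₅ (by
        simp [Expr.safe]) (by simp [Expr.cost])
      (fun i hi => by have := ok₅.bdd r i; rwa [gr] at this) fun m₆ ok₆ f₆ v₆ => ?_)
    have g₆ : ∀ a, a ∉ [20, 16, 17, 18] → m₆ a = m₂ a := fun a ha => by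
      simp only [List.mem_cons, List.not_mem_nil, or_false, not_or] at ha
      rw [f₆ a ha.2.2.2, g₅ a (by simp [ha])]
    refine Runs.then (D := 20) (D' := 250 * E.levels) (by omega) (Runs.set ok₆ rfl (by decide)
      (fun i hi => ok₆.lt_of_grade hi rfl) fun m₇ ok₇ f₇ v₇ => ?_)
    have g₇ : ∀ a, a ∉ [20, 16, 17, 18, 19] → m₇ a = m₂ a := fun a ha => by
      simp only [List.mem_cons, List.not_mem_nil, or_false, not_or] at ha
      rw [f₇ a ha.2.2.2.2, g₆ a (by simp [ha])]
    have e16 : ∀ i < E.k, m₇ 16 i = E.out m (m r i) q - 1 := fun i hi => by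
      rw [f₇ 16 (by decide), f₆ 16 (by decide), f₅ 16 (by decide), v₄ i hi]
      simp only [Expr.nat, Op.nat]
      rw [v20 i hi]
    have e17 : ∀ i < E.k, m₇ 17 i = q := fun i hi => by
      rw [f₇ 17 (by decide), f₆ 17 (by decide), v₅ i hi]
      simp only [Expr.nat]
      rw [g₄ 31 (by decide), s₂]
    have e18 : ∀ i < E.k, m₇ 18 i = m r i := fun i hi => by
      rw [f₇ 18 (by decide), v₆ i hi]
      simp only [Expr.nat]
      rw [g₅ r (by
        have := hne 20 (by decide); have := hne 16 (by decide); have := hne 17 (by decide)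
        simp [*]), er]
    have e19 : ∀ i < E.k, (m₇ 19 i ≠ 0 ↔ m 15 i ≠ 0 ∧ E.out m (m r i) q ≠ 0) := fun i hi => by
      have h15 : m₆ 15 i = m 15 i := by rw [g₆ 15 (by decide), e15]
      have h20 : m₆ 20 i = E.out m (m r i) q := by
        rw [f₆ 20 (by decide), f₅ 20 (by decide), f₄ 20 (by decide), v20 i hi]
      rw [v₇ i hi]
      simp only [Expr.nat, Op.nat, h15, h20, Nat.pos_iff_ne_zero]
      split_ifs <;> simp [*]
    have r₇ := r₂.trans (Refreshed.of_frame ok₇ r₂.treeOk _ (by decide) g₇)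
    refine runs_touch ok₇ r₇.treeOk (fun i hi hg => ?_) fun m' ok' t' f' k' d' => ⟨?_, by omega, ?_⟩
    · obtain ⟨g1, g2⟩ := (e19 i hi).1 hg
      have h1 := hv i hi g1
      have h2 := ho _ h1 q (by omega)
      rw [e16 i hi, e17 i hi, e18 i hi]
      exact ⟨by omega, by omega, h1⟩
    · rw [f' 31 (by decide), g₇ 31 (by decide), s₂]
    · refine (r₇.trans (T' := fun y c x => ∃ i < E.k, m 15 i ≠ 0 ∧ x = m r i ∧ c = q ∧
        E.out m x c = y + 1) ⟨ok', t', fun a ha => f' a fun h => ha ?_, k', ?_⟩).weaken ?_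
      · simp only [List.mem_cons, List.not_mem_nil, or_false] at h
        rcases h with rfl | rfl | rfl | rfl | rfl <;> decide
      · rintro y _ _ - - ⟨i, hi, hg, rfl, rfl, ho'⟩
        have := d' i hi ((e19 i hi).2 ⟨hg, by omega⟩)
        rwa [e16 i hi, e17 i hi, e18 i hi, ho', Nat.add_sub_cancel] at this
      · rintro y c x ⟨i, hi, hg, hx, hc, hc', ho'⟩
        rcases hc.eq_or_lt with rfl | hc
        · exact .inr ⟨i, hi, hg, hx, rfl, ho'⟩
        · exact .inl (.inl (.inl ⟨i, hi, hg, hx, hc, hc', ho'⟩))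
  · have : E.H * (320 * E.levels + 10) ≤ E.H * (330 * E.levels) :=
      Nat.mul_le_mul_left _ (by omega)
    have : E.H * (330 * E.levels) = 330 * (E.H * E.levels) := by ring
    omega
  · rintro m' ⟨-, -, h⟩
    refine h.weaken ?_
    rintro y c x ⟨i, hi, hg, hx, hc, ho'⟩
    exact ⟨i, hi, hg, hx, Nat.zero_le _, hc, ho'⟩

/-- The leaves that `refresh` brings up to date. -/
def RefreshSet (E : Env) (m : Mem) (y c x : ℕ) : Prop :=
  ∃ i < E.k, m 15 i ≠ 0 ∧ (y = m 11 i ∧ c = m 14 i ∧ x = m 12 i ∨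
    y = m 12 i ∧ c = E.H + 1 ∧ x = m 11 i ∨ y = m 13 i ∧ c = E.H ∧ x = m 12 i ∨
    y = m 12 i ∧ c = E.H + 1 ∧ x = m 13 i ∨
    (x = m 12 i ∨ x = m 11 i) ∧ c < E.H ∧ E.out m x c = y + 1)

theorem runs_refresh {m : Mem} (hm : E.Ok m) (hT : E.TreeOk m)
    (hv : ∀ i < E.k, m 15 i ≠ 0 →
      m 11 i < E.n ∧ m 12 i < E.n ∧ m 13 i < E.n ∧ m 14 i ≤ E.H + 1)
    (ho : ∀ u < E.n, ∀ s < E.H, E.out m u s ≤ E.n) :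
    E.Runs refresh m (2000 * (E.H * E.levels)) fun m' => E.Refreshed m m' (E.RefreshSet m) := by
  have hL := E.one_le_levels
  have hH := E.one_le_H
  have hHL : E.levels ≤ E.H * E.levels := Nat.le_mul_of_pos_left _ hH
  have hQ : E.H + 1 < E.Q ^ 2 := by
    have := E.Q_ge; have : E.H ≤ E.Q := by unfold Q; omega
    nlinarith
  have hk : ∀ i, i < E.k → i < E.k := fun _ h => h
  unfold refresh
  refine Runs.then (D := 300 * E.levels) (D' := 900 * E.levels + 800 * (E.H * E.levels)) (by omega)
    ((runs_touchAt (fy := m 11) (fc := m 14) (fx := m 12) hm hT rfl (fun m' h i => ?_)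
      (fun i _ => by simp only [Expr.nat]; exact hm.bdd 14 i) fun i hi hg => ?_).mono le_rfl fun m₁ r₁ => ?_)
  · simp only [Expr.nat]; rw [h 11 (by decide), h 14 (by decide), h 12 (by decide)]; simp
  · obtain ⟨h1, h2, _, h4⟩ := hv i hi hg; exact ⟨h1, h4, h2⟩
  refine Runs.then (D := 300 * E.levels) (D' := 600 * E.levels + 800 * (E.H * E.levels)) (by omega)
    ((runs_touchAt (fy := m 12) (fc := fun _ => E.H + 1) (fx := m 11) r₁.ok r₁.treeOk rfl
      (fun m' h i => ?_) (fun i _ => ?_) fun i hi hg => ?_).mono le_rfl fun m₂ r₂ => ?_)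
  · simp only [Expr.nat, Op.nat]
    rw [h 11 (by decide), h 0 (by decide), h 12 (by decide), r₁.frame 11 (by decide), r₁.ok.H,
      r₁.frame 12 (by decide)]; simp
  · simp only [Expr.nat, Op.nat]; rw [r₁.ok.H]; exact hQ
  · rw [r₁.frame 15 (by decide)] at hg
    obtain ⟨h1, h2, _, h4⟩ := hv i hi hg; exact ⟨h2, le_rfl, h1⟩
  replace r₂ := r₁.trans r₂
  refine Runs.then (D := 300 * E.levels) (D' := 300 * E.levels + 800 * (E.H * E.levels)) (by omega)
    ((runs_touchAt (fy := m 13) (fc := fun _ => E.H) (fx := m 12) r₂.ok r₂.treeOk rfl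
      (fun m' h i => ?_) (fun i _ => ?_) fun i hi hg => ?_).mono le_rfl fun m₃ r₃ => ?_)
  · simp only [Expr.nat]
    rw [h 13 (by decide), h 0 (by decide), h 12 (by decide), r₂.frame 13 (by decide), r₂.ok.H,
      r₂.frame 12 (by decide)]; simp
  · simp only [Expr.nat]; rw [r₂.ok.H]; omega
  · rw [r₂.frame 15 (by decide)] at hg
    obtain ⟨h1, h2, h3, h4⟩ := hv i hi hg; exact ⟨h3, by omega, h2⟩
  replace r₃ := r₂.trans r₃
  refine Runs.then (D := 300 * E.levels) (D' := 800 * (E.H * E.levels)) (by omega)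
    ((runs_touchAt (fy := m 12) (fc := fun _ => E.H + 1) (fx := m 13) r₃.ok r₃.treeOk rfl
      (fun m' h i => ?_) (fun i _ => ?_) fun i hi hg => ?_).mono le_rfl fun m₄ r₄ => ?_)
  · simp only [Expr.nat, Op.nat]
    rw [h 13 (by decide), h 0 (by decide), h 12 (by decide), r₃.frame 13 (by decide), r₃.ok.H,
      r₃.frame 12 (by decide)]; simp
  · simp only [Expr.nat, Op.nat]; rw [r₃.ok.H]; exact hQ
  · rw [r₃.frame 15 (by decide)] at hg
    obtain ⟨h1, h2, h3, h4⟩ := hv i hi hg; exact ⟨h2, le_rfl, h3⟩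
  replace r₄ := r₃.trans r₄
  refine Runs.then (D := 400 * (E.H * E.levels)) (D' := 400 * (E.H * E.levels)) (by omega)
    ((runs_touchSlots (by decide) r₄.ok r₄.treeOk (fun i hi hg => ?_) fun u hu s hs => ?_).mono
      le_rfl fun m₅ r₅ => ?_)
  · rw [r₄.frame 15 (by decide)] at hg
    rw [r₄.frame 12 (by decide)]; exact (hv i hi hg).2.1
  · rw [out, r₄.frame 4 (by decide)]; exact ho u hu s hs
  replace r₅ := r₄.trans r₅
  refine (runs_touchSlots (by decide) r₅.ok r₅.treeOk (fun i hi hg => ?_) fun u hu s hs => ?_).mono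
      le_rfl fun m₆ r₆ => ?_
  · rw [r₅.frame 15 (by decide)] at hg
    rw [r₅.frame 11 (by decide)]; exact (hv i hi hg).1
  · rw [out, r₅.frame 4 (by decide)]; exact ho u hu s hs
  replace r₆ := r₅.trans r₆
  refine r₆.weaken ?_
  have e1 := r₁.frame 15 (by decide)
  have e2 := r₂.frame 15 (by decide)
  have e3 := r₃.frame 15 (by decide)
  have e4 := r₄.frame 15 (by decide)
  have e5 := r₅.frame 15 (by decide)
  have f4 := r₄.frame 12 (by decide)
  have f5 := r₅.frame 11 (by decide)
  have g4 := r₄.frame 4 (by decide)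
  have g5 := r₅.frame 4 (by decide)
  rintro y c x ⟨i, hi, hg, h | h | h | h | ⟨h | h, hc, ho⟩⟩
  · exact .inl (.inl (.inl (.inl (.inl ⟨i, hi, hg, h⟩))))
  · exact .inl (.inl (.inl (.inl (.inr ⟨i, hi, by rwa [e1], h⟩))))
  · exact .inl (.inl (.inl (.inr ⟨i, hi, by rwa [e2], h⟩)))
  · exact .inl (.inl (.inr ⟨i, hi, by rwa [e3], h⟩))
  · exact .inl (.inr ⟨i, hi, by rwa [e4], by rwa [f4], hc, by rwa [out, g4]⟩)
  · exact .inr ⟨i, hi, by rwa [e5], by rwa [f5], hc, by rwa [out, g5]⟩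

end Env

/-! ### Modifying the slots of a vertex -/

/-- Every processor with nonzero register `15` whose class in register `14` is a core slot refills
this slot of the vertex in register `12` by a surplus edge, or frees the slot if there is no surplus
edge. The head of the surplus edge goes to register `13`. -/
def fixSlot : Prog :=
  .seq (set 44 (.load 6 (eAdd (eMul (eAdd (eMul (reg 12) (eAdd eH (.const 2))) (eAdd eH (.const 1)))
    (eMul (.const 2) eN)) (.const 1)))) <|
  .seq (set 13 (eMod (reg 44) eN)) <|
  .seq (set 27 (eMul (eLt (.const 0) (reg 15)) (eLt (reg 14) eH))) <|
  .seq (put (eMul (reg 27) (eLt (.const 0) (reg 44))) 3 (eAdd (eMul (reg 12) eN) (reg 13))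
    (eAdd (reg 14) (.const 1))) <|
  .seq (put (eMul (reg 27) (eEq (reg 44) (.const 0))) 5 (reg 12)
    (eSub (.load 5 (reg 12)) (.const 1))) <|
  put (reg 27) 4 (eAdd (eMul (reg 12) eH) (reg 14))
    (eMul (eLt (.const 0) (reg 44)) (eAdd (reg 13) (.const 1)))

/-- Every processor with nonzero register `15` inserts the edge from the vertex in register `11` to
the vertex in register `12` into a free slot. -/
def link : Prog :=
  .seq (setSca 31 eH) <|
  .seq (countdown 31 (setIf (eEq (.load 4 (eAdd (eMul (reg 11) eH) (sca 31))) (.const 0)) 21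
    (sca 31))) <|
  .seq (put (reg 15) 3 (eAdd (eMul (reg 11) eN) (reg 12)) (eAdd (reg 21) (.const 1))) <|
  .seq (put (reg 15) 4 (eAdd (eMul (reg 11) eH) (reg 21)) (eAdd (reg 12) (.const 1))) <|
  put (reg 15) 5 (reg 11) (eAdd (.load 5 (reg 11)) (.const 1))

namespace Env

variable (E : Env)

/-- The root of the tree of surplus edges of `u`. -/
abbrev top (m : Mem) (u : ℕ) : ℕ := E.tree m (E.tid u (E.H + 1)) 1

/-- Slot `j < H` of `u` is to be refilled. -/
def FixReq (m : Mem) (u j : ℕ) : Prop :=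
  ∃ i < E.k, m 15 i ≠ 0 ∧ m 14 i < E.H ∧ m 12 i = u ∧ m 14 i = j

/-- The effect of `fixSlot`. -/
structure Fixed (m m' : Mem) : Prop where
  ok : E.Ok m'
  frame : ∀ a, a ∉ [3, 4, 5, 13, 27, 44] → m' a = m a
  head : ∀ i < E.k, m' 13 i = E.top m (m 12 i) % E.n
  cls_new : ∀ u j, E.FixReq m u j → E.top m u ≠ 0 → E.cls m' u (E.top m u % E.n) = j + 1
  cls_old : ∀ u v, v < E.n → ((∀ j, ¬ E.FixReq m u j) ∨ E.top m u = 0 ∨ v ≠ E.top m u % E.n) →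
    E.cls m' u v = E.cls m u v
  out_new : ∀ u j, E.FixReq m u j →
    E.out m' u j = if E.top m u = 0 then 0 else E.top m u % E.n + 1
  out_old : ∀ u s, s < E.H → ¬ E.FixReq m u s → E.out m' u s = E.out m u s
  deg_new : ∀ u j, E.FixReq m u j → E.top m u = 0 → deg m' u = deg m u - 1
  deg_old : ∀ u, ((∀ j, ¬ E.FixReq m u j) ∨ E.top m u ≠ 0) → deg m' u = deg m u

/-- The edge `v → x` is to be inserted. -/
def LinkReq (m : Mem) (v x : ℕ) : Prop :=
  ∃ i < E.k, m 15 i ≠ 0 ∧ m 11 i = v ∧ m 12 i = x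

/-- The effect of `link`; the new edge at `v` gets slot `sl v`. -/
structure Linked (m m' : Mem) (sl : ℕ → ℕ) : Prop where
  ok : E.Ok m'
  frame : ∀ a, a ∉ [3, 4, 5, 21, 31] → m' a = m a
  free : ∀ v x, E.LinkReq m v x → sl v < E.H ∧ E.out m v (sl v) = 0
  cls_new : ∀ v x, E.LinkReq m v x → E.cls m' v x = sl v + 1
  cls_old : ∀ v x, x < E.n → ¬ E.LinkReq m v x → E.cls m' v x = E.cls m v x
  out_new : ∀ v x, E.LinkReq m v x → E.out m' v (sl v) = x + 1
  out_old : ∀ v s, s < E.H → ((∀ x, ¬ E.LinkReq m v x) ∨ s ≠ sl v) → E.out m' v s = E.out m v s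
  deg_new : ∀ v x, E.LinkReq m v x → deg m' v = deg m v + 1
  deg_old : ∀ v, (∀ x, ¬ E.LinkReq m v x) → deg m' v = deg m v

variable {E}

theorem H_lt : E.H < E.Q ^ 2 := by
  have := E.Q_ge; have : E.H ≤ E.Q := by unfold Q; omega
  nlinarith

theorem n_lt : E.n < E.Q ^ 2 := by
  have := E.Q_ge; have : E.n ≤ E.Q := by unfold Q; omega
  nlinarith

theorem runs_fixSlot {m : Mem} (hm : E.Ok m)
    (hS : ∀ u j j', E.FixReq m u j → E.FixReq m u j' → j = j') :
    E.Runs fixSlot m 200 fun m' => E.Fixed m m' := by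
  have hn := E.two_le_n
  have hQH := E.H_lt
  have hQn := E.n_lt
  unfold fixSlot
  refine Runs.then (D := 30) (D' := 170) (by omega) (Runs.set hm rfl (by decide)
    (fun i hi => hm.bdd 6 _) fun m₁ ok₁ f₁ v₁ => ?_)
  replace v₁ : ∀ i < E.k, m₁ 44 i = E.top m (m 12 i) := fun i hi => by
    rw [v₁ i hi]; simp only [Expr.nat, Op.nat, hm.n, hm.H]
  refine Runs.then (D := 20) (D' := 150) (by omega) (Runs.set ok₁ rfl (by decide)
    (fun i hi => ?_) fun m₂ ok₂ f₂ v₂ => ?_)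
  · simp only [Expr.nat, Op.nat, ok₁.n]
    exact (Nat.mod_lt _ (by omega)).trans hQn
  have g₂ : ∀ a, a ∉ [44, 13] → m₂ a = m a := fun a ha => by
    simp only [List.mem_cons, List.not_mem_nil, or_false, not_or] at ha
    rw [f₂ a ha.2, f₁ a ha.1]
  replace v₂ : ∀ i < E.k, m₂ 13 i = E.top m (m 12 i) % E.n := fun i hi => by
    rw [v₂ i hi]; simp only [Expr.nat, Op.nat, ok₁.n, v₁ i hi]
  refine Runs.then (D := 20) (D' := 130) (by omega) (Runs.set ok₂ rfl (by decide)
    (fun i hi => ok₂.lt_of_grade hi rfl) fun m₃ ok₃ f₃ v₃ => ?_)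
  have g₃ : ∀ a, a ∉ [44, 13, 27] → m₃ a = m a := fun a ha => by
    simp only [List.mem_cons, List.not_mem_nil, or_false, not_or] at ha
    rw [f₃ a ha.2.2, g₂ a (by simp [ha])]
  replace v₃ : ∀ i < E.k, (m₃ 27 i ≠ 0 ↔ m 15 i ≠ 0 ∧ m 14 i < E.H) := fun i hi => by
    rw [v₃ i hi]
    simp only [Expr.nat, Op.nat, ok₂.H, g₂ 15 (by decide), g₂ 14 (by decide), Nat.pos_iff_ne_zero]
    split_ifs <;> simp [*]
  have w13 : ∀ i < E.k, m₃ 13 i = E.top m (m 12 i) % E.n := fun i hi => by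
    rw [f₃ 13 (by decide), v₂ i hi]
  have w44 : ∀ i < E.k, m₃ 44 i = E.top m (m 12 i) := fun i hi => by
    rw [f₃ 44 (by decide), f₂ 44 (by decide), v₁ i hi]
  have w12 : m₃ 12 = m 12 := g₃ 12 (by decide)
  have w14 : m₃ 14 = m 14 := g₃ 14 (by decide)
  have w3 : m₃ 3 = m 3 := g₃ 3 (by decide)
  have w4 : m₃ 4 = m 4 := g₃ 4 (by decide)
  have w5 : m₃ 5 = m 5 := g₃ 5 (by decide)
  -- promotion of the surplus edge
  have gd : ∀ i < E.k, (Expr.nat m₃ i (eMul (reg 27) (eLt (.const 0) (reg 44))) ≠ 0 ↔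
      (m 15 i ≠ 0 ∧ m 14 i < E.H) ∧ E.top m (m 12 i) ≠ 0) := fun i hi => by
    rw [← v₃ i hi]
    simp only [Expr.nat, Op.nat, w44 i hi, Nat.pos_iff_ne_zero]
    split_ifs <;> simp [*]
  refine Runs.then (D := 30) (D' := 100) (by omega) (Runs.put ok₃ rfl (by decide)
    (fun i hi hg => ?_) fun f hf ok₄ => ?_)
  · simp only [Expr.nat, Op.nat, w14]
    have := ((gd i hi).1 hg).1.2
    change _ < E.Q ^ 2
    omega
  have hw3 := hf.matrix (b := E.n) (A := m 12) (B := fun i => E.top m (m 12 i) % E.n) fun i hi _ => by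
    refine ⟨?_, Nat.mod_lt _ (by omega)⟩
    simp only [Expr.nat, Op.nat, ok₃.n, w12, w13 i hi]
  have e₄ : ∀ a ≠ 3, Function.update m₃ 3 f a = m₃ a := fun a ha => Function.update_of_ne ha _ _
  have e₄' : Function.update m₃ 3 f 3 = f := Function.update_self _ _ _
  generalize Function.update m₃ 3 f = m₄ at ok₄ e₄ e₄'
  -- the degree drops if there is no surplus edge
  have gd5 : ∀ i < E.k, (Expr.nat m₄ i (eMul (reg 27) (eEq (reg 44) (.const 0))) ≠ 0 ↔
      (m 15 i ≠ 0 ∧ m 14 i < E.H) ∧ E.top m (m 12 i) = 0) := fun i hi => by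
    rw [← v₃ i hi]
    simp only [Expr.nat, Op.nat, e₄ 27 (by decide), e₄ 44 (by decide), w44 i hi]
    split_ifs <;> simp [*]
  refine Runs.then (D := 30) (D' := 70) (by omega) (Runs.put ok₄ rfl (by decide)
    (fun i hi hg => ok₄.lt_of_grade hi rfl) fun f5 hf5 ok₅ => ?_)
  have hw5 := hf5.congr (guard' := fun i => Expr.nat m₄ i (eMul (reg 27) (eEq (reg 44) (.const 0))))
    (addr' := m 12) (val' := fun i => deg m (m 12 i) - 1) (fun i hi => rfl)
    (fun i hi => by simp only [Expr.nat, e₄ 12 (by decide), w12])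
    (fun i hi => by simp only [Expr.nat, Op.nat, e₄ 12 (by decide), w12, e₄ 5 (by decide), w5])
  have e₅ : ∀ a ≠ 5, Function.update m₄ 5 f5 a = m₄ a := fun a ha => Function.update_of_ne ha _ _
  have e₅' : Function.update m₄ 5 f5 5 = f5 := Function.update_self _ _ _
  generalize Function.update m₄ 5 f5 = m₅ at ok₅ e₅ e₅'
  have h27 : ∀ i < E.k, (Expr.nat m₅ i (reg 27) ≠ 0 ↔ m 15 i ≠ 0 ∧ m 14 i < E.H) := fun i hi => by
    rw [← v₃ i hi]; simp only [Expr.nat, e₅ 27 (by decide), e₄ 27 (by decide)]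
  have hv4 : ∀ i < E.k, Expr.nat m₅ i (eMul (eLt (.const 0) (reg 44)) (eAdd (reg 13) (.const 1))) =
      if E.top m (m 12 i) = 0 then 0 else E.top m (m 12 i) % E.n + 1 := fun i hi => by
    simp only [Expr.nat, Op.nat, e₅ 13 (by decide), e₄ 13 (by decide), e₅ 44 (by decide),
      e₄ 44 (by decide), w44 i hi, w13 i hi, Nat.pos_iff_ne_zero]
    split_ifs <;> simp_all
  refine (Runs.put (D := 70) ok₅ rfl (by decide) (fun i hi hg => ?_) fun f4 hf4 ok₆ => ?_)
  · rw [hv4 i hi]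
    have := Nat.mod_lt (E.top m (m 12 i)) (show E.n > 0 by omega)
    change _ < E.Q ^ 2
    split_ifs <;> omega
  have hw4 := hf4.matrix (b := E.H) (A := m 12) (B := m 14) fun i hi hg => by
    refine ⟨?_, ((h27 i hi).1 hg).2⟩
    simp only [Expr.nat, Op.nat, ok₅.H, e₅ 12 (by decide), e₄ 12 (by decide), w12,
      e₅ 14 (by decide), e₄ 14 (by decide), w14]
  have e₆ : ∀ a ≠ 4, Function.update m₅ 4 f4 a = m₅ a := fun a ha => Function.update_of_ne ha _ _
  have e₆' : Function.update m₅ 4 f4 4 = f4 := Function.update_self _ _ _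
  generalize Function.update m₅ 4 f4 = m₆ at ok₆ e₆ e₆'
  have c3 : ∀ u v, E.cls m₆ u v = f (u * E.n + v) := fun u v => by
    rw [cls, e₆ 3 (by decide), e₅ 3 (by decide), e₄']
  have c4 : ∀ u v, E.out m₆ u v = f4 (u * E.H + v) := fun u v => by rw [out, e₆']
  have c5 : ∀ u, deg m₆ u = f5 u := fun u => by rw [deg, e₆ 5 (by decide), e₅']
  refine ⟨ok₆, fun a ha => ?_, fun i hi => ?_, ?_, ?_, ?_, ?_, ?_, ?_⟩
  · simp only [List.mem_cons, List.not_mem_nil, or_false, not_or] at ha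
    rw [e₆ a ha.2.1, e₅ a ha.2.2.1, e₄ a ha.1, g₃ a (by simp [ha])]
  · rw [e₆ 13 (by decide), e₅ 13 (by decide), e₄ 13 (by decide), w13 i hi]
  · intro u j hS1 ht
    rw [c3]
    rcases hw3 u (E.top m u % E.n) (Nat.mod_lt _ (by omega)) with ⟨i, hi, hg, hA, hB, hv⟩ | ⟨hno, _⟩
    · rw [hv]
      simp only [Expr.nat, Op.nat, w14]
      rw [hS u _ j ⟨i, hi, ((gd i hi).1 hg).1.1, ((gd i hi).1 hg).1.2, hA, rfl⟩ hS1]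
    · obtain ⟨i, hi, h1, h2, h3, h4⟩ := hS1
      exact absurd ⟨h3, by rw [h3]⟩ (hno i hi ((gd i hi).2 ⟨⟨h1, h2⟩, by rwa [h3]⟩))
  · intro u v hv hcond
    rw [c3]
    rcases hw3 u v hv with ⟨i, hi, hg, hA, hB, hv⟩ | ⟨_, h⟩
    · obtain ⟨⟨g1, g2⟩, g3⟩ := (gd i hi).1 hg
      simp only [hA] at hB g3
      rcases hcond with h | h | h
      · exact absurd ⟨i, hi, g1, g2, hA, rfl⟩ (h (m 14 i))
      · exact absurd h g3
      · exact absurd hB.symm h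
    · rw [h, w3]
  · intro u j hS1
    rw [c4]
    rcases hw4 u j (by obtain ⟨_, _, _, h, _, h'⟩ := hS1; exact h' ▸ h) with
      ⟨i, hi, hg, hA, hB, hv⟩ | ⟨hno, _⟩
    · rw [hv, hv4 i hi, hA]
    · obtain ⟨i, hi, h1, h2, h3, h4⟩ := hS1
      exact absurd ⟨h3, h4⟩ (hno i hi ((h27 i hi).2 ⟨h1, h2⟩))
  · intro u s hs hno
    rw [c4]
    rcases hw4 u s hs with ⟨i, hi, hg, hA, hB, hv⟩ | ⟨_, h⟩
    · obtain ⟨g1, g2⟩ := (h27 i hi).1 hg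
      exact absurd ⟨i, hi, g1, g2, hA, hB⟩ hno
    · rw [h, e₅ 4 (by decide), e₄ 4 (by decide), w4]
  · intro u j hS1 ht
    rw [c5]
    rcases hw5 u with ⟨i, hi, hg, hA, hv⟩ | ⟨hno, _⟩
    · rw [hv, ← hA]
    · obtain ⟨i, hi, h1, h2, h3, h4⟩ := hS1
      exact absurd h3 (hno i hi ((gd5 i hi).2 ⟨⟨h1, h2⟩, by rwa [h3]⟩))
  · intro u hcond
    rw [c5]
    rcases hw5 u with ⟨i, hi, hg, hA, hv⟩ | ⟨_, h⟩
    · obtain ⟨⟨g1, g2⟩, g3⟩ := (gd5 i hi).1 hg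
      rw [hA] at g3
      rcases hcond with h | h
      · exact absurd ⟨i, hi, g1, g2, hA, rfl⟩ (h (m 14 i))
      · exact absurd g3 h
    · rw [h, e₄ 5 (by decide), w5]

theorem runs_link {m : Mem} (hm : E.Ok m)
    (hv : ∀ i < E.k, m 15 i ≠ 0 → m 11 i < E.n ∧ m 12 i < E.n ∧ deg m (m 11 i) < E.H ∧
      ∃ s < E.H, E.out m (m 11 i) s = 0)
    (hL : ∀ v x x', E.LinkReq m v x → E.LinkReq m v x' → x = x') :
    E.Runs link m (200 * E.H) fun m' => ∃ sl, E.Linked m m' sl := by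
  have hn := E.two_le_n
  have hH := E.one_le_H
  have hQH := E.H_lt
  have hQn := E.n_lt
  unfold link
  refine Runs.then (D := 10) (D' := 190 * E.H) (by omega) (Runs.setSca hm rfl (by decide)
    (hm.lt_of_grade E.one_le_k rfl) fun m₁ ok₁ f₁ s₁ => ?_)
  simp only [Expr.nat, hm.H] at s₁
  refine Runs.then (D := 42 * E.H) (D' := 148 * E.H) (by omega) ((Runs.countdown (by decide) (D := 30)
    (I := fun q m' => m' 31 0 = q ∧ q ≤ E.H ∧ E.Ok m' ∧ (∀ a, a ∉ [21, 31] → m' a = m a) ∧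
      ∀ i < E.k, (∃ s < E.H, q ≤ s ∧ E.out m (m 11 i) s = 0) →
        m' 21 i < E.H ∧ q ≤ m' 21 i ∧ E.out m (m 11 i) (m' 21 i) = 0 ∧
        ∀ s, q ≤ s → s < E.H → E.out m (m 11 i) s = 0 → m' 21 i ≤ s)
    (fun q m' h => h.2.2.1) (fun q m' h => h.1) ?_ E.H m₁
    ⟨s₁, le_rfl, ok₁, fun a ha => f₁ a (by simp_all), ?_⟩).mono (by omega) ?_)
  · rintro q m₂ m₃ ⟨-, hq, -, f₂, h₂⟩ ok₃ f₃ s₃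
    have g₃ : ∀ a, a ∉ [21, 31] → m₃ a = m a := fun a ha => by
      simp only [List.mem_cons, List.not_mem_nil, or_false, not_or] at ha
      rw [f₃ a ha.2, f₂ a (by simp [ha])]
    refine Runs.setIf ok₃ rfl (by decide) (fun i hi _ => ok₃.bdd 31 0) fun m₄ ok₄ f₄ v₄ =>
      ⟨by rw [f₄ 31 (by decide), s₃], by omega, ok₄, fun a ha => ?_, fun i hi hs => ?_⟩
    · simp only [List.mem_cons, List.not_mem_nil, or_false, not_or] at ha
      rw [f₄ a ha.1, g₃ a (by simp [ha])]
    · have hg : (Expr.nat m₃ i (eEq (.load 4 (eAdd (eMul (reg 11) eH) (sca 31))) (.const 0)) ≠ 0 ↔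
          E.out m (m 11 i) q = 0) := by
        simp only [Expr.nat, Op.nat, g₃ 11 (by decide), g₃ 4 (by decide), s₃, ok₃.H]
        split_ifs <;> simp [*]
      rw [v₄ i hi]
      by_cases hz : E.out m (m 11 i) q = 0
      · rw [if_pos (hg.2 hz)]
        simp only [Expr.nat, s₃]
        exact ⟨by omega, le_rfl, hz, fun s h _ _ => h⟩
      · rw [if_neg (fun h => hz (hg.1 h)), f₃ 21 (by decide)]
        obtain ⟨s, h1, h2, h3⟩ := hs
        have hsq : ∀ s, q ≤ s → E.out m (m 11 i) s = 0 → q + 1 ≤ s := fun s h2 h3 => by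
          rcases h2.eq_or_lt with rfl | h2
          · exact absurd h3 hz
          · exact h2
        obtain ⟨a1, a2, a3, a4⟩ := h₂ i hi ⟨s, h1, hsq s h2 h3, h3⟩
        exact ⟨a1, by omega, a3, fun s h1 h2 h3 => a4 s (hsq s h1 h3) h2 h3⟩
  · rintro i hi ⟨s, h1, h2, _⟩; omega
  rintro m₂ ⟨-, -, ok₂, f₂, h₂⟩
  obtain ⟨sl, hsl⟩ : ∃ sl : ℕ → ℕ, ∀ i < E.k, m 15 i ≠ 0 →
      m₂ 21 i = sl (m 11 i) ∧ m₂ 21 i < E.H ∧ E.out m (m 11 i) (m₂ 21 i) = 0 := by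
    refine ⟨fun v => sInf {s : ℕ | s < E.H ∧ E.out m v s = 0}, fun i hi hg => ?_⟩
    obtain ⟨s, h1, h2⟩ := (hv i hi hg).2.2.2
    obtain ⟨a1, a2, a3, a4⟩ := h₂ i hi ⟨s, h1, Nat.zero_le _, h2⟩
    have hl : IsLeast {s : ℕ | s < E.H ∧ E.out m (m 11 i) s = 0} (m₂ 21 i) :=
      ⟨⟨a1, a3⟩, fun s hs => a4 s (Nat.zero_le _) hs.1 hs.2⟩
    exact ⟨hl.csInf_eq.symm, a1, a3⟩
  have w15 : ∀ i, Expr.nat m₂ i (reg 15) = m 15 i := fun i => by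
    simp only [Expr.nat, f₂ 15 (by decide)]
  have w11 : m₂ 11 = m 11 := f₂ 11 (by decide)
  have w12 : m₂ 12 = m 12 := f₂ 12 (by decide)
  refine Runs.then (D := 30) (D' := 118 * E.H) (by omega) (Runs.put ok₂ rfl (by decide)
    (fun i hi hg => ?_) fun f hf ok₃ => ?_)
  · rw [w15] at hg
    have := (hsl i hi hg).2.1
    simp only [Expr.nat, Op.nat]
    change _ < E.Q ^ 2
    omega
  have hw3 := hf.matrix (b := E.n) (A := m 11) (B := m 12) fun i hi hg => by
    rw [w15] at hg
    refine ⟨?_, (hv i hi hg).2.1⟩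
    simp only [Expr.nat, Op.nat, ok₂.n, w12, w11]
  have e₃ : ∀ a ≠ 3, Function.update m₂ 3 f a = m₂ a := fun a ha => Function.update_of_ne ha _ _
  have e₃' : Function.update m₂ 3 f 3 = f := Function.update_self _ _ _
  generalize Function.update m₂ 3 f = m₃ at ok₃ e₃ e₃'
  have x15 : ∀ i, Expr.nat m₃ i (reg 15) = m 15 i := fun i => by
    simp only [Expr.nat, e₃ 15 (by decide), f₂ 15 (by decide)]
  refine Runs.then (D := 30) (D' := 88 * E.H) (by omega) (Runs.put ok₃ rfl (by decide)
    (fun i hi hg => ?_) fun f4 hf4 ok₄ => ?_)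
  · rw [x15] at hg
    have := (hv i hi hg).2.1
    simp only [Expr.nat, Op.nat, e₃ 12 (by decide), w12]
    change _ < E.Q ^ 2
    omega
  have hw4 := hf4.matrix (b := E.H) (A := m 11) (B := m₂ 21) fun i hi hg => by
    rw [x15] at hg
    refine ⟨?_, (hsl i hi hg).2.1⟩
    simp only [Expr.nat, Op.nat, ok₃.H, e₃ 11 (by decide), w11, e₃ 21 (by decide)]
  have e₄ : ∀ a ≠ 4, Function.update m₃ 4 f4 a = m₃ a := fun a ha => Function.update_of_ne ha _ _
  have e₄' : Function.update m₃ 4 f4 4 = f4 := Function.update_self _ _ _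
  generalize Function.update m₃ 4 f4 = m₄ at ok₄ e₄ e₄'
  have y15 : ∀ i, Expr.nat m₄ i (reg 15) = m 15 i := fun i => by
    simp only [Expr.nat, e₄ 15 (by decide), e₃ 15 (by decide), f₂ 15 (by decide)]
  have y5 : ∀ i, Expr.nat m₄ i (eAdd (.load 5 (reg 11)) (.const 1)) = deg m (m 11 i) + 1 :=
    fun i => by
      simp only [Expr.nat, Op.nat, e₄ 11 (by decide), e₃ 11 (by decide), w11, e₄ 5 (by decide),
        e₃ 5 (by decide), f₂ 5 (by decide)]
  refine Runs.put (D := 88 * E.H) ok₄ rfl (by simp [Expr.cost]; omega)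
    (fun i hi hg => ?_) fun f5 hf5 ok₅ => ?_
  · rw [y15] at hg
    have := (hv i hi hg).2.2.1
    rw [y5]
    change _ < E.Q ^ 2
    omega
  have hw5 := hf5.congr (guard' := m 15) (addr' := m 11) (val' := fun i => deg m (m 11 i) + 1)
    (fun i hi => y15 i)
    (fun i hi => by simp only [Expr.nat, e₄ 11 (by decide), e₃ 11 (by decide), w11])
    (fun i hi => y5 i)
  have e₅ : ∀ a ≠ 5, Function.update m₄ 5 f5 a = m₄ a := fun a ha => Function.update_of_ne ha _ _
  have e₅' : Function.update m₄ 5 f5 5 = f5 := Function.update_self _ _ _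
  generalize Function.update m₄ 5 f5 = m₅ at ok₅ e₅ e₅'
  have c3 : ∀ u v, E.cls m₅ u v = f (u * E.n + v) := fun u v => by
    rw [cls, e₅ 3 (by decide), e₄ 3 (by decide), e₃']
  have c4 : ∀ u v, E.out m₅ u v = f4 (u * E.H + v) := fun u v => by rw [out, e₅ 4 (by decide), e₄']
  have c5 : ∀ u, deg m₅ u = f5 u := fun u => by rw [deg, e₅']
  refine ⟨sl, ok₅, fun a ha => ?_, ?_, ?_, ?_, ?_, ?_, ?_, ?_⟩
  · simp only [List.mem_cons, List.not_mem_nil, or_false, not_or] at ha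
    rw [e₅ a ha.2.2.1, e₄ a ha.2.1, e₃ a ha.1, f₂ a (by simp [ha])]
  · rintro v x ⟨i, hi, hg, rfl, rfl⟩
    obtain ⟨h1, h2, h3⟩ := hsl i hi hg
    rw [← h1]; exact ⟨h2, h3⟩
  · rintro v x hreq
    rw [c3]
    obtain ⟨i, hi, hg, rfl, rfl⟩ := hreq
    rcases hw3 (m 11 i) (m 12 i) (hv i hi hg).2.1 with ⟨i', hi', hg', hA, hB, h⟩ | ⟨hno, _⟩
    · rw [h]; simp only [Expr.nat, Op.nat]
      rw [w15] at hg'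
      rw [(hsl i' hi' hg').1, hA]
    · exact absurd ⟨rfl, rfl⟩ (hno i hi (by rwa [w15]))
  · intro v x hx hno
    rw [c3]
    rcases hw3 v x hx with ⟨i, hi, hg, hA, hB, h⟩ | ⟨_, h⟩
    · rw [w15] at hg; exact absurd ⟨i, hi, hg, hA, hB⟩ hno
    · rw [h, f₂ 3 (by decide)]
  · intro v x hreq
    rw [c4]
    have hreq' := hreq
    obtain ⟨i, hi, hg, rfl, rfl⟩ := hreq
    obtain ⟨h1, h2, h3⟩ := hsl i hi hg
    rcases hw4 (m 11 i) (sl (m 11 i)) (h1 ▸ h2) with ⟨i', hi', hg', hA, hB, h⟩ | ⟨hno, _⟩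
    · rw [h]; simp only [Expr.nat, Op.nat]
      rw [x15] at hg'
      rw [e₃ 12 (by decide), w12, hL _ _ _ ⟨i', hi', hg', hA, rfl⟩ hreq']
    · exact absurd ⟨rfl, h1⟩ (hno i hi (by rwa [x15]))
  · intro v s hs hcond
    rw [c4]
    rcases hw4 v s hs with ⟨i, hi, hg, hA, hB, h⟩ | ⟨_, h⟩
    · rw [x15] at hg
      rcases hcond with h' | h'
      · exact absurd ⟨i, hi, hg, hA, rfl⟩ (h' (m 12 i))
      · exact absurd (by rw [← hB, (hsl i hi hg).1, hA]) h'
    · rw [h, e₃ 4 (by decide), f₂ 4 (by decide)]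
  · rintro v x ⟨i, hi, hg, hA, _⟩
    rw [c5]
    rcases hw5 v with ⟨i', hi', hg', hA', h⟩ | ⟨hno, _⟩
    · rw [h, ← hA']
    · exact absurd hA (hno i hi hg)
  · intro v hno
    rw [c5]
    rcases hw5 v with ⟨i, hi, hg, hA, h⟩ | ⟨_, h⟩
    · exact absurd ⟨i, hi, hg, hA, rfl⟩ (hno (m 12 i))
    · rw [h, e₄ 5 (by decide), e₃ 5 (by decide), f₂ 5 (by decide)]

end Env

/-! ### The invariant of the data structure, and reversing edges -/

namespace Env

variable (E : Env)

/-- The arrays describe an orientation together with an assignment of its edges to slots. A slot may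
be in use without holding an edge, while a deletion is under way. -/
structure Wf (m : Mem) : Prop where
  cls_le : ∀ u < E.n, ∀ v < E.n, E.cls m u v ≤ E.H + 1
  asymm : ∀ u < E.n, ∀ v < E.n, E.cls m u v ≠ 0 → E.cls m v u = 0
  out_le : ∀ u < E.n, ∀ s < E.H, E.out m u s ≤ E.n
  slot : ∀ u < E.n, ∀ v < E.n, ∀ s < E.H, E.cls m u v = s + 1 → E.out m u s = v + 1
  deg_eq : ∀ u < E.n, deg m u = ((Finset.range E.H).filter fun s => E.out m u s ≠ 0).card
  surplus : ∀ u < E.n, ∀ v < E.n, E.cls m u v = E.H + 1 → deg m u = E.H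

/-- The invariant between two modifications: in addition, the search trees are up to date. -/
structure Inv (m : Mem) : Prop where
  ok : E.Ok m
  wf : E.Wf m
  treeOk : E.TreeOk m
  good : ∀ y < E.n, ∀ c ≤ E.H + 1, ∀ x < E.n, E.Good m y c x

/-- Slot `s` of `u` is in use but holds no edge. -/
def Phantom (m : Mem) (u s : ℕ) : Prop := E.out m u s ≠ 0 ∧ ∀ v < E.n, E.cls m u v ≠ s + 1

/-- `u` has a surplus edge. -/
def HasSurplus (m : Mem) (u : ℕ) : Prop := ∃ v < E.n, E.cls m u v = E.H + 1

variable {E}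

theorem top_spec {m : Mem} (hT : E.TreeOk m) {u : ℕ}
    (hg : ∀ x < E.n, E.Good m u (E.H + 1) x) :
    (E.top m u ≠ 0 → E.cls m u (E.top m u % E.n) = E.H + 1) ∧
    (E.top m u = 0 → ¬ E.HasSurplus m u) := by
  have hn := E.two_le_n
  have hl : ∀ x < E.n, E.tree m (E.tid u (E.H + 1)) (E.n + x) =
      if E.cls m u x = E.H + 1 then E.n + x else 0 := fun x hx => by
    rw [hg x hx, leafVal, if_neg (by omega)]
  constructor
  · intro h
    obtain ⟨x, hx, e⟩ := exists_leaf_eq hT (E.tid u (E.H + 1)) _ 1 rfl le_rfl (by omega)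
    rw [hl x hx] at e
    by_cases hc : E.cls m u x = E.H + 1
    · rw [if_pos hc] at e
      rw [top, e, Nat.add_mod_left, Nat.mod_eq_of_lt hx, hc]
    · rw [if_neg hc] at e; exact absurd e h
  · rintro h ⟨v, hv, hc⟩
    have := tree_le_root hT (E.tid u (E.H + 1)) (E.n + v) (by omega) (by omega)
    rw [hl v hv, if_pos hc] at this
    rw [top] at h
    omega

/-- The root of the tree of vertex `y` and class `c ≤ H` gives an in-neighbour of maximum degree. -/
theorem root_spec {m : Mem} (hT : E.TreeOk m) {y c : ℕ} (hc : c ≤ E.H)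
    (hg : ∀ x < E.n, E.Good m y c x) :
    (E.tree m (E.tid y c) 1 ≠ 0 →
      E.cls m (E.tree m (E.tid y c) 1 % E.n) y = c + 1 ∧
      E.tree m (E.tid y c) 1 / E.n = deg m (E.tree m (E.tid y c) 1 % E.n) + 1) ∧
    ∀ x < E.n, E.cls m x y = c + 1 → deg m x + 1 ≤ E.tree m (E.tid y c) 1 / E.n := by
  have hn := E.two_le_n
  have hl : ∀ x < E.n, E.tree m (E.tid y c) (E.n + x) =
      if E.cls m x y = c + 1 then (deg m x + 1) * E.n + x else 0 := fun x hx => by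
    rw [hg x hx, leafVal, if_pos hc]
  constructor
  · intro h
    obtain ⟨x, hx, e⟩ := exists_leaf_eq hT (E.tid y c) _ 1 rfl le_rfl (by omega)
    rw [hl x hx] at e
    by_cases hc' : E.cls m x y = c + 1
    · rw [if_pos hc'] at e
      have h1 : ((deg m x + 1) * E.n + x) % E.n = x := by
        rw [Nat.mul_comm, Nat.mul_add_mod, Nat.mod_eq_of_lt hx]
      have h2 : ((deg m x + 1) * E.n + x) / E.n = deg m x + 1 := by
        rw [Nat.mul_comm, Nat.mul_add_div (by omega), Nat.div_eq_of_lt hx, Nat.add_zero]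
      rw [e, h1, h2]
      exact ⟨hc', rfl⟩
    · rw [if_neg hc'] at e; exact absurd e h
  · intro x hx hcx
    have := tree_le_root hT (E.tid y c) (E.n + x) (by omega) (by omega)
    rw [hl x hx, if_pos hcx] at this
    rw [Nat.le_div_iff_mul_le (by omega)]
    omega

theorem Wf.free_slot {m : Mem} (h : E.Wf m) {u : ℕ} (hu : u < E.n) (hd : deg m u < E.H) :
    ∃ s < E.H, E.out m u s = 0 := by
  by_contra! hcon
  rw [h.deg_eq u hu, Finset.filter_true_of_mem fun s hs => hcon s (Finset.mem_range.1 hs),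
    Finset.card_range] at hd
  exact lt_irrefl _ hd

theorem Wf.deg_le {m : Mem} (h : E.Wf m) {u : ℕ} (hu : u < E.n) : deg m u ≤ E.H := by
  rw [h.deg_eq u hu]
  exact (Finset.card_filter_le _ _).trans (Finset.card_range _).le

/-- The slot of an edge determines its head. -/
theorem Wf.head_unique {m : Mem} (h : E.Wf m) {u v v' s : ℕ} (hu : u < E.n) (hv : v < E.n)
    (hv' : v' < E.n) (hs : s < E.H) (h1 : E.cls m u v = s + 1) (h2 : E.cls m u v' = s + 1) :
    v = v' := by
  have := h.slot u hu v hv s hs h1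
  have := h.slot u hu v' hv' s hs h2
  omega

/-- The slots that `fixSlot` refills must be in use without holding an edge. -/
structure FixPre (E : Env) (m : Mem) : Prop where
  unique : ∀ u j j', E.FixReq m u j → E.FixReq m u j' → j = j'
  top : ∀ u j, E.FixReq m u j → (E.top m u ≠ 0 → E.cls m u (E.top m u % E.n) = E.H + 1) ∧
    (E.top m u = 0 → ¬ E.HasSurplus m u)
  phantom : ∀ u j, E.FixReq m u j → u < E.n ∧ E.Phantom m u j

theorem FixReq.lt {m : Mem} {u j : ℕ} (h : E.FixReq m u j) : j < E.H := by
  obtain ⟨_, _, _, h, _, h'⟩ := h; exact h' ▸ h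

theorem Fixed.cls_change {m m' : Mem} (h : E.Fixed m m') (hp : E.FixPre m) {u v : ℕ}
    (hv : v < E.n) (hc : E.cls m' u v ≠ E.cls m u v) :
    ∃ j, E.FixReq m u j ∧ E.top m u ≠ 0 ∧ v = E.top m u % E.n ∧ E.cls m u v = E.H + 1 ∧
      E.cls m' u v = j + 1 := by
  by_cases hj : ∃ j, E.FixReq m u j
  · obtain ⟨j, hj⟩ := hj
    have h1 : E.top m u ≠ 0 := fun h1 => hc (h.cls_old u v hv (.inr (.inl h1)))
    have h2 : v = E.top m u % E.n := by
      by_contra h2; exact hc (h.cls_old u v hv (.inr (.inr h2)))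
    exact ⟨j, hj, h1, h2, h2 ▸ (hp.top u j hj).1 h1, h2 ▸ h.cls_new u j hj h1⟩
  · exact absurd (h.cls_old u v hv (.inl fun j hj' => hj ⟨j, hj'⟩)) hc

theorem Fixed.cls_ne_zero {m m' : Mem} (h : E.Fixed m m') (hp : E.FixPre m) {u v : ℕ}
    (hv : v < E.n) : E.cls m' u v ≠ 0 ↔ E.cls m u v ≠ 0 := by
  by_cases hc : E.cls m' u v = E.cls m u v
  · rw [hc]
  · obtain ⟨j, _, _, _, h1, h2⟩ := h.cls_change hp hv hc
    rw [h1, h2]; simp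

theorem Fixed.cls_core {m m' : Mem} (h : E.Fixed m m') (hp : E.FixPre m) {u v s : ℕ}
    (hv : v < E.n) (hs : s < E.H) (h1 : E.cls m u v = s + 1) : E.cls m' u v = s + 1 := by
  by_contra hc
  obtain ⟨j, _, _, _, h2, _⟩ := h.cls_change hp hv (by rwa [h1])
  omega

theorem Fixed.cls_surplus {m m' : Mem} (h : E.Fixed m m') (hp : E.FixPre m) {u v : ℕ}
    (hv : v < E.n) (h1 : E.cls m' u v = E.H + 1) : E.cls m u v = E.H + 1 := by
  by_contra hc
  obtain ⟨j, _, _, _, h2, _⟩ := h.cls_change hp hv (by rw [h1]; exact Ne.symm hc)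
  exact hc h2

theorem Fixed.deg_of_surplus {m m' : Mem} (h : E.Fixed m m') (hp : E.FixPre m) {u : ℕ}
    (hs : E.HasSurplus m u) : deg m' u = deg m u := by
  refine h.deg_old u ?_
  by_cases hj : ∃ j, E.FixReq m u j
  · obtain ⟨j, hj⟩ := hj
    exact .inr fun h0 => (hp.top u j hj).2 h0 hs
  · exact .inl fun j hj' => hj ⟨j, hj'⟩

theorem Fixed.deg_of_not_surplus {m m' : Mem} (h : E.Fixed m m') (hp : E.FixPre m) {u j : ℕ}
    (hj : E.FixReq m u j) (hs : ¬ E.HasSurplus m u) : deg m' u = deg m u - 1 := by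
  refine h.deg_new u j hj ?_
  by_contra h0
  exact hs ⟨_, Nat.mod_lt _ (by have := E.two_le_n; omega), (hp.top u j hj).1 h0⟩

theorem Fixed.phantom_iff {m m' : Mem} (h : E.Fixed m m') (hp : E.FixPre m)
    {u s : ℕ} (hs : s < E.H) : E.Phantom m' u s ↔ E.Phantom m u s ∧ ¬ E.FixReq m u s := by
  have hn : E.top m u % E.n < E.n := Nat.mod_lt _ (by have := E.two_le_n; omega)
  by_cases hj : E.FixReq m u s
  · refine ⟨fun hph => ?_, fun hph => absurd hj hph.2⟩
    by_cases h0 : E.top m u = 0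
    · exact absurd (by rw [h.out_new u s hj, if_pos h0]) hph.1
    · exact absurd (h.cls_new u s hj h0) (hph.2 _ hn)
  · rw [Phantom, Phantom, h.out_old u s hs hj]
    constructor
    · refine fun hph => ⟨⟨hph.1, fun v hv hc => ?_⟩, hj⟩
      exact hph.2 v hv (h.cls_core hp hv hs hc)
    · refine fun hph => ⟨hph.1.1, fun v hv hc => ?_⟩
      by_cases he : E.cls m' u v = E.cls m u v
      · exact hph.1.2 v hv (he ▸ hc)
      · obtain ⟨j, hj', _, _, _, h2⟩ := h.cls_change hp hv he
        obtain rfl : j = s := by omega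
        exact hj hj'

theorem Fixed.wf {m m' : Mem} (h : E.Fixed m m') (hp : E.FixPre m) (w : E.Wf m) : E.Wf m' := by
  have hn := E.two_le_n
  refine ⟨fun u hu v hv => ?_, fun u hu v hv hc => ?_, fun u hu s hs => ?_,
    fun u hu v hv s hs hc => ?_, fun u hu => ?_, fun u hu v hv hc => ?_⟩
  · by_cases hc : E.cls m' u v = E.cls m u v
    · rw [hc]; exact w.cls_le u hu v hv
    · obtain ⟨j, hj, _, _, _, h2⟩ := h.cls_change hp hv hc
      have := hj.lt; omega
  · have := w.asymm u hu v hv ((h.cls_ne_zero hp hv).1 hc)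
    by_contra h0
    exact (h.cls_ne_zero hp hu).1 h0 this
  · by_cases hj : E.FixReq m u s
    · rw [h.out_new u s hj]
      have := Nat.mod_lt (E.top m u) (show E.n > 0 by omega)
      split_ifs <;> omega
    · rw [h.out_old u s hs hj]; exact w.out_le u hu s hs
  · by_cases he : E.cls m' u v = E.cls m u v
    · have ho := w.slot u hu v hv s hs (he ▸ hc)
      by_cases hj : E.FixReq m u s
      · exact absurd (he ▸ hc) ((hp.phantom u s hj).2.2 v hv)
      · rw [h.out_old u s hs hj, ho]
    · obtain ⟨j, hj, h0, h1, _, h2⟩ := h.cls_change hp hv he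
      obtain rfl : j = s := by omega
      rw [h.out_new u j hj, if_neg h0, h1]
  · by_cases hj : ∃ j, E.FixReq m u j
    · obtain ⟨j, hj⟩ := hj
      have hold : ∀ s < E.H, s ≠ j → E.out m' u s = E.out m u s := fun s hs hne =>
        h.out_old u s hs fun hs' => hne (hp.unique u s j hs' hj)
      by_cases h0 : E.top m u = 0
      · rw [h.deg_new u j hj h0, w.deg_eq u hu, ← Finset.card_erase_of_mem (a := j)
          (Finset.mem_filter.2 ⟨Finset.mem_range.2 hj.lt, (hp.phantom u j hj).2.1⟩)]
        congr 1
        ext s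
        simp only [Finset.mem_erase, Finset.mem_filter, Finset.mem_range]
        by_cases hs : s = j
        · subst hs; simp [h.out_new u s hj, h0]
        · constructor
          · rintro ⟨_, h1, h2⟩; exact ⟨h1, by rwa [hold s h1 hs]⟩
          · rintro ⟨h1, h2⟩; exact ⟨hs, h1, by rwa [hold s h1 hs] at h2⟩
      · rw [h.deg_old u (.inr h0), w.deg_eq u hu]
        congr 1
        refine Finset.filter_congr fun s hs => ?_
        by_cases hsj : s = j
        · subst hsj
          simp [h.out_new u s hj, h0, (hp.phantom u s hj).2.1]
        · rw [hold s (Finset.mem_range.1 hs) hsj]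
    · rw [h.deg_old u (.inl fun j hj' => hj ⟨j, hj'⟩), w.deg_eq u hu]
      congr 1
      refine Finset.filter_congr fun s hs => ?_
      rw [h.out_old u s (Finset.mem_range.1 hs) fun h' => hj ⟨s, h'⟩]
  · have h1 := h.cls_surplus hp hv hc
    rw [h.deg_of_surplus hp ⟨v, hv, h1⟩]
    exact w.surplus u hu v hv h1

/-- The edges that `link` inserts must be new, and at most one per tail. -/
structure LinkPre (E : Env) (m : Mem) : Prop where
  unique : ∀ v x x', E.LinkReq m v x → E.LinkReq m v x' → x = x'
  lt : ∀ v x, E.LinkReq m v x → v < E.n ∧ x < E.n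
  new : ∀ v x, E.LinkReq m v x → E.cls m v x = 0 ∧ E.cls m x v = 0 ∧ ¬ E.LinkReq m x v
  room : ∀ v x, E.LinkReq m v x → deg m v < E.H

theorem Linked.cls_ne_zero {m m' : Mem} {sl : ℕ → ℕ} (h : E.Linked m m' sl) {v x : ℕ}
    (hx : x < E.n) : E.cls m' v x ≠ 0 ↔ E.cls m v x ≠ 0 ∨ E.LinkReq m v x := by
  by_cases hr : E.LinkReq m v x
  · simp [h.cls_new v x hr, hr]
  · simp [h.cls_old v x hx hr, hr]

theorem Linked.cls_of_ne_zero {m m' : Mem} {sl : ℕ → ℕ} (h : E.Linked m m' sl)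
    (hp : E.LinkPre m) {v x : ℕ} (hx : x < E.n) (h0 : E.cls m v x ≠ 0) :
    E.cls m' v x = E.cls m v x :=
  h.cls_old v x hx fun hr => h0 (hp.new v x hr).1

theorem Linked.cls_surplus {m m' : Mem} {sl : ℕ → ℕ} (h : E.Linked m m' sl) {u v : ℕ}
    (hv : v < E.n) (h1 : E.cls m' u v = E.H + 1) : E.cls m u v = E.H + 1 := by
  by_cases hr : E.LinkReq m u v
  · have := (h.free u v hr).1
    rw [h.cls_new u v hr] at h1; omega
  · rwa [← h.cls_old u v hv hr]

theorem Linked.phantom_iff {m m' : Mem} {sl : ℕ → ℕ} (h : E.Linked m m' sl) (hp : E.LinkPre m)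
    {u s : ℕ} (hs : s < E.H) : E.Phantom m' u s ↔ E.Phantom m u s := by
  by_cases hr : (∃ x, E.LinkReq m u x) ∧ s = sl u
  · obtain ⟨⟨x, hr⟩, rfl⟩ := hr
    refine ⟨fun hph => absurd (h.cls_new u x hr) (hph.2 x (hp.lt u x hr).2), fun hph =>
      absurd (h.free u x hr).2 hph.1⟩
  · have ho : E.out m' u s = E.out m u s := by
      refine h.out_old u s hs ?_
      by_cases h1 : s = sl u
      · exact .inl fun x hx => hr ⟨⟨x, hx⟩, h1⟩
      · exact .inr h1
    rw [Phantom, Phantom, ho]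
    refine and_congr_right fun _ => forall_congr' fun v => forall_congr' fun hv => not_congr ?_
    by_cases hr' : E.LinkReq m u v
    · rw [h.cls_new u v hr', (hp.new u v hr').1]
      have : s ≠ sl u := fun h1 => hr ⟨⟨v, hr'⟩, h1⟩
      omega
    · rw [h.cls_old u v hv hr']

theorem Linked.wf {m m' : Mem} {sl : ℕ → ℕ} (h : E.Linked m m' sl) (hp : E.LinkPre m)
    (w : E.Wf m) : E.Wf m' := by
  refine ⟨fun u hu v hv => ?_, fun u hu v hv hc => ?_, fun u hu s hs => ?_,
    fun u hu v hv s hs hc => ?_, fun u hu => ?_, fun u hu v hv hc => ?_⟩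
  · by_cases hr : E.LinkReq m u v
    · have := (h.free u v hr).1
      rw [h.cls_new u v hr]; omega
    · rw [h.cls_old u v hv hr]; exact w.cls_le u hu v hv
  · by_contra h0
    have h1 := (h.cls_ne_zero hv).1 hc
    have h2 := (h.cls_ne_zero hu).1 h0
    rcases h1 with h1 | h1
    · rcases h2 with h2 | h2
      · exact h2 (w.asymm u hu v hv h1)
      · exact h1 (hp.new v u h2).2.1
    · rcases h2 with h2 | h2
      · exact h2 (hp.new u v h1).2.1
      · exact (hp.new u v h1).2.2 h2
  · by_cases hr : (∃ x, E.LinkReq m u x) ∧ s = sl u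
    · obtain ⟨⟨x, hr⟩, rfl⟩ := hr
      rw [h.out_new u x hr]; exact (hp.lt u x hr).2
    · rw [h.out_old u s hs]
      · exact w.out_le u hu s hs
      · by_cases h1 : s = sl u
        · exact .inl fun x hx => hr ⟨⟨x, hx⟩, h1⟩
        · exact .inr h1
  · by_cases hr : E.LinkReq m u v
    · rw [h.cls_new u v hr] at hc
      obtain rfl : sl u = s := by omega
      exact h.out_new u v hr
    · rw [h.cls_old u v hv hr] at hc
      have ho := w.slot u hu v hv s hs hc
      rw [h.out_old u s hs, ho]
      by_cases hx : ∃ x, E.LinkReq m u x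
      · obtain ⟨x, hx⟩ := hx
        right; rintro rfl
        rw [(h.free u x hx).2] at ho; omega
      · exact .inl fun x hx' => hx ⟨x, hx'⟩
  · by_cases hx : ∃ x, E.LinkReq m u x
    · obtain ⟨x, hx⟩ := hx
      obtain ⟨f1, f2⟩ := h.free u x hx
      rw [h.deg_new u x hx, w.deg_eq u hu, ← Finset.card_insert_of_notMem (a := sl u)
        (by simp [f2])]
      congr 1
      ext s
      simp only [Finset.mem_insert, Finset.mem_filter, Finset.mem_range]
      by_cases hs : s = sl u
      · subst hs; simp [h.out_new u x hx, f1]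
      · simp only [hs, false_or]
        refine and_congr_right fun hs' => ?_
        rw [h.out_old u s hs' (.inr hs)]
    · have hx' : ∀ x, ¬ E.LinkReq m u x := fun x h' => hx ⟨x, h'⟩
      rw [h.deg_old u hx', w.deg_eq u hu]
      congr 1
      refine Finset.filter_congr fun s hs => ?_
      rw [h.out_old u s (Finset.mem_range.1 hs) (.inl hx')]
  · have h1 := h.cls_surplus hv hc
    have h2 := w.surplus u hu v hv h1
    rw [h.deg_old u fun x hx => ?_, h2]
    have := hp.room u x hx
    omega

/-- All leaves are up to date after a modification that only concerns the vertices in `act`, if all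
leaves of their core edges and of the edges that have changed are refreshed. -/
theorem Inv.of_refreshed {m₀ m m' : Mem} {T : ℕ → ℕ → ℕ → Prop} {act : ℕ → Prop} (h₀ : E.Inv m₀)
    (w : E.Wf m) (h6 : m 6 = m₀ 6) (hr : E.Refreshed m m' T)
    (hslot : ∀ u < E.n, act u → ∀ s < E.H, ∀ v, E.out m u s = v + 1 → T v s u)
    (hdeg : ∀ u < E.n, deg m u ≠ deg m₀ u → act u)
    (hcls : ∀ u < E.n, ∀ v < E.n, E.cls m u v ≠ E.cls m₀ u v → act u ∧
      (∀ s < E.H, E.cls m₀ u v = s + 1 → T v s u) ∧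
      (E.cls m₀ u v = E.H + 1 ∨ E.cls m u v = E.H + 1 → T v E.H u ∧ T u (E.H + 1) v)) :
    E.Inv m' := by
  have h3 := hr.frame 3 (by decide)
  have h4 := hr.frame 4 (by decide)
  have h5 := hr.frame 5 (by decide)
  have w' : E.Wf m' := by
    obtain ⟨a1, a2, a3, a4, a5, a6⟩ := w
    constructor <;> simpa only [cls, out, deg, h3, h4, h5]
  refine ⟨hr.ok, w', hr.treeOk, fun y hy c hc x hx => ?_⟩
  by_cases hT : T y c x
  · exact hr.fresh y c x hc hx hT
  refine hr.keep y c x hc hx ?_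
  have hg := h₀.good y hy c hc x hx
  rw [Good] at hg ⊢
  have ht : E.tree m (E.tid y c) (E.n + x) = E.tree m₀ (E.tid y c) (E.n + x) := by
    simp only [tree, h6]
  rw [ht, hg, leafVal, leafVal]
  by_cases hcH : c ≤ E.H
  · rw [if_pos hcH, if_pos hcH]
    have key : E.cls m₀ x y = c + 1 ∨ E.cls m x y = c + 1 →
        E.cls m x y = E.cls m₀ x y ∧ deg m x = deg m₀ x := by
      intro hor
      by_cases hch : E.cls m x y = E.cls m₀ x y
      · refine ⟨hch, ?_⟩
        rw [hch, or_self] at hor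
        rcases hcH.lt_or_eq with hlt | rfl
        · by_contra hne
          exact hT (hslot x hx (hdeg x hx hne) c hlt y (w.slot x hx y hy c hlt (hch ▸ hor)))
        · rw [h₀.wf.surplus x hx y hy hor, w.surplus x hx y hy (hch ▸ hor)]
      · obtain ⟨b1, b2, b3⟩ := hcls x hx y hy hch
        exfalso
        rcases hcH.lt_or_eq with hlt | rfl
        · rcases hor with hor | hor
          · exact hT (b2 c hlt hor)
          · exact hT (hslot x hx b1 c hlt y (w.slot x hx y hy c hlt hor))
        · exact hT (b3 hor).1
    by_cases hor : E.cls m₀ x y = c + 1 ∨ E.cls m x y = c + 1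
    · rw [(key hor).1, (key hor).2]
    · rw [not_or] at hor
      rw [if_neg hor.1, if_neg hor.2]
  · obtain rfl : c = E.H + 1 := by omega
    rw [if_neg hcH, if_neg hcH]
    by_cases hch : E.cls m y x = E.cls m₀ y x
    · rw [hch]
    · by_cases hor : E.cls m₀ y x = E.H + 1 ∨ E.cls m y x = E.H + 1
      · exact absurd ((hcls y hy x hx hch).2.2 hor).2 hT
      · rw [not_or] at hor
        rw [if_neg hor.1, if_neg hor.2]

end Env

/-- Every processor with nonzero register `15` reverses the edge from the vertex in register `12` to
the vertex in register `11`; register `14` holds the class of these edges. -/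
def flip : Prog :=
  .seq (put (reg 15) 3 (eAdd (eMul (reg 12) eN) (reg 11)) (.const 0)) <|
  .seq fixSlot <| .seq link refresh

namespace Env

variable {E : Env}

/-- The arrays that `flip` may modify. -/
def flipArrs : List ℕ := [3, 4, 5, 6, 13, 16, 17, 18, 19, 20, 21, 27, 31, 40, 41, 42, 44, 45]

/-- The effect of reversing the edges in `F`. -/
structure Flipped (E : Env) (F : ℕ → ℕ → Prop) (m m' : Mem) : Prop where
  inv : E.Inv m'
  edge : ∀ u < E.n, ∀ v < E.n, (E.cls m' u v ≠ 0 ↔ (E.cls m u v ≠ 0 ∧ ¬ F u v) ∨ F v u)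
  deg_tail : ∀ u < E.n, ∀ v, F u v → (∀ w, ¬ F w u) → (E.HasSurplus m u → deg m' u = deg m u) ∧
    (¬ E.HasSurplus m u → deg m' u = deg m u - 1)
  deg_head : ∀ v < E.n, ∀ u, F u v → (∀ w, ¬ F v w) → deg m' v = deg m v + 1
  deg_old : ∀ u < E.n, (∀ w, ¬ F u w) → (∀ w, ¬ F w u) → deg m' u = deg m u
  core : ∀ u < E.n, ∀ v < E.n, ∀ s < E.H, E.cls m u v = s + 1 → ¬ F u v → E.cls m' u v = s + 1
  surplus : ∀ u < E.n, ∀ v < E.n, E.cls m' u v = E.H + 1 → E.cls m u v = E.H + 1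
  phantom : ∀ u < E.n, ∀ s < E.H, (E.Phantom m' u s ↔ E.Phantom m u s)

theorem runs_flip {m : Mem} {j : ℕ} (h : E.Inv m) (hj : j ≤ E.H)
    (hact : ∀ i < E.k, m 15 i ≠ 0 → m 14 i = j ∧ m 11 i < E.n ∧ m 12 i < E.n ∧
      E.cls m (m 12 i) (m 11 i) = j + 1 ∧ deg m (m 11 i) + 2 ≤ deg m (m 12 i))
    (huniq : ∀ i < E.k, ∀ i' < E.k, m 15 i ≠ 0 → m 15 i' ≠ 0 → m 11 i = m 11 i' →
      m 12 i = m 12 i') :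
    E.Runs flip m (2500 * (E.H * E.levels)) fun m' =>
      E.Flipped (fun x v => E.LinkReq m v x) m m' ∧ ∀ a, a ∉ flipArrs → m' a = m a := by
  have hn := E.two_le_n
  have hH := E.one_le_H
  have hHL : E.H ≤ E.H * E.levels := Nat.le_mul_of_pos_right _ E.one_le_levels
  unfold flip
  refine Runs.then (D := 20) (D' := 2480 * (E.H * E.levels)) (by omega) (Runs.put h.ok rfl
    (by decide) (fun i hi _ => ?_) fun f hf ok₁ => ?_)
  · simp only [Expr.nat]; exact Nat.pow_pos (by have := E.Q_ge; omega)
  have hw := hf.matrix (b := E.n) (A := m 12) (B := m 11) fun i hi hg => by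
    simp only [Expr.nat, Op.nat, h.ok.n] at hg ⊢
    exact ⟨trivial, (hact i hi hg).2.1⟩
  have e₁ : ∀ a ≠ 3, Function.update m 3 f a = m a := fun a ha => Function.update_of_ne ha _ _
  have e₁' : Function.update m 3 f 3 = f := Function.update_self _ _ _
  generalize Function.update m 3 f = m₁ at ok₁ e₁ e₁'
  -- `LinkReq m v x` means that the edge `x → v` is to be reversed
  have hF : ∀ v x, E.LinkReq m v x → v < E.n ∧ x < E.n ∧ E.cls m x v = j + 1 ∧
      deg m v + 2 ≤ deg m x := by
    rintro v x ⟨i, hi, hg, rfl, rfl⟩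
    obtain ⟨_, h1, h2, h3, h4⟩ := hact i hi hg
    exact ⟨h1, h2, h3, h4⟩
  have c₁F : ∀ u v, E.LinkReq m v u → E.cls m₁ u v = 0 := by
    rintro u v ⟨i, hi, hg, rfl, rfl⟩
    rw [cls, e₁']
    rcases hw (m 12 i) (m 11 i) (hact i hi hg).2.1 with ⟨i', hi', hg', hA, hB, h⟩ | ⟨hno, _⟩
    · rw [h]; rfl
    · exact absurd ⟨rfl, rfl⟩ (hno i hi (by simpa only [Expr.nat] using hg))
  have c₁ : ∀ u v, v < E.n → ¬ E.LinkReq m v u → E.cls m₁ u v = E.cls m u v := by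
    intro u v hv hno
    rw [cls, e₁']
    rcases hw u v hv with ⟨i, hi, hg, hA, hB, _⟩ | ⟨_, h⟩
    · simp only [Expr.nat] at hg
      exact absurd ⟨i, hi, hg, hB, hA⟩ hno
    · rw [h]
  have c₁le : ∀ u v, v < E.n → E.cls m₁ u v ≠ 0 → ¬ E.LinkReq m v u ∧ E.cls m₁ u v = E.cls m u v := by
    intro u v hv h0
    have : ¬ E.LinkReq m v u := fun hr => h0 (c₁F u v hr)
    exact ⟨this, c₁ u v hv this⟩
  have o₁ : ∀ u s, E.out m₁ u s = E.out m u s := fun u s => by rw [out, e₁ 4 (by decide)]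
  have d₁ : ∀ u, deg m₁ u = deg m u := fun u => by rw [deg, e₁ 5 (by decide)]
  have w₁ : E.Wf m₁ := by
    refine ⟨fun u hu v hv => ?_, fun u hu v hv hc => ?_, fun u hu s hs => ?_,
      fun u hu v hv s hs hc => ?_, fun u hu => ?_, fun u hu v hv hc => ?_⟩
    · by_cases h0 : E.cls m₁ u v = 0
      · omega
      · rw [(c₁le u v hv h0).2]; exact h.wf.cls_le u hu v hv
    · have := h.wf.asymm u hu v hv ((c₁le u v hv hc).2 ▸ hc)
      by_contra h0
      exact h0 ((c₁le v u hu h0).2.trans this)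
    · rw [o₁]; exact h.wf.out_le u hu s hs
    · rw [o₁]; exact h.wf.slot u hu v hv s hs ((c₁le u v hv (by omega)).2 ▸ hc)
    · rw [d₁, h.wf.deg_eq u hu]; simp only [o₁]
    · rw [d₁]; exact h.wf.surplus u hu v hv ((c₁le u v hv (by omega)).2 ▸ hc)
  have q15 : m₁ 15 = m 15 := e₁ 15 (by decide)
  have q14 : m₁ 14 = m 14 := e₁ 14 (by decide)
  have q12 : m₁ 12 = m 12 := e₁ 12 (by decide)
  have q11 : m₁ 11 = m 11 := e₁ 11 (by decide)
  have fixReq : ∀ u j', E.FixReq m₁ u j' ↔ j' = j ∧ j < E.H ∧ ∃ v, E.LinkReq m v u := by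
    intro u j'
    simp only [FixReq, q15, q14, q12]
    constructor
    · rintro ⟨i, hi, hg, h1, h2, h3⟩
      rw [(hact i hi hg).1] at h1 h3
      exact ⟨h3.symm, h1, _, i, hi, hg, rfl, h2⟩
    · rintro ⟨rfl, h1, v, i, hi, hg, _, h2⟩
      exact ⟨i, hi, hg, (hact i hi hg).1 ▸ h1, h2, (hact i hi hg).1⟩
  have surp : j < E.H → ∀ u, E.HasSurplus m₁ u ↔ E.HasSurplus m u := by
    intro hj' u
    refine exists_congr fun v => and_congr_right fun hv => ?_
    by_cases hr : E.LinkReq m v u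
    · rw [c₁F u v hr, (hF v u hr).2.2.1]; omega
    · rw [c₁ u v hv hr]
  have ph₁ : ∀ u < E.n, ∀ s < E.H, (E.Phantom m₁ u s ↔ E.Phantom m u s ∨ E.FixReq m₁ u s) := by
    intro u hu s hs
    rw [fixReq, Phantom, Phantom, o₁]
    constructor
    · rintro ⟨h1, h2⟩
      by_cases h3 : ∃ v < E.n, E.cls m u v = s + 1
      · obtain ⟨v, hv, h3⟩ := h3
        have hr : E.LinkReq m v u := by
          by_contra hr; exact h2 v hv (by rw [c₁ u v hv hr, h3])
        have := (hF v u hr).2.2.1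
        exact .inr ⟨by omega, by omega, v, hr⟩
      · exact .inl ⟨h1, fun v hv h4 => h3 ⟨v, hv, h4⟩⟩
    · rintro (⟨h1, h2⟩ | ⟨rfl, _, v, hr⟩)
      · refine ⟨h1, fun v hv h3 => h2 v hv ?_⟩
        rw [← (c₁le u v hv (by omega)).2, h3]
      · obtain ⟨a1, a2, a3, a4⟩ := hF v u hr
        refine ⟨by rw [h.wf.slot u hu v a1 s hs a3]; omega, fun v' hv' h3 => ?_⟩
        obtain ⟨b1, b2⟩ := c₁le u v' hv' (by omega)
        obtain rfl := h.wf.head_unique hu hv' a1 hs (b2 ▸ h3) a3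
        exact b1 hr
  have fp : E.FixPre m₁ := by
    refine ⟨fun u s s' h1 h2 => ?_, fun u s hs => ?_, fun u s hs => ?_⟩
    · rw [((fixReq u s).1 h1).1, ((fixReq u s').1 h2).1]
    · obtain ⟨-, hj', v, hr⟩ := (fixReq u s).1 hs
      have hu := (hF v u hr).2.1
      have htop : E.top m₁ u = E.top m u := by rw [top, tree, e₁ 6 (by decide)]
      obtain ⟨t1, t2⟩ := top_spec h.treeOk (fun x hx => h.good u hu (E.H + 1) le_rfl x hx)
      rw [htop, surp hj']
      refine ⟨fun h0 => ?_, t2⟩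
      rw [c₁ _ _ (Nat.mod_lt _ (by omega)), t1 h0]
      intro hr'
      have := (hF _ _ hr').2.2.1
      rw [t1 h0] at this; omega
    · obtain ⟨-, hj', v, hr⟩ := (fixReq u s).1 hs
      have hu := (hF v u hr).2.1
      exact ⟨hu, (ph₁ u hu s hs.lt).2 (.inr hs)⟩
  refine Runs.then (D := 200) (D' := 2280 * (E.H * E.levels)) (by omega)
    ((runs_fixSlot ok₁ fp.unique).mono le_rfl fun m₂ fx => ?_)
  have w₂ := fx.wf fp w₁
  have linkReq : ∀ v x, E.LinkReq m₂ v x ↔ E.LinkReq m v x := by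
    intro v x
    simp only [LinkReq, fx.frame 15 (by decide), fx.frame 11 (by decide), fx.frame 12 (by decide),
      q15, q11, q12]
  have d₂le : ∀ u, deg m₂ u ≤ deg m u := by
    intro u
    rw [← d₁ u]
    by_cases hr : ∃ s, E.FixReq m₁ u s
    · obtain ⟨s, hr⟩ := hr
      by_cases h0 : E.top m₁ u = 0
      · rw [fx.deg_new u s hr h0]; omega
      · rw [fx.deg_old u (.inr h0)]
    · rw [fx.deg_old u (.inl fun s hs => hr ⟨s, hs⟩)]
  have lp : E.LinkPre m₂ := by
    refine ⟨fun v x x' h1 h2 => ?_, fun v x h1 => ?_, fun v x h1 => ?_, fun v x h1 => ?_⟩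
    · rw [linkReq] at h1 h2
      obtain ⟨i, hi, hg, rfl, rfl⟩ := h1
      obtain ⟨i', hi', hg', e, rfl⟩ := h2
      exact huniq i hi i' hi' hg hg' e.symm
    · obtain ⟨a1, a2, _⟩ := hF v x ((linkReq _ _).1 h1); exact ⟨a1, a2⟩
    · have hr := (linkReq _ _).1 h1
      obtain ⟨a1, a2, a3, a4⟩ := hF v x hr
      have a5 := h.wf.asymm x a2 v a1 (by omega)
      refine ⟨?_, ?_, fun h2 => ?_⟩
      · by_contra h0
        have h0' := (fx.cls_ne_zero fp a2).1 h0
        exact h0' ((c₁le v x a2 h0').2.trans a5)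
      · by_contra h0
        exact (fx.cls_ne_zero fp a1).1 h0 (c₁F x v hr)
      · have := (hF x v ((linkReq _ _).1 h2)).2.2.1
        omega
    · obtain ⟨a1, a2, a3, a4⟩ := hF v x ((linkReq _ _).1 h1)
      have := d₂le v
      have := h.wf.deg_le a2
      omega
  have lreq : ∀ i < E.k, m₂ 15 i ≠ 0 → E.LinkReq m₂ (m₂ 11 i) (m₂ 12 i) := fun i hi hg =>
    ⟨i, hi, hg, rfl, rfl⟩
  refine Runs.then (D := 200 * E.H) (D' := 2080 * (E.H * E.levels)) (by omega)
    ((runs_link fx.ok (fun i hi hg => ⟨(lp.lt _ _ (lreq i hi hg)).1, (lp.lt _ _ (lreq i hi hg)).2,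
      lp.room _ _ (lreq i hi hg), w₂.free_slot (lp.lt _ _ (lreq i hi hg)).1
        (lp.room _ _ (lreq i hi hg))⟩) lp.unique).mono le_rfl fun m₃ h₃ => ?_)
  obtain ⟨sl, lk⟩ := h₃
  have w₃ := lk.wf lp w₂
  have fr₃ : ∀ a, a ∉ [3, 4, 5, 13, 21, 27, 31, 44] → m₃ a = m a := fun a ha => by
    simp only [List.mem_cons, List.not_mem_nil, or_false, not_or] at ha
    rw [lk.frame a (by simp [ha]), fx.frame a (by simp [ha]), e₁ a ha.1]
  have h6 : m₃ 6 = m 6 := fr₃ 6 (by decide)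
  have t₃ : E.TreeOk m₃ := fun t z h1 h2 => by
    simp only [tree, h6]; exact h.treeOk t z h1 h2
  have r15 := fr₃ 15 (by decide)
  have r14 := fr₃ 14 (by decide)
  have r12 := fr₃ 12 (by decide)
  have r11 := fr₃ 11 (by decide)
  have r13 : ∀ i < E.k, m₃ 13 i = E.top m₁ (m 12 i) % E.n := fun i hi => by
    rw [lk.frame 13 (by decide), fx.head i hi, q12]
  refine (runs_refresh lk.ok t₃ (fun i hi hg => ?_) w₃.out_le).mono (by omega) fun m₄ rf => ?_
  · rw [r15] at hg
    obtain ⟨a1, a2, a3, a4⟩ := hact i hi hg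
    rw [r11, r12, r13 i hi, r14]
    exact ⟨a2, a3, Nat.mod_lt _ (by omega), by omega⟩
  have s3 : ∀ u v, E.cls m₄ u v = E.cls m₃ u v := fun u v => by rw [cls, rf.frame 3 (by decide)]
  have s4 : ∀ u v, E.out m₄ u v = E.out m₃ u v := fun u v => by rw [out, rf.frame 4 (by decide)]
  have s5 : ∀ u, deg m₄ u = deg m₃ u := fun u => by rw [deg, rf.frame 5 (by decide)]
  refine ⟨⟨?_, fun u hu v hv => ?_, fun u hu v hr hno => ?_,
    fun v hv u hr hno => ?_, fun u hu h1 h2 => ?_, fun u hu v hv s hs hc hno => ?_,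
    fun u hu v hv hc => ?_, fun u hu s hs => ?_⟩, fun a ha => ?_⟩
  · -- the invariant
    refine h.of_refreshed w₃ h6 rf (act := fun u => ∃ v, E.LinkReq m u v ∨ E.LinkReq m v u)
      ?_ ?_ ?_
    · rintro u hu ⟨v, ⟨i, hi, hg, h1, h2⟩ | ⟨i, hi, hg, h1, h2⟩⟩ s hs v' ho
      · exact ⟨i, hi, by rwa [r15], .inr (.inr (.inr (.inr ⟨.inr (by rw [r11, h1]), hs, ho⟩)))⟩
      · exact ⟨i, hi, by rwa [r15], .inr (.inr (.inr (.inr ⟨.inl (by rw [r12, h2]), hs, ho⟩)))⟩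
    · intro u hu hne
      by_contra hno
      simp only [not_exists, not_or] at hno
      refine hne ?_
      rw [lk.deg_old u fun x hx => (hno x).1 ((linkReq _ _).1 hx), fx.deg_old u (.inl fun s hs => ?_),
        d₁]
      obtain ⟨-, -, v, hv⟩ := (fixReq u s).1 hs
      exact (hno v).2 hv
    · intro u hu v hv hne
      by_cases hl : E.LinkReq m u v
      · -- a new edge
        have h0 : E.cls m u v = 0 := h.wf.asymm v hv u hu (by rw [(hF u v hl).2.2.1]; omega)
        have h1 := lk.cls_new u v ((linkReq _ _).2 hl)
        have h2 := (lk.free u v ((linkReq _ _).2 hl)).1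
        refine ⟨⟨v, .inl hl⟩, fun s _ h3 => by omega, fun h3 => by omega⟩
      have h3 : E.cls m₃ u v = E.cls m₂ u v :=
        lk.cls_old u v hv fun h' => hl ((linkReq _ _).1 h')
      by_cases hr : E.LinkReq m v u
      · -- a removed edge
        have hr' := hr
        obtain ⟨i, hi, hg, h1, h2⟩ := hr
        have hm₃ : E.cls m₃ u v = 0 := by
          by_contra h0
          rw [h3] at h0
          exact (fx.cls_ne_zero fp hv).1 h0 (c₁F u v hr')
        have hj' := (hF v u hr').2.2.1
        refine ⟨⟨v, .inr hr'⟩, fun s hs h4 => ⟨i, hi, by rwa [r15], .inl ⟨by rw [r11, h1], ?_,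
          by rw [r12, h2]⟩⟩, fun h4 => ⟨⟨i, hi, by rwa [r15], .inl ⟨by rw [r11, h1], ?_,
          by rw [r12, h2]⟩⟩, ⟨i, hi, by rwa [r15], .inr (.inl ⟨by rw [r12, h2], rfl,
          by rw [r11, h1]⟩)⟩⟩⟩
        · rw [r14, (hact i hi hg).1]; omega
        · rw [r14, (hact i hi hg).1]; omega
      · -- a promoted edge
        rw [h3, ← c₁ u v hv hr] at hne
        obtain ⟨s, hs, _, h2, h4, h5⟩ := fx.cls_change fp hv hne
        have hs' := hs.lt
        obtain ⟨-, -, v', hv'⟩ := (fixReq u s).1 hs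
        have hv'' := hv'
        obtain ⟨i, hi, hg, a1, a2⟩ := hv'
        rw [c₁ u v hv hr] at h4
        have h13 : m₃ 13 i = v := by rw [r13 i hi, a2, h2]
        exact ⟨⟨v', .inr hv''⟩, fun s' _ _ => by omega, fun _ => ⟨⟨i, hi, by rwa [r15],
          .inr (.inr (.inl ⟨h13.symm, rfl, by rw [r12, a2]⟩))⟩, ⟨i, hi, by rwa [r15],
          .inr (.inr (.inr (.inl ⟨by rw [r12, a2], rfl, h13.symm⟩)))⟩⟩⟩
  · rw [s3, lk.cls_ne_zero hv, linkReq, fx.cls_ne_zero fp hv]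
    refine or_congr_left ⟨fun h0 => ?_, fun h0 => ?_⟩
    · obtain ⟨a1, a2⟩ := c₁le u v hv h0
      exact ⟨a2 ▸ h0, a1⟩
    · rw [c₁ u v hv h0.2]; exact h0.1
  · have e : deg m₄ u = deg m₂ u := by
      rw [s5, lk.deg_old u fun x hx => hno x ((linkReq _ _).1 hx)]
    rw [e, ← d₁ u]
    rcases hj.lt_or_eq with hj' | rfl
    · rw [← surp hj']
      exact ⟨fun hs => fx.deg_of_surplus fp hs,
        fun hs => fx.deg_of_not_surplus fp ((fixReq u j).2 ⟨rfl, hj', v, hr⟩) hs⟩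
    · refine ⟨fun _ => fx.deg_old u (.inl fun s hs => ?_), fun hs => absurd ⟨v, (hF v u hr).1,
        (hF v u hr).2.2.1⟩ hs⟩
      have := ((fixReq u s).1 hs).2.1
      omega
  · rw [s5, lk.deg_new v u ((linkReq _ _).2 hr), fx.deg_old v (.inl fun s hs => ?_), d₁]
    obtain ⟨-, -, w, hw⟩ := (fixReq v s).1 hs
    exact hno w hw
  · rw [s5, lk.deg_old u fun x hx => h2 x ((linkReq _ _).1 hx),
      fx.deg_old u (.inl fun s hs => ?_), d₁]
    obtain ⟨-, -, w, hw⟩ := (fixReq u s).1 hs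
    exact h1 w hw
  · rw [← c₁ u v hv hno] at hc
    have := fx.cls_core fp hv hs hc
    rw [s3, lk.cls_of_ne_zero lp hv (by omega), this]
  · rw [s3] at hc
    have := fx.cls_surplus fp hv (lk.cls_surplus hv hc)
    rw [← (c₁le u v hv (by omega)).2, this]
  · have : E.Phantom m₄ u s ↔ E.Phantom m₃ u s := by simp only [Phantom, s3, s4]
    rw [this, lk.phantom_iff lp hs, fx.phantom_iff fp hs, ph₁ u hu s hs]
    refine ⟨fun h' => h'.1.resolve_right h'.2, fun h' => ⟨.inl h', fun hr => ?_⟩⟩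
    obtain ⟨rfl, -, v, hv⟩ := (fixReq u s).1 hr
    exact h'.2 v (hF v u hv).1 (hF v u hv).2.2.1
  · have h1 : a ∉ refreshArrs := fun h' =>
      ha ((by decide : ∀ a ∈ refreshArrs, a ∈ flipArrs) a h')
    rw [rf.frame a h1]
    exact fr₃ a fun h' =>
      ha ((by decide : ∀ a ∈ [3, 4, 5, 13, 21, 27, 31, 44], a ∈ flipArrs) a h')

end Env

end PRAM

/-! ### Token dropping -/

namespace TokenGame

variable {V : Type*}

/-- A path from an occupied position to a free position. Its edges are the pairs of the relation
`G`, which is the direction in which tokens move. -/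
structure ActivePath (G : V → V → Prop) (occ : V → Prop) (P : List V) : Prop where
  chain : P.IsChain G
  head : ∃ p ∈ P.head?, occ p
  last : ∃ q ∈ P.getLast?, ¬ occ q

/-- After `r` rounds, every active path has potential at most `K - r`. During round `r + 1`, this
has improved to `K - (r + 1)`, or none of the pairs `(p, q)` handled so far is a move from an
occupied to a free position on the path. -/
def Slack (G : V → V → Prop) (occ : V → Prop) (θ : V → ℕ) (done : V → V → Prop) (K r : ℕ) : Prop :=
  ∀ P, ActivePath G occ P → (P.map θ).sum + r + 1 ≤ K ∨
    ((P.map θ).sum + r ≤ K ∧ ∀ p q, [p, q] <:+: P → occ p → ¬ occ q → ¬ done p q)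

/-- A step of the game: tokens move along edges of `G` from occupied to free positions, edges are
only removed, and the potential of a position decreases whenever its occupation changes. A pair on
which a token could still move has not been handled by the step. -/
structure Step (G : V → V → Prop) (occ : V → Prop) (θ : V → ℕ) (done : V → V → Prop)
    (G' : V → V → Prop) (occ' : V → Prop) (θ' : V → ℕ) (done' : V → V → Prop) : Prop where
  sub : ∀ p q, G' p q → G p q
  pass : ∀ v, occ v → ¬ occ' v → ∃ x, G v x ∧ ¬ occ x
  receive : ∀ v, ¬ occ v → occ' v → ∃ u, G u v ∧ occ u
  mono : ∀ v, θ' v ≤ θ v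
  strict : ∀ v, ¬ (occ v ↔ occ' v) → θ' v < θ v
  done : ∀ p q, G' p q → occ p → ¬ occ q → occ' p → ¬ occ' q → done' p q → done p q

variable {G G' : V → V → Prop} {occ occ' : V → Prop} {θ θ' : V → ℕ} {done done' : V → V → Prop}
  {K r : ℕ}

/-- An active path after a step comes from an active path before the step: if one of its ends has
changed its occupation, the path is prolonged along the move responsible for this. -/
theorem Slack.step (h : Slack G occ θ done K r) (hs : Step G occ θ done G' occ' θ' done') :
    Slack G' occ' θ' done' K r := by
  rintro P ⟨hc, ⟨p, hp, hp'⟩, ⟨q, hq, hq'⟩⟩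
  have hcG : P.IsChain G := hc.imp hs.sub
  have hle : (P.map θ').sum ≤ (P.map θ).sum := List.sum_le_sum fun v _ => hs.mono v
  by_cases hall : ∀ v ∈ P, (occ v ↔ occ' v)
  · have hpP : p ∈ P := List.mem_of_mem_head? hp
    have hqP : q ∈ P := List.mem_of_mem_getLast? hq
    rcases h P ⟨hcG, ⟨p, hp, (hall p hpP).2 hp'⟩, ⟨q, hq, fun h' => hq' ((hall q hqP).1 h')⟩⟩ with
      h1 | ⟨h1, h2⟩
    · exact .inl (by omega)
    · refine .inr ⟨by omega, fun a b hab ha hb hd => ?_⟩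
      have haP : a ∈ P := hab.subset (by simp)
      have hbP : b ∈ P := hab.subset (by simp)
      have ha' := (hall a haP).2 ha
      have hb' : ¬ occ b := fun h' => hb ((hall b hbP).1 h')
      have hG : G' a b := by simpa using hc.infix hab
      exact h2 a b hab ha' hb' (hs.done a b hG ha' hb' ha hb hd)
  · push Not at hall
    obtain ⟨v, hv, hv'⟩ := hall
    -- a vertex of the path has changed its occupation, so that the potential has dropped
    have hlt : (P.map θ').sum < (P.map θ).sum :=
      List.sum_lt_sum _ _ (fun v _ => hs.mono v) ⟨v, hv, hs.strict v (by tauto)⟩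
    -- if the first vertex is newly occupied, prepend the vertex from which its token came
    obtain ⟨P₁, c₁, ⟨p₁, hp₁, op₁⟩, hl₁, hsum₁⟩ : ∃ P₁ : List V, P₁.IsChain G ∧
        (∃ p ∈ P₁.head?, occ p) ∧ q ∈ P₁.getLast? ∧ (P.map θ).sum ≤ (P₁.map θ).sum := by
      by_cases ho : occ p
      · exact ⟨P, hcG, ⟨p, hp, ho⟩, hq, le_rfl⟩
      · obtain ⟨u, hu, ou⟩ := hs.receive p ho hp'
        refine ⟨u :: P, ?_, ⟨u, by simp, ou⟩, ?_, by simp⟩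
        · rw [List.isChain_cons]
          exact ⟨fun y hy => by rw [Option.mem_def] at hp hy; rw [hp] at hy; cases hy; exact hu, hcG⟩
        · rw [List.getLast?_cons]
          rw [Option.mem_def] at hq ⊢
          rw [hq]; rfl
    -- if the last vertex is newly free, append the vertex to which its token went
    obtain ⟨P₂, hP₂, hsum₂⟩ : ∃ P₂, ActivePath G occ P₂ ∧ (P₁.map θ).sum ≤ (P₂.map θ).sum := by
      by_cases ho : occ q
      · obtain ⟨x, hx, ox⟩ := hs.pass q ho hq'
        refine ⟨P₁ ++ [x], ⟨?_, ⟨p₁, ?_, op₁⟩, ⟨x, by simp, ox⟩⟩, by simp⟩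
        · rw [List.isChain_append]
          refine ⟨c₁, by simp, fun a ha b hb => ?_⟩
          rw [Option.mem_def] at ha hl₁
          rw [hl₁] at ha; cases ha
          simp only [List.head?_cons, Option.mem_def, Option.some.injEq] at hb
          exact hb ▸ hx
        · rw [List.head?_append, Option.mem_def] at *
          rw [hp₁]; rfl
      · exact ⟨P₁, ⟨c₁, ⟨p₁, hp₁, op₁⟩, ⟨q, hl₁, ho⟩⟩, le_rfl⟩
    rcases h P₂ hP₂ with h1 | ⟨h1, _⟩ <;> exact .inl (by omega)

theorem ActivePath.exists_pair {P : List V} (h : ActivePath G occ P) :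
    ∃ p q, [p, q] <:+: P ∧ occ p ∧ ¬ occ q := by
  obtain ⟨-, ⟨p, hp, op⟩, ⟨q, hq, oq⟩⟩ := h
  induction P generalizing p with
  | nil => simp at hp
  | cons a P ih =>
    simp only [List.head?_cons, Option.mem_def, Option.some.injEq] at hp
    subst hp
    cases P with
    | nil =>
      simp only [List.getLast?_singleton, Option.mem_def, Option.some.injEq] at hq
      exact absurd op (hq ▸ oq)
    | cons b P =>
      by_cases ob : occ b
      · obtain ⟨c, d, hcd, h1, h2⟩ := ih b (by simp) ob (by simpa using hq)
        exact ⟨c, d, hcd.trans (List.suffix_cons a _).isInfix, h1, h2⟩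
      · exact ⟨a, b, ⟨[], P, by simp⟩, op, ob⟩

/-- If all moves have been handled, then the round is complete. -/
theorem Slack.next (h : Slack G occ θ done K r) (hd : ∀ p q, G p q → done p q) :
    Slack G occ θ (fun _ _ => False) K (r + 1) := by
  intro P hP
  rcases h P hP with h1 | ⟨_, h2⟩
  · exact .inr ⟨by omega, fun _ _ _ _ _ => id⟩
  · obtain ⟨p, q, hpq, op, oq⟩ := hP.exists_pair
    exact absurd (hd p q (by simpa using hP.chain.infix hpq)) (h2 p q hpq op oq)

/-- When the rounds exceed the initial potential, no token can move any more. -/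
theorem Slack.final (h : Slack G occ θ done K r) (hr : K < r) {p q : V} (hG : G p q) (hp : occ p) :
    occ q := by
  by_contra hq
  rcases h [p, q] ⟨by simpa using hG, ⟨p, by simp, hp⟩, ⟨q, by simp, hq⟩⟩ with h1 | ⟨h1, _⟩ <;> omega

/-- The initial potential of a path is bounded if the edges decrease a bounded rank: the path has at
most `H + 1` vertices then. -/
theorem Slack.init {ρ : V → ℕ} {H M : ℕ} (hρ : ∀ p q, G p q → ρ q < ρ p) (hH : ∀ p, ρ p ≤ H)
    (hM : ∀ p, θ p ≤ M) : Slack G occ θ (fun _ _ => False) ((H + 1) * M) 0 := by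
  have hlen : ∀ P : List V, P.IsChain G → ∀ p ∈ P.head?, P.length ≤ ρ p + 1 := by
    intro P
    induction P with
    | nil => simp
    | cons a P ih =>
      intro hc p hp
      simp only [List.head?_cons, Option.mem_def, Option.some.injEq] at hp
      subst hp
      rw [List.isChain_cons] at hc
      cases P with
      | nil => simp
      | cons b P =>
        have h1 := hρ _ _ (hc.1 b (by simp))
        have h2 := ih hc.2 b (by simp)
        simp only [List.length_cons] at h2 ⊢
        omega
  rintro P ⟨hc, ⟨p, hp, _⟩, _⟩
  have h1 := hlen P hc p hp
  have h2 := hH p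
  have h3 : (P.map θ).sum ≤ (P.map θ).length * M := by
    have := List.sum_le_card_nsmul (P.map θ) M fun x hx => by
      obtain ⟨v, _, rfl⟩ := List.mem_map.1 hx
      exact hM v
    simpa using this
  rw [List.length_map] at h3
  have h4 : P.length * M ≤ (H + 1) * M := Nat.mul_le_mul_right _ (by omega)
  exact .inr ⟨by omega, fun _ _ _ _ _ => id⟩

end TokenGame

namespace PRAM

theorem Expr.nat_lt_ne_zero {m : Mem} {i : ℕ} {x y : Expr} :
    (eLt x y).nat m i ≠ 0 ↔ x.nat m i < y.nat m i := by
  simp only [Expr.nat, Op.nat]; split_ifs with h <;> simp [h]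

theorem Expr.nat_eq_ne_zero {m : Mem} {i : ℕ} {x y : Expr} :
    (eEq x y).nat m i ≠ 0 ↔ x.nat m i = y.nat m i := by
  simp only [Expr.nat, Op.nat]; split_ifs with h <;> simp [h]

theorem Expr.nat_mul_ne_zero {m : Mem} {i : ℕ} {x y : Expr} :
    (eMul x y).nat m i ≠ 0 ↔ x.nat m i ≠ 0 ∧ y.nat m i ≠ 0 :=
  mul_ne_zero_iff

/-! ### Moving tokens along the edges of one class -/

/-- Every processor with nonzero register `28` looks up an in-neighbour of maximum degree of the
vertex in its register `11`, among the edges whose class is one more than the scalar `30`, and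
reverses the edge if the degrees differ by at least two. Register `15` tells whether this happens,
and register `12` holds the in-neighbour. -/
def moveAt : Prog :=
  .seq (set 43 (.load 6 (eAdd (eMul (eAdd (eMul (reg 11) (eAdd eH (.const 2))) (sca 30))
    (eMul (.const 2) eN)) (.const 1)))) <|
  .seq (set 12 (eMod (reg 43) eN)) <|
  .seq (set 14 (sca 30)) <|
  .seq (set 15 (eMul (eLt (.const 0) (reg 28))
    (eLt (eAdd (.load 5 (reg 11)) (.const 2)) (eDiv (reg 43) eN)))) flip

namespace Env

variable {E : Env}

/-- The arrays that `moveAt` may modify. -/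
def moveArrs : List ℕ :=
  [3, 4, 5, 6, 12, 13, 14, 15, 16, 17, 18, 19, 20, 21, 27, 31, 40, 41, 42, 43, 44, 45]

theorem Flipped.congr_left {F : ℕ → ℕ → Prop} {m₀ m m' : Mem} (h : E.Flipped F m m')
    (h3 : m 3 = m₀ 3) (h4 : m 4 = m₀ 4) (h5 : m 5 = m₀ 5) : E.Flipped F m₀ m' := by
  obtain ⟨a1, a2, a3, a4, a5, a6, a7, a8⟩ := h
  simp only [cls, out, deg, HasSurplus, Phantom, h3, h4, h5] at a2 a3 a4 a5 a6 a7 a8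
  constructor <;> simpa only [cls, out, deg, HasSurplus, Phantom]

/-- The effect of `moveAt`: the edges in `F` of class `j + 1` have been reversed. -/
structure Moved (E : Env) (j : ℕ) (F : ℕ → ℕ → Prop) (m m' : Mem) : Prop where
  flipped : E.Flipped F m m'
  frame : ∀ a, a ∉ moveArrs → m' a = m a
  gap : ∀ x v, F x v → v < E.n ∧ x < E.n ∧ E.cls m x v = j + 1 ∧ deg m v + 2 ≤ deg m x
  unique : ∀ x x' v, F x v → F x' v → x = x'
  request : ∀ x v, F x v → ∃ i < E.k, m 28 i ≠ 0 ∧ m 11 i = v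
  complete : ∀ i < E.k, m 28 i ≠ 0 → ∀ x < E.n, E.cls m x (m 11 i) = j + 1 →
    deg m (m 11 i) + 2 ≤ deg m x → ∃ x', F x' (m 11 i)
  success : ∀ i < E.k, m' 15 i ≠ 0 → F (m' 12 i) (m 11 i)
  failure : ∀ i < E.k, m' 15 i = 0 → m 28 i ≠ 0 → ∀ x, ¬ F x (m 11 i)

theorem runs_moveAt {m : Mem} {j : ℕ} (h : E.Inv m) (hj : j ≤ E.H) (h30 : m 30 0 = j)
    (hA : ∀ i < E.k, m 28 i ≠ 0 → m 11 i < E.n) :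
    E.Runs moveAt m (2600 * (E.H * E.levels)) fun m' => ∃ F, E.Moved j F m m' := by
  have hn := E.two_le_n
  have hL : 1 ≤ E.H * E.levels := Nat.mul_pos E.one_le_H E.one_le_levels
  have hQ := E.Q_ge
  have hQn := E.n_lt
  unfold moveAt
  refine Runs.then (D := 30) (D' := 2570 * (E.H * E.levels)) (by omega) (Runs.set h.ok rfl
    (by decide) (fun i hi => h.ok.lt_of_grade hi rfl) fun m₁ ok₁ f₁ v₁ => ?_)
  refine Runs.then (D := 20) (D' := 2550 * (E.H * E.levels)) (by omega) (Runs.set ok₁ rfl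
    (by decide) (fun i hi => ?_) fun m₂ ok₂ f₂ v₂ => ?_)
  · simp only [Expr.nat, Op.nat, ok₁.n]
    exact (Nat.mod_lt _ (by omega)).trans hQn
  refine Runs.then (D := 10) (D' := 2540 * (E.H * E.levels)) (by omega) (Runs.set ok₂ rfl
    (by decide) (fun i hi => ok₂.lt_of_grade hi rfl) fun m₃ ok₃ f₃ v₃ => ?_)
  refine Runs.then (D := 30) (D' := 2500 * (E.H * E.levels)) (by omega) (Runs.set ok₃ rfl
    (by decide) (fun i hi => ok₃.lt_of_grade hi rfl) fun m₄ ok₄ f₄ v₄ => ?_)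
  have g₄ : ∀ a, a ∉ [12, 14, 15, 43] → m₄ a = m a := fun a ha => by
    simp only [List.mem_cons, List.not_mem_nil, or_false, not_or] at ha
    rw [f₄ a ha.2.2.1, f₃ a ha.2.1, f₂ a ha.1, f₁ a ha.2.2.2]
  set ρ : ℕ → ℕ := fun v => E.tree m (E.tid v j) 1 with hρ
  have r43 : ∀ i < E.k, m₁ 43 i = ρ (m 11 i) := fun i hi => by
    rw [v₁ i hi]; simp only [Expr.nat, Op.nat, h.ok.n, h.ok.H, h30, hρ, tree, tid]
  have r12 : ∀ i < E.k, m₄ 12 i = ρ (m 11 i) % E.n := fun i hi => by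
    rw [f₄ 12 (by decide), f₃ 12 (by decide), v₂ i hi]
    simp only [Expr.nat, Op.nat, ok₁.n]
    rw [r43 i hi]
  have r14 : ∀ i < E.k, m₄ 14 i = j := fun i hi => by
    rw [f₄ 14 (by decide), v₃ i hi]
    simp only [Expr.nat]
    rw [f₂ 30 (by decide), f₁ 30 (by decide), h30]
  have r11 : m₄ 11 = m 11 := g₄ 11 (by decide)
  have r15 : ∀ i < E.k, m₄ 15 i ≠ 0 ↔ m 28 i ≠ 0 ∧ deg m (m 11 i) + 2 < ρ (m 11 i) / E.n := by
    intro i hi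
    rw [v₄ i hi, Expr.nat_mul_ne_zero, Expr.nat_lt_ne_zero, Expr.nat_lt_ne_zero]
    simp only [Expr.nat, Op.nat, ok₃.n]
    rw [f₃ 28 (by decide), f₂ 28 (by decide), f₁ 28 (by decide), f₃ 11 (by decide),
      f₂ 11 (by decide), f₁ 11 (by decide), f₃ 5 (by decide), f₂ 5 (by decide), f₁ 5 (by decide),
      f₃ 43 (by decide), f₂ 43 (by decide), r43 i hi, Nat.pos_iff_ne_zero]
  have c₄ : ∀ u v, E.cls m₄ u v = E.cls m u v := fun u v => by rw [cls, g₄ 3 (by decide)]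
  have d₄ : ∀ u, deg m₄ u = deg m u := fun u => by rw [deg, g₄ 5 (by decide)]
  have h₄ : E.Inv m₄ := by
    refine ⟨ok₄, ?_, ?_, ?_⟩
    · obtain ⟨a1, a2, a3, a4, a5, a6⟩ := h.wf
      constructor <;> simpa only [cls, out, deg, g₄ 3 (by decide), g₄ 4 (by decide),
        g₄ 5 (by decide)]
    · intro t z h1 h2
      simp only [tree, g₄ 6 (by decide)]; exact h.treeOk t z h1 h2
    · intro y hy c hc x hx
      have := h.good y hy c hc x hx
      rw [Good, leafVal_congr (g₄ 3 (by decide)) (g₄ 5 (by decide)), tree, g₄ 6 (by decide)]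
      exact this
  have spec : ∀ v < E.n, _ := fun v hv =>
    root_spec h.treeOk hj (fun x hx => h.good v hv j (by omega) x hx)
  have hact : ∀ i < E.k, m₄ 15 i ≠ 0 → m 11 i < E.n ∧
      E.cls m (ρ (m 11 i) % E.n) (m 11 i) = j + 1 ∧
      deg m (m 11 i) + 2 ≤ deg m (ρ (m 11 i) % E.n) := by
    intro i hi hg
    obtain ⟨h1, h2⟩ := (r15 i hi).1 hg
    have hv := hA i hi h1
    have h0 : ρ (m 11 i) ≠ 0 := fun h0 => by rw [h0, Nat.zero_div] at h2; omega
    obtain ⟨h3, h4⟩ := (spec _ hv).1 h0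
    have h5 : ρ (m 11 i) / E.n = deg m (ρ (m 11 i) % E.n) + 1 := h4
    exact ⟨hv, h3, by omega⟩
  refine (runs_flip h₄ hj (fun i hi hg => ?_) fun i hi i' hi' _ _ e => ?_).mono le_rfl
    fun m' h' => ⟨fun x v => E.LinkReq m₄ v x, ?_⟩
  · obtain ⟨h1, h2, h3⟩ := hact i hi hg
    rw [r14 i hi, r11, r12 i hi, c₄, d₄, d₄]
    exact ⟨rfl, h1, Nat.mod_lt _ (by omega), h2, h3⟩
  · rw [r12 i hi, r12 i' hi', ← r11, e]
  · obtain ⟨hf, fr⟩ := h'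
    have e15 : m' 15 = m₄ 15 := fr 15 (by decide)
    have e12 : m' 12 = m₄ 12 := fr 12 (by decide)
    refine ⟨hf.congr_left (g₄ 3 (by decide)) (g₄ 4 (by decide)) (g₄ 5 (by decide)),
      fun a ha => ?_, ?_, ?_, ?_, fun i hi hg x hx hc hd => ?_, fun i hi hg => ?_,
      fun i hi hg ha x hx => ?_⟩
    · rw [fr a fun h' => ha ((by decide : ∀ a ∈ flipArrs, a ∈ moveArrs) a h'),
        g₄ a fun h' => ha ((by decide : ∀ a ∈ [12, 14, 15, 43], a ∈ moveArrs) a h')]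
    · rintro x v ⟨i, hi, hg, rfl, rfl⟩
      obtain ⟨h1, h2, h3⟩ := hact i hi hg
      rw [r11, r12 i hi]
      exact ⟨h1, Nat.mod_lt _ (by omega), h2, h3⟩
    · rintro x x' v ⟨i, hi, _, rfl, rfl⟩ ⟨i', hi', _, e, rfl⟩
      rw [r12 i hi, r12 i' hi', ← r11, e]
    · rintro x v ⟨i, hi, hg, rfl, rfl⟩
      exact ⟨i, hi, ((r15 i hi).1 hg).1, by rw [r11]⟩
    · have h2 : deg m x + 1 ≤ ρ (m 11 i) / E.n := (spec _ (hA i hi hg)).2 x hx hc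
      exact ⟨m₄ 12 i, i, hi, (r15 i hi).2 ⟨hg, by omega⟩, by rw [r11], rfl⟩
    · rw [e15] at hg
      exact ⟨i, hi, hg, by rw [r11], by rw [e12]⟩
    · obtain ⟨i', hi', hg', e, rfl⟩ := hx
      obtain ⟨_, h2⟩ := (r15 i' hi').1 hg'
      rw [r11] at e
      rw [e] at h2
      exact (r15 i hi).2 ⟨ha, h2⟩ (by rw [← e15]; exact hg)

end Env

/-! ### The rebalancing loop -/

/-- The token game is played in rounds, and every round treats the classes of edges in decreasing
order. -/
def rebalance (pass : Prog) : Prog :=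
  .seq (setSca 46 (eAdd (eMul (eAdd eH (.const 1)) (eAdd (eMul (.const 2) eH) (.const 1)))
    (.const 1))) <|
  countdown 46 <| .seq (setSca 30 (eAdd eH (.const 1))) <| countdown 30 pass

/-- A token game that is played on the stored orientation: the edges along which tokens move, the
occupied vertices, the potential, and the class of the edge that is used by a move. -/
structure Game where
  edge : Mem → ℕ → ℕ → Prop
  occ : Mem → ℕ → Prop
  pot : Mem → ℕ → ℕ
  lvl : Mem → ℕ → ℕ → ℕ

namespace Game

/-- The moves along edges of classes above `j` have been handled in round `r + 1`. -/
def Slack (g : Game) (K r j : ℕ) (m : Mem) : Prop :=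
  TokenGame.Slack (g.edge m) (g.occ m) (g.pot m) (fun p q => j < g.lvl m p q) K r

/-- A step of the game that handles the moves along edges of class `j + 1`. -/
def Step (g : Game) (j : ℕ) (m m' : Mem) : Prop :=
  TokenGame.Step (g.edge m) (g.occ m) (g.pot m) (fun p q => j + 1 < g.lvl m p q)
    (g.edge m') (g.occ m') (g.pot m') (fun p q => j < g.lvl m' p q)

/-- The memories agree as far as the game is concerned. -/
def Agree (g : Game) (m m' : Mem) : Prop :=
  g.edge m' = g.edge m ∧ g.occ m' = g.occ m ∧ g.pot m' = g.pot m ∧ g.lvl m' = g.lvl m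

/-- In passing from `m` to `m'`, the game has progressed. -/
def Progress (g : Game) (m m' : Mem) : Prop :=
  (∀ p q, g.edge m' p q → g.edge m p q) ∧ ∀ v, g.pot m' v ≤ g.pot m v

theorem Progress.trans {g : Game} {m₁ m₂ m₃ : Mem} (h : g.Progress m₁ m₂) (h' : g.Progress m₂ m₃) :
    g.Progress m₁ m₃ :=
  ⟨fun p q e => h.1 p q (h'.1 p q e), fun v => (h'.2 v).trans (h.2 v)⟩

theorem Agree.progress {g : Game} {m m' : Mem} (h : g.Agree m m') : g.Progress m m' := by
  obtain ⟨h1, -, h2, -⟩ := h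
  exact ⟨fun p q e => h1 ▸ e, fun v => (congrFun h2 v).le⟩

theorem Agree.slack {g : Game} {m m' : Mem} (h : g.Agree m m') {K r j : ℕ}
    (hs : g.Slack K r j m) : g.Slack K r j m' := by
  obtain ⟨h1, h2, h3, h4⟩ := h
  rw [Slack] at hs ⊢
  rwa [h1, h2, h3, h4]

end Game

namespace Env

variable {E : Env}

/-- If the initial potential of every active path is at most `(H + 1) * (2 * H + 1)`, then no moves
are left after `rebalance`. The predicate `St` is an invariant of the game. -/
theorem runs_rebalance {pass : Prog} {D : ℕ} (g : Game) {St : Mem → Prop}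
    (hok : ∀ m, St m → E.Ok m)
    (hagree : ∀ m m', St m → E.Ok m' → (∀ a, a ≠ 30 → a ≠ 46 → m' a = m a) →
      St m' ∧ g.Agree m m')
    (hlvl : ∀ m p q, St m → g.edge m p q → 1 ≤ g.lvl m p q ∧ g.lvl m p q ≤ E.H + 1)
    (hpass : ∀ m j, St m → j ≤ E.H → m 30 0 = j →
      E.Runs pass m D fun m' => St m' ∧ m' 30 = m 30 ∧ m' 46 = m 46 ∧ g.Step j m m')
    {m : Mem} (hm : St m)
    (hinit : TokenGame.Slack (g.edge m) (g.occ m) (g.pot m) (fun _ _ => False)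
      ((E.H + 1) * (2 * E.H + 1)) 0) :
    E.Runs (rebalance pass) m
      (((E.H + 1) * (2 * E.H + 1) + 1) * ((E.H + 1) * (D + 10) + 30) + 30)
      fun m' => St m' ∧ g.Progress m m' ∧ ∀ p q, g.edge m' p q → g.occ m' p → g.occ m' q := by
  set K := (E.H + 1) * (2 * E.H + 1) with hK
  unfold rebalance
  refine Runs.then (D := 20) (D' := (K + 1) * ((E.H + 1) * (D + 10) + 30) + 2) (by omega)
    (Runs.setSca (hok m hm) rfl (by decide) ?_ fun m₁ ok₁ f₁ v₁ => ?_)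
  · exact (hok m hm).lt_of_grade (by have := E.one_le_k; omega) rfl
  simp only [Expr.nat, Op.nat, (hok m hm).H] at v₁
  rw [← hK] at v₁
  obtain ⟨s₁, a₁⟩ := hagree m m₁ hm ok₁ fun a _ ha => f₁ a ha
  refine (Runs.countdown (r := 46) (D := (E.H + 1) * (D + 10) + 20) (by decide)
    (I := fun q m' => ∃ r, q + r = K + 1 ∧ St m' ∧ m' 46 0 = q ∧ g.Progress m m' ∧
      TokenGame.Slack (g.edge m') (g.occ m') (g.pot m') (fun _ _ => False) K r)
    (fun q m' h => hok m' ?_) (fun q m' h => ?_) (fun q m₂ m₃ h ok₃ f₃ v₃ => ?_) (K + 1) m₁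
    ⟨0, rfl, s₁, v₁, a₁.progress, ?_⟩).mono le_rfl fun m' h => ?_
  · obtain ⟨r, -, h, -⟩ := h; exact h
  · obtain ⟨r, -, -, h, -⟩ := h; exact h
  · obtain ⟨r, hr, s₂, -, p₂, sl₂⟩ := h
    obtain ⟨s₃, a₃⟩ := hagree m₂ m₃ s₂ ok₃ fun a _ ha => f₃ a ha
    refine Runs.then (D := 8) (D' := (E.H + 1) * (D + 10) + 2) (by omega)
      (Runs.setSca ok₃ rfl (by decide) ?_ fun m₄ ok₄ f₄ v₄ => ?_)
    · simp only [Expr.nat, Op.nat, ok₃.H]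
      have h1 := E.two_le_n
      exact (show E.H + 1 < E.Q by unfold Q; omega).trans_le (Nat.le_self_pow (by decide) _)
    simp only [Expr.nat, Op.nat, ok₃.H] at v₄
    obtain ⟨s₄, a₄⟩ := hagree m₃ m₄ s₃ ok₄ fun a ha _ => f₄ a ha
    refine (Runs.countdown (r := 30) (D := D) (by decide)
      (I := fun j m' => j ≤ E.H + 1 ∧ St m' ∧ m' 30 0 = j ∧ m' 46 0 = q ∧ g.Progress m m' ∧
        g.Slack K r j m')
      (fun j m' h => hok m' h.2.1) (fun j m' h => h.2.2.1) (fun j m₅ m₆ h ok₆ f₆ v₆ => ?_)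
      (E.H + 1) m₄ ⟨le_rfl, s₄, v₄, by rw [f₄ 46 (by decide), v₃],
        (p₂.trans a₃.progress).trans a₄.progress, ?_⟩).mono le_rfl fun m' h => ?_
    · obtain ⟨hj, s₅, -, h46, p₅, sl₅⟩ := h
      obtain ⟨s₆, a₆⟩ := hagree m₅ m₆ s₅ ok₆ fun a ha _ => f₆ a ha
      refine (hpass m₆ j s₆ (by omega) v₆).mono le_rfl fun m₇ h => ?_
      obtain ⟨s₇, e30, e46, st⟩ := h
      exact ⟨by omega, s₇, by rw [e30, v₆], by rw [e46, f₆ 46 (by decide), h46],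
        (p₅.trans a₆.progress).trans ⟨st.sub, st.mono⟩, TokenGame.Slack.step (a₆.slack sl₅) st⟩
    · refine a₄.slack (a₃.slack ?_)
      intro P hP
      refine (sl₂ P hP).imp_right fun h => ⟨h.1, fun p q hpq hp hq hd => ?_⟩
      have := (hlvl m₂ p q s₂ (by simpa using hP.chain.infix hpq)).2
      omega
    · obtain ⟨-, s', -, h46, p', sl'⟩ := h
      exact ⟨r + 1, by omega, s', h46, p', sl'.next fun p q hpq => (hlvl m' p q s' hpq).1⟩
  · obtain ⟨h1, h2, h3, -⟩ := a₁
    rwa [h1, h2, h3]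
  · obtain ⟨r, hr, s', -, p', sl'⟩ := h
    exact ⟨s', p', fun p q hpq hp => sl'.final (by omega) hpq hp⟩

end Env

/-! ### The two games -/

namespace Env

variable (E : Env)

/-- In passing from `m` to `m'`, only edges have been reversed, and only working arrays have been
modified. -/
structure Same (m m' : Mem) : Prop where
  frame : ∀ a, a ∉ [10, 11, 28, 29, 30, 46] → a ∉ moveArrs → m' a = m a
  edge : ∀ u < E.n, ∀ v < E.n, (E.cls m' u v ≠ 0 ∨ E.cls m' v u ≠ 0 ↔
    E.cls m u v ≠ 0 ∨ E.cls m v u ≠ 0)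
  phantom : ∀ u < E.n, ∀ s < E.H, (E.Phantom m' u s ↔ E.Phantom m u s)

variable {E}

theorem Same.trans {m₁ m₂ m₃ : Mem} (h : E.Same m₁ m₂) (h' : E.Same m₂ m₃) : E.Same m₁ m₃ where
  frame a h1 h2 := (h'.frame a h1 h2).trans (h.frame a h1 h2)
  edge u hu v hv := (h'.edge u hu v hv).trans (h.edge u hu v hv)
  phantom u hu s hs := (h'.phantom u hu s hs).trans (h.phantom u hu s hs)

/-- The working arrays of a pass outside of `moveAt`. -/
theorem Same.of_frame {m m' : Mem} (h : ∀ a, a ∉ [10, 11, 28, 29, 30, 46] → m' a = m a) :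
    E.Same m m' where
  frame a h1 _ := h a h1
  edge u _ v _ := by simp only [cls, h 3 (by decide)]
  phantom u _ s _ := by simp only [Phantom, cls, out, h 3 (by decide), h 4 (by decide)]

theorem Moved.same {j : ℕ} {F : ℕ → ℕ → Prop} {m m' : Mem} (h : E.Moved j F m m') :
    E.Same m m' where
  frame a _ h2 := h.frame a h2
  edge u hu v hv := by
    have h1 : ∀ x v, F x v → E.cls m x v ≠ 0 := fun x v hF => by
      rw [(h.gap x v hF).2.2.1]; omega
    have h2 := h1 u v
    have h3 := h1 v u
    have h4 := h.flipped.edge u hu v hv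
    have h5 := h.flipped.edge v hv u hu
    tauto
  phantom u hu s hs := h.flipped.phantom u hu s hs

theorem Inv.of_frame {m m' : Mem} (h : E.Inv m) (ok : E.Ok m') (h3 : m' 3 = m 3) (h4 : m' 4 = m 4)
    (h5 : m' 5 = m 5) (h6 : m' 6 = m 6) : E.Inv m' := by
  refine ⟨ok, ?_, ?_, ?_⟩
  · obtain ⟨a1, a2, a3, a4, a5, a6⟩ := h.wf
    constructor <;> simpa only [cls, out, deg, h3, h4, h5]
  · intro t z h1 h2
    simp only [tree, h6]; exact h.treeOk t z h1 h2
  · intro y hy c hc x hx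
    have := h.good y hy c hc x hx
    rw [Good, leafVal_congr h3 h5, tree, h6]
    exact this

open Classical in
theorem Wf.card_out_le {m : Mem} (h : E.Wf m) {u : ℕ} (hu : u < E.n) (hs : ¬ E.HasSurplus m u) :
    ((Finset.range E.n).filter fun v => E.cls m u v ≠ 0).card ≤ deg m u := by
  have hc : ∀ v < E.n, E.cls m u v ≠ 0 → E.cls m u v - 1 < E.H ∧
      E.cls m u v = (E.cls m u v - 1) + 1 := fun v hv h0 => by
    have h1 := h.cls_le u hu v hv
    have h2 : E.cls m u v ≠ E.H + 1 := fun h2 => hs ⟨v, hv, h2⟩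
    omega
  rw [h.deg_eq u hu]
  refine Finset.card_le_card_of_injOn (fun v => E.cls m u v - 1) (fun v hv => ?_)
    fun v hv v' hv' e => ?_
  · rw [Finset.mem_coe, Finset.mem_filter, Finset.mem_range] at hv
    obtain ⟨h1, h2⟩ := hc v hv.1 hv.2
    rw [Finset.mem_coe, Finset.mem_filter, Finset.mem_range]
    exact ⟨h1, by rw [h.slot u hu v hv.1 _ h1 h2]; omega⟩
  · rw [Finset.mem_coe, Finset.mem_filter, Finset.mem_range] at hv hv'
    obtain ⟨h1, h2⟩ := hc v hv.1 hv.2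
    obtain ⟨_, h2'⟩ := hc v' hv'.1 hv'.2
    exact h.head_unique hu hv.1 hv'.1 h1 h2 (by simp only at e; omega)

end Env

open Classical in
/-- The game after a deletion: the tokens are the vertices whose degree has dropped below the former
degree `b`, and they move against the direction of the edges. A vertex `v` with `b v < H` gains a
token by reversing an edge that leaves `v`, which costs two units of potential for the edge and
returns one for the token; when the token moves on, this one is lost. A vertex with `b v = H` never
loses its token, as there is no in-neighbour with a larger value of `b`. -/
noncomputable def lowGame (E : Env) (b : ℕ → ℕ) : Game where
  edge m v x := v < E.n ∧ x < E.n ∧ E.cls m x v ≠ 0 ∧ b x = b v + 1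
  occ m v := v < E.n ∧ Env.deg m v < b v
  pot m v := if b v < E.H then 2 * ((Finset.range E.n).filter fun u =>
      u < E.n ∧ v < E.n ∧ E.cls m v u ≠ 0 ∧ b v = b u + 1).card +
      (if v < E.n ∧ Env.deg m v < b v then 1 else 0)
    else if v < E.n ∧ Env.deg m v < b v then 0 else 1
  lvl m v x := E.cls m x v

open Classical in
/-- The game after an insertion: the tokens are the vertices whose degree exceeds the former degree
`b`, and they move along the edges. A vertex `u` with `b u < H` loses its token by reversing an edge
that leaves `u`, which costs two units of potential for the edge and returns one for being free;
when `u` receives the next token, this one is lost. A vertex with `b u = H` never holds a token, as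
degrees are truncated at `H`. -/
noncomputable def highGame (E : Env) (b : ℕ → ℕ) : Game where
  edge m u c := u < E.n ∧ c < E.n ∧ E.cls m u c ≠ 0 ∧ b u = b c + 1
  occ m u := u < E.n ∧ b u < Env.deg m u
  pot m u := if b u < E.H then 2 * ((Finset.range E.n).filter fun c =>
      u < E.n ∧ c < E.n ∧ E.cls m u c ≠ 0 ∧ b u = b c + 1).card +
      (if u < E.n ∧ b u < Env.deg m u then 0 else 1)
    else 0
  lvl m u c := E.cls m u c

/-- The vertex in register `10` of every processor is the position of a token. The token moves to an
in-neighbour. -/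
def passLow : Prog :=
  .seq (set 11 (reg 10)) <| .seq (set 28 (.const 1)) <| .seq moveAt <| setIf (reg 15) 10 (reg 12)

/-- The vertex in register `10` of every processor is the position of a token. The token moves to
the out-neighbour in the slot given by the scalar `30`. -/
def passHigh : Prog :=
  .seq (set 29 (.load 4 (eAdd (eMul (reg 10) eH) (sca 30)))) <|
  .seq (set 11 (eSub (reg 29) (.const 1))) <|
  .seq (set 28 (eMul (eLt (sca 30) eH) (eLt (.const 0) (reg 29)))) <| .seq moveAt <|
  setIf (eMul (reg 15) (eEq (reg 12) (reg 10))) 10 (reg 11)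

namespace Env

variable {E : Env}

/-- The invariant of the game after a deletion. -/
structure Low (E : Env) (b : ℕ → ℕ) (m : Mem) : Prop where
  inv : E.Inv m
  base_le : ∀ u < E.n, b u ≤ E.H
  le : ∀ u < E.n, deg m u ≤ b u
  ge : ∀ u < E.n, b u ≤ deg m u + 1
  edge : ∀ u < E.n, ∀ v < E.n, E.cls m u v ≠ 0 → b u ≤ b v + 1
  loc : ∀ i < E.k, m 10 i < E.n
  cover : ∀ u < E.n, deg m u < b u → ∃ i < E.k, m 10 i = u

/-- The invariant of the game after an insertion. -/
structure High (E : Env) (b : ℕ → ℕ) (m : Mem) : Prop where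
  inv : E.Inv m
  base_le : ∀ u < E.n, b u ≤ E.H
  ge : ∀ u < E.n, b u ≤ deg m u
  le : ∀ u < E.n, deg m u ≤ b u + 1
  edge : ∀ u < E.n, ∀ v < E.n, E.cls m u v ≠ 0 → b u ≤ b v + 1
  surplus : ∀ u < E.n, E.HasSurplus m u → b u = E.H
  loc : ∀ i < E.k, m 10 i < E.n
  cover : ∀ u < E.n, b u < deg m u → ∃ i < E.k, m 10 i = u

theorem Low.gap {b : ℕ → ℕ} {m m' : Mem} {j : ℕ} {F : ℕ → ℕ → Prop} (h : E.Low b m)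
    (hm : E.Moved j F m m') {x v : ℕ} (hF : F x v) :
    deg m x = b x ∧ deg m v + 1 = b v ∧ b x = b v + 1 := by
  obtain ⟨hv, hx, hc, hg⟩ := hm.gap x v hF
  have := h.edge x hx v hv (by omega)
  have := h.le x hx
  have := h.ge v hv
  omega

theorem High.gap {b : ℕ → ℕ} {m m' : Mem} {j : ℕ} {F : ℕ → ℕ → Prop} (h : E.High b m)
    (hm : E.Moved j F m m') {x v : ℕ} (hF : F x v) :
    deg m x = b x + 1 ∧ deg m v = b v ∧ b x = b v + 1 ∧ ¬ E.HasSurplus m x := by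
  obtain ⟨hv, hx, hc, hg⟩ := hm.gap x v hF
  have := h.edge x hx v hv (by omega)
  have := h.le x hx
  have := h.ge v hv
  have := h.inv.wf.deg_le hx
  have h1 := h.surplus x hx
  refine ⟨by omega, by omega, by omega, fun hs => ?_⟩
  have := h1 hs
  omega

/-- The degrees after a pass of the game following a deletion. -/
theorem Low.deg_moved {b : ℕ → ℕ} {m m' : Mem} {j : ℕ} {F : ℕ → ℕ → Prop} (h : E.Low b m)
    (hm : E.Moved j F m m') :
    (∀ x v, F x v → deg m' v = b v) ∧ (∀ x v, F x v → deg m' x ≤ b x ∧ b x ≤ deg m' x + 1) ∧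
    ∀ u < E.n, (∀ w, ¬ F u w) → (∀ w, ¬ F w u) → deg m' u = deg m u := by
  refine ⟨fun x v hF => ?_, fun x v hF => ?_, hm.flipped.deg_old⟩
  · have h1 := h.gap hm hF
    rw [hm.flipped.deg_head v (hm.gap x v hF).1 x hF fun w hw => by have := h.gap hm hw; omega]
    omega
  · have h1 := h.gap hm hF
    obtain ⟨h2, h3⟩ := hm.flipped.deg_tail x (hm.gap x v hF).2.1 v hF
      fun w hw => by have := h.gap hm hw; omega
    by_cases hs : E.HasSurplus m x
    · have := h2 hs; omega
    · have := h3 hs; omega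

/-- The degrees after a pass of the game following an insertion. -/
theorem High.deg_moved {b : ℕ → ℕ} {m m' : Mem} {j : ℕ} {F : ℕ → ℕ → Prop} (h : E.High b m)
    (hm : E.Moved j F m m') :
    (∀ x v, F x v → deg m' v = b v + 1) ∧ (∀ x v, F x v → deg m' x = b x) ∧
    ∀ u < E.n, (∀ w, ¬ F u w) → (∀ w, ¬ F w u) → deg m' u = deg m u := by
  refine ⟨fun x v hF => ?_, fun x v hF => ?_, hm.flipped.deg_old⟩
  · have h1 := h.gap hm hF
    rw [hm.flipped.deg_head v (hm.gap x v hF).1 x hF fun w hw => by have := h.gap hm hw; omega]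
    omega
  · have h1 := h.gap hm hF
    rw [(hm.flipped.deg_tail x (hm.gap x v hF).2.1 v hF
      fun w hw => by have := h.gap hm hw; omega).2 h1.2.2.2]
    omega

theorem Low.step {b : ℕ → ℕ} {m m' : Mem} {j : ℕ} {F : ℕ → ℕ → Prop} (h : E.Low b m)
    (hm : E.Moved j F m m')
    (hact : ∀ v < E.n, deg m v < b v → ∃ i < E.k, m 28 i ≠ 0 ∧ m 11 i = v) :
    (lowGame E b).Step j m m' := by
  obtain ⟨d₁, d₂, d₃⟩ := h.deg_moved hm
  have sub : ∀ p q, (lowGame E b).edge m' p q → (lowGame E b).edge m p q := by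
    rintro p q ⟨hp, hq, hc, hb⟩
    rcases (hm.flipped.edge q hq p hp).1 hc with h1 | h1
    · exact ⟨hp, hq, h1.1, hb⟩
    · have := h.gap hm h1; omega
  have card_le : ∀ v, ((Finset.range E.n).filter fun u =>
      u < E.n ∧ v < E.n ∧ E.cls m' v u ≠ 0 ∧ b v = b u + 1) ⊆ (Finset.range E.n).filter fun u =>
      u < E.n ∧ v < E.n ∧ E.cls m v u ≠ 0 ∧ b v = b u + 1 := fun v u hu => by
    rw [Finset.mem_filter] at hu ⊢
    exact ⟨hu.1, sub u v hu.2⟩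
  have lose : ∀ v, (lowGame E b).occ m v → ¬ (lowGame E b).occ m' v → ∃ w, F w v := by
    rintro v ⟨hv, h1⟩ h2
    have h2' : ¬ deg m' v < b v := fun h3 => h2 ⟨hv, h3⟩
    by_contra! hno
    by_cases ht : ∃ w, F v w
    · obtain ⟨w, hw⟩ := ht
      have := h.gap hm hw; omega
    · have := d₃ v hv (fun w hw => ht ⟨w, hw⟩) hno
      omega
  have gain : ∀ v, ¬ (lowGame E b).occ m v → (lowGame E b).occ m' v → ∃ w, F v w := by
    rintro v h1 ⟨hv, h2⟩
    have h1' : ¬ deg m v < b v := fun h3 => h1 ⟨hv, h3⟩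
    by_contra! hno
    by_cases ht : ∃ w, F w v
    · obtain ⟨w, hw⟩ := ht
      have := h.gap hm hw; omega
    · have := d₃ v hv hno (fun w hw => ht ⟨w, hw⟩)
      omega
  have strict : ∀ v, ¬ ((lowGame E b).occ m v ↔ (lowGame E b).occ m' v) →
      (lowGame E b).pot m' v < (lowGame E b).pot m v := by
    intro v htog
    by_cases h1 : (lowGame E b).occ m v
    · have h2 : ¬ (lowGame E b).occ m' v := by tauto
      obtain ⟨w, hw⟩ := lose v h1 h2
      have h3 := h.gap hm hw
      have h4 := h.base_le w (hm.gap _ _ hw).2.1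
      have h5 := Finset.card_le_card (card_le v)
      have hb : b v < E.H := by omega
      simp only [lowGame] at h1 h2 ⊢
      simp only [if_pos hb, if_neg h2, if_pos h1]
      omega
    · have h2 : (lowGame E b).occ m' v := by tauto
      obtain ⟨w, hw⟩ := gain v h1 h2
      have h3 := h.gap hm hw
      obtain ⟨hw', hv, hc, _⟩ := hm.gap _ _ hw
      have h5 : _ < _ := Finset.card_lt_card ((Finset.ssubset_iff_of_subset (card_le v)).2 ⟨w, by
        rw [Finset.mem_filter, Finset.mem_range]
        exact ⟨hw', hw', hv, by omega, h3.2.2⟩, fun h6 => by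
        rw [Finset.mem_filter] at h6
        rcases (hm.flipped.edge v hv w hw').1 h6.2.2.2.1 with h7 | h7
        · exact h7.2 hw
        · have := h.gap hm h7; omega⟩)
      simp only [lowGame] at h1 h2 ⊢
      rw [if_pos h2, if_neg h1]
      split_ifs <;> omega
  refine ⟨sub, fun v h1 h2 => ?_, fun v h1 h2 => ?_, fun v => ?_, strict, ?_⟩
  · obtain ⟨w, hw⟩ := lose v h1 h2
    obtain ⟨hv, hw', hc, _⟩ := hm.gap _ _ hw
    have h3 := h.gap hm hw
    refine ⟨w, ⟨hv, hw', by omega, h3.2.2⟩, fun h4 => ?_⟩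
    have := h4.2
    omega
  · obtain ⟨w, hw⟩ := gain v h1 h2
    obtain ⟨hw', hv, hc, _⟩ := hm.gap _ _ hw
    have h3 := h.gap hm hw
    exact ⟨w, ⟨hw', hv, by omega, h3.2.2⟩, hw', by omega⟩
  · by_cases htog : (lowGame E b).occ m v ↔ (lowGame E b).occ m' v
    · have h5 := Finset.card_le_card (card_le v)
      simp only [lowGame] at htog ⊢
      simp only [htog]
      split_ifs <;> omega
    · exact (strict v htog).le
  · rintro p q ⟨hp, hq, hc, hb⟩ ⟨_, op⟩ oq op' _ hd
    simp only [lowGame] at hd ⊢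
    have oq' : ¬ deg m q < b q := fun h1 => oq ⟨hq, h1⟩
    have h1 := h.le q hq
    have nF : ∀ x, ¬ F x p := fun x hx => by
      have := d₁ x p hx
      have := op'.2
      omega
    have hcl := (sub p q ⟨hp, hq, hc, hb⟩).2.2.1
    have hle := h.inv.wf.cls_le q hq p hp
    -- an edge `q → p` of class `j + 1` between a token and a free vertex would have been offered
    -- to `p`, which would then have lost its token
    by_contra hlt
    have hj : E.cls m q p = j + 1 := by
      by_cases hs : E.cls m q p = E.H + 1
      · have := hm.flipped.inv.wf.cls_le q hq p hp
        omega
      · have := hm.flipped.core q hq p hp (E.cls m q p - 1) (by omega) (by omega) (nF q)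
        omega
    obtain ⟨i, hi, hg, rfl⟩ := hact p hp op
    obtain ⟨x, hx⟩ := hm.complete i hi hg q hq hj (by omega)
    exact nF x hx

theorem High.step {b : ℕ → ℕ} {m m' : Mem} {j : ℕ} {F : ℕ → ℕ → Prop} (h : E.High b m)
    (hm : E.Moved j F m m')
    (hact : ∀ u < E.n, b u < deg m u → ∀ v < E.n, E.cls m u v = j + 1 →
      ∃ i < E.k, m 28 i ≠ 0 ∧ m 11 i = v) :
    (highGame E b).Step j m m' := by
  obtain ⟨d₁, d₂, d₃⟩ := h.deg_moved hm
  have sub : ∀ p q, (highGame E b).edge m' p q → (highGame E b).edge m p q := by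
    rintro p q ⟨hp, hq, hc, hb⟩
    rcases (hm.flipped.edge p hp q hq).1 hc with h1 | h1
    · exact ⟨hp, hq, h1.1, hb⟩
    · have := h.gap hm h1; omega
  have card_le : ∀ u, ((Finset.range E.n).filter fun c =>
      u < E.n ∧ c < E.n ∧ E.cls m' u c ≠ 0 ∧ b u = b c + 1) ⊆ (Finset.range E.n).filter fun c =>
      u < E.n ∧ c < E.n ∧ E.cls m u c ≠ 0 ∧ b u = b c + 1 := fun u c hc => by
    rw [Finset.mem_filter] at hc ⊢
    exact ⟨hc.1, sub u c hc.2⟩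
  have lose : ∀ v, (highGame E b).occ m v → ¬ (highGame E b).occ m' v → ∃ w, F v w := by
    rintro v ⟨hv, h1⟩ h2
    have h2' : ¬ b v < deg m' v := fun h3 => h2 ⟨hv, h3⟩
    by_contra! hno
    by_cases ht : ∃ w, F w v
    · obtain ⟨w, hw⟩ := ht
      have := h.gap hm hw; omega
    · have := d₃ v hv hno (fun w hw => ht ⟨w, hw⟩)
      omega
  have gain : ∀ v, ¬ (highGame E b).occ m v → (highGame E b).occ m' v → ∃ w, F w v := by
    rintro v h1 ⟨hv, h2⟩
    have h1' : ¬ b v < deg m v := fun h3 => h1 ⟨hv, h3⟩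
    by_contra! hno
    by_cases ht : ∃ w, F v w
    · obtain ⟨w, hw⟩ := ht
      have := h.gap hm hw; omega
    · have := d₃ v hv (fun w hw => ht ⟨w, hw⟩) hno
      omega
  have strict : ∀ v, ¬ ((highGame E b).occ m v ↔ (highGame E b).occ m' v) →
      (highGame E b).pot m' v < (highGame E b).pot m v := by
    intro v htog
    by_cases h1 : (highGame E b).occ m v
    · have h2 : ¬ (highGame E b).occ m' v := by tauto
      obtain ⟨w, hw⟩ := lose v h1 h2
      have h3 := h.gap hm hw
      obtain ⟨hw', hv, hc, _⟩ := hm.gap _ _ hw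
      have h4 := h.inv.wf.deg_le hv
      have h5 : _ < _ := Finset.card_lt_card ((Finset.ssubset_iff_of_subset (card_le v)).2 ⟨w, by
        rw [Finset.mem_filter, Finset.mem_range]
        exact ⟨hw', hv, hw', by omega, h3.2.2.1⟩, fun h6 => by
        rw [Finset.mem_filter] at h6
        rcases (hm.flipped.edge v hv w hw').1 h6.2.2.2.1 with h7 | h7
        · exact h7.2 hw
        · have := h.gap hm h7; omega⟩)
      have hb : b v < E.H := by omega
      simp only [highGame] at h1 h2 ⊢
      simp only [if_pos hb, if_neg h2, if_pos h1]
      omega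
    · have h2 : (highGame E b).occ m' v := by tauto
      obtain ⟨w, hw⟩ := gain v h1 h2
      have h3 := h.gap hm hw
      have h4 := h.base_le w (hm.gap _ _ hw).2.1
      have h5 := Finset.card_le_card (card_le v)
      have hb : b v < E.H := by omega
      simp only [highGame] at h1 h2 ⊢
      simp only [if_pos hb, if_pos h2, if_neg h1]
      omega
  refine ⟨sub, fun v h1 h2 => ?_, fun v h1 h2 => ?_, fun v => ?_, strict, ?_⟩
  · obtain ⟨w, hw⟩ := lose v h1 h2
    obtain ⟨hw', hv, hc, _⟩ := hm.gap _ _ hw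
    have h3 := h.gap hm hw
    refine ⟨w, ⟨hv, hw', by omega, h3.2.2.1⟩, fun h4 => ?_⟩
    have := h4.2
    omega
  · obtain ⟨w, hw⟩ := gain v h1 h2
    obtain ⟨hv, hw', hc, _⟩ := hm.gap _ _ hw
    have h3 := h.gap hm hw
    exact ⟨w, ⟨hw', hv, by omega, h3.2.2.1⟩, hw', by omega⟩
  · by_cases htog : (highGame E b).occ m v ↔ (highGame E b).occ m' v
    · have h5 := Finset.card_le_card (card_le v)
      simp only [highGame] at htog ⊢
      simp only [htog]
      split_ifs <;> omega
    · exact (strict v htog).le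
  · rintro p q ⟨hp, hq, hc, hb⟩ ⟨_, op⟩ oq op' oq' hd
    simp only [highGame] at hd ⊢
    have oq₁ : ¬ b q < deg m q := fun h1 => oq ⟨hq, h1⟩
    have oq₂ : ¬ b q < deg m' q := fun h1 => oq' ⟨hq, h1⟩
    have h1 := h.le p hp
    have nF : ∀ x, ¬ F x q := fun x hx => by
      have := d₁ x q hx
      omega
    have hcl := (sub p q ⟨hp, hq, hc, hb⟩).2.2.1
    have hle := h.inv.wf.cls_le p hp q hq
    -- an edge `p → q` of class `j + 1` between a token and a free vertex would have been offered
    -- to `q`, which would then have received a token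
    by_contra hlt
    have hj : E.cls m p q = j + 1 := by
      by_cases hs : E.cls m p q = E.H + 1
      · have := hm.flipped.inv.wf.cls_le p hp q hq
        omega
      · have := hm.flipped.core p hp q hq (E.cls m p q - 1) (by omega) (by omega) (nF p)
        omega
    obtain ⟨i, hi, hg, rfl⟩ := hact p hp op q hq hj
    obtain ⟨x, hx⟩ := hm.complete i hi hg p hp hj (by omega)
    exact nF x hx

end Env

/-! ### Playing the games -/

theorem Game.Agree.step {g : Game} {m₁ m₂ m₃ m₄ : Mem} {j : ℕ} (h : g.Agree m₁ m₂)
    (h' : g.Agree m₃ m₄) (hs : g.Step j m₂ m₃) : g.Step j m₁ m₄ := by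
  obtain ⟨a1, a2, a3, a4⟩ := h
  obtain ⟨b1, b2, b3, b4⟩ := h'
  rw [Step] at hs ⊢
  rwa [← a1, ← a2, ← a3, ← a4, b1, b2, b3, b4]

theorem lowGame_agree {E : Env} {b : ℕ → ℕ} {m m' : Mem} (h3 : m' 3 = m 3) (h5 : m' 5 = m 5) :
    (lowGame E b).Agree m m' := by
  simp only [Game.Agree, lowGame, Env.cls, Env.deg, h3, h5, and_self]

theorem highGame_agree {E : Env} {b : ℕ → ℕ} {m m' : Mem} (h3 : m' 3 = m 3) (h5 : m' 5 = m 5) :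
    (highGame E b).Agree m m' := by
  simp only [Game.Agree, highGame, Env.cls, Env.deg, h3, h5, and_self]

namespace Env

variable {E : Env} {b : ℕ → ℕ}

theorem Low.of_frame {m m' : Mem} (h : E.Low b m) (ok : E.Ok m') (h3 : m' 3 = m 3)
    (h4 : m' 4 = m 4) (h5 : m' 5 = m 5) (h6 : m' 6 = m 6) (h10 : m' 10 = m 10) : E.Low b m' := by
  obtain ⟨a1, a2, a3, a4, a5, a6, a7⟩ := h
  refine ⟨a1.of_frame ok h3 h4 h5 h6, ?_, ?_, ?_, ?_, ?_, ?_⟩ <;> simpa only [cls, deg, h3, h5, h10]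

theorem High.of_frame {m m' : Mem} (h : E.High b m) (ok : E.Ok m') (h3 : m' 3 = m 3)
    (h4 : m' 4 = m 4) (h5 : m' 5 = m 5) (h6 : m' 6 = m 6) (h10 : m' 10 = m 10) : E.High b m' := by
  obtain ⟨a1, a2, a3, a4, a5, a6, a7, a8⟩ := h
  refine ⟨a1.of_frame ok h3 h4 h5 h6, ?_, ?_, ?_, ?_, ?_, ?_, ?_⟩ <;>
    simpa only [HasSurplus, cls, deg, h3, h5, h10]

theorem runs_passLow {m : Mem} {j : ℕ} (h : E.Low b m) (hj : j ≤ E.H) (h30 : m 30 0 = j) :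
    E.Runs passLow m (2700 * (E.H * E.levels)) fun m' => E.Low b m' ∧ E.Same m m' ∧
      m' 30 = m 30 ∧ m' 46 = m 46 ∧ (lowGame E b).Step j m m' := by
  have hL : 1 ≤ E.H * E.levels := Nat.mul_pos E.one_le_H E.one_le_levels
  have hQ := E.Q_ge
  unfold passLow
  refine Runs.then (D := 20) (D' := 2680 * (E.H * E.levels)) (by omega) (Runs.set h.inv.ok rfl
    (by decide) (fun i hi => h.inv.ok.lt_of_grade hi rfl) fun m₁ ok₁ f₁ v₁ => ?_)
  refine Runs.then (D := 20) (D' := 2660 * (E.H * E.levels)) (by omega) (Runs.set ok₁ rfl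
    (by decide) (fun i hi => ok₁.lt_of_grade hi rfl) fun m₂ ok₂ f₂ v₂ => ?_)
  have g₂ : ∀ a, a ∉ [11, 28] → m₂ a = m a := fun a ha => by
    simp only [List.mem_cons, List.not_mem_nil, or_false, not_or] at ha
    rw [f₂ a ha.2, f₁ a ha.1]
  have h₂ : E.Low b m₂ := h.of_frame ok₂ (g₂ 3 (by decide)) (g₂ 4 (by decide)) (g₂ 5 (by decide))
    (g₂ 6 (by decide)) (g₂ 10 (by decide))
  have e11 : ∀ i < E.k, m₂ 11 i = m 10 i := fun i hi => by
    rw [f₂ 11 (by decide), v₁ i hi]; rfl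
  have e10 : m₂ 10 = m 10 := g₂ 10 (by decide)
  have e28 : ∀ i < E.k, m₂ 28 i ≠ 0 := fun i hi => by rw [v₂ i hi]; simp [Expr.nat]
  refine Runs.then (D := 2600 * (E.H * E.levels)) (D' := 60 * (E.H * E.levels)) (by omega)
    ((runs_moveAt h₂.inv hj ((congrFun (g₂ 30 (by decide)) 0).trans h30) fun i hi _ => by
      rw [e11 i hi]; exact h.loc i hi).mono le_rfl fun m₃ h₃ => ?_)
  obtain ⟨F, hm⟩ := h₃
  have st := h₂.step hm fun v hv hd => by
    obtain ⟨i, hi, rfl⟩ := h₂.cover v hv hd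
    exact ⟨i, hi, e28 i hi, by rw [e11 i hi, e10]⟩
  obtain ⟨d₁, d₂, d₃⟩ := h₂.deg_moved hm
  refine Runs.setIf hm.flipped.inv.ok rfl (by simp only [Expr.cost]; omega) (fun i hi _ =>
    hm.flipped.inv.ok.lt_of_grade hi rfl) fun m₄ ok₄ f₄ v₄ => ?_
  have e10' : m₃ 10 = m 10 := (hm.frame 10 (by decide)).trans e10
  -- a token that has been passed on follows the reversed edge, all other tokens stay
  have stay : ∀ i < E.k, (∀ x, ¬ F x (m 10 i)) → m₄ 10 i = m 10 i := fun i hi hno => by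
    rw [v₄ i hi, if_neg, e10']
    intro hg
    have := hm.success i hi hg
    rw [e11 i hi] at this
    exact hno _ this
  have go : ∀ i < E.k, ∀ x, F x (m 10 i) → m₄ 10 i = x := fun i hi x hF => by
    have hF' : F x (m₂ 11 i) := by rwa [e11 i hi]
    have hg : m₃ 15 i ≠ 0 := fun h0 => hm.failure i hi h0 (e28 i hi) x hF'
    rw [v₄ i hi, if_pos (show (reg 15).nat m₃ i ≠ 0 from hg)]
    exact hm.unique _ _ _ (hm.success i hi hg) hF'
  have k3 : m₄ 3 = m₃ 3 := f₄ 3 (by decide)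
  have k5 : m₄ 5 = m₃ 5 := f₄ 5 (by decide)
  have dd : ∀ u, deg m₄ u = deg m₃ u := fun u => congrFun k5 u
  refine ⟨⟨hm.flipped.inv.of_frame ok₄ k3 (f₄ 4 (by decide)) k5 (f₄ 6 (by decide)), h.base_le,
    fun u hu => ?_, fun u hu => ?_, fun u hu v hv hc => ?_, fun i hi => ?_, fun u hu hd => ?_⟩,
    (Same.of_frame fun a ha => ?_).trans (hm.same.trans (Same.of_frame fun a ha => ?_)), ?_, ?_,
    (lowGame_agree (g₂ 3 (by decide)) (g₂ 5 (by decide))).step (lowGame_agree k3 k5) st⟩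
  · rw [dd]
    by_cases h1 : ∃ w, F u w
    · exact (d₂ _ _ h1.choose_spec).1
    by_cases h2 : ∃ w, F w u
    · exact (d₁ _ _ h2.choose_spec).le
    rw [d₃ u hu (fun w hw => h1 ⟨w, hw⟩) fun w hw => h2 ⟨w, hw⟩]; exact h₂.le u hu
  · rw [dd]
    by_cases h1 : ∃ w, F u w
    · exact (d₂ _ _ h1.choose_spec).2
    by_cases h2 : ∃ w, F w u
    · have := d₁ _ _ h2.choose_spec; omega
    rw [d₃ u hu (fun w hw => h1 ⟨w, hw⟩) fun w hw => h2 ⟨w, hw⟩]; exact h₂.ge u hu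
  · rw [cls, k3] at hc
    rcases (hm.flipped.edge u hu v hv).1 hc with h1 | h1
    · exact h₂.edge u hu v hv h1.1
    · have := h₂.gap hm h1; omega
  · by_cases h1 : ∃ x, F x (m 10 i)
    · obtain ⟨x, hx⟩ := h1
      rw [go i hi x hx]; exact (hm.gap _ _ hx).2.1
    · rw [stay i hi fun x hx => h1 ⟨x, hx⟩]; exact h.loc i hi
  · rw [dd] at hd
    by_cases h1 : deg m₂ u < b u
    · obtain ⟨i, hi, hiu⟩ := h₂.cover u hu h1
      rw [e10] at hiu
      refine ⟨i, hi, ?_⟩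
      rw [stay i hi, hiu]
      intro x hx
      rw [hiu] at hx
      have := d₁ _ _ hx
      omega
    · obtain ⟨w, hw⟩ : ∃ w, F u w := by
        by_contra! h2
        by_cases h3 : ∃ w, F w u
        · have := d₁ _ _ h3.choose_spec; omega
        · have := d₃ u hu h2 fun w hw => h3 ⟨w, hw⟩
          omega
      obtain ⟨i, hi, _, rfl⟩ := hm.request _ _ hw
      rw [e11 i hi] at hw
      exact ⟨i, hi, go i hi u hw⟩
  · exact g₂ a fun h' => ha ((by decide : ∀ a ∈ [11, 28], a ∈ [10, 11, 28, 29, 30, 46]) a h')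
  · exact f₄ a (by rintro rfl; exact ha (by decide))
  · rw [f₄ 30 (by decide), hm.frame 30 (by decide), g₂ 30 (by decide)]
  · rw [f₄ 46 (by decide), hm.frame 46 (by decide), g₂ 46 (by decide)]

theorem runs_passHigh {m : Mem} {j : ℕ} (h : E.High b m) (hj : j ≤ E.H) (h30 : m 30 0 = j) :
    E.Runs passHigh m (2700 * (E.H * E.levels)) fun m' => E.High b m' ∧ E.Same m m' ∧
      m' 30 = m 30 ∧ m' 46 = m 46 ∧ (highGame E b).Step j m m' := by
  have hL : 1 ≤ E.H * E.levels := Nat.mul_pos E.one_le_H E.one_le_levels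
  have hQ := E.Q_ge
  unfold passHigh
  refine Runs.then (D := 20) (D' := 2680 * (E.H * E.levels)) (by omega) (Runs.set h.inv.ok rfl
    (by decide) (fun i hi => h.inv.ok.lt_of_grade hi rfl) fun m₁ ok₁ f₁ v₁ => ?_)
  refine Runs.then (D := 20) (D' := 2660 * (E.H * E.levels)) (by omega) (Runs.set ok₁ rfl
    (by decide) (fun i hi => ok₁.lt_of_grade hi rfl) fun m₂ ok₂ f₂ v₂ => ?_)
  refine Runs.then (D := 20) (D' := 2640 * (E.H * E.levels)) (by omega) (Runs.set ok₂ rfl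
    (by decide) (fun i hi => ok₂.lt_of_grade hi rfl) fun m₃ ok₃ f₃ v₃ => ?_)
  have g₃ : ∀ a, a ∉ [11, 28, 29] → m₃ a = m a := fun a ha => by
    simp only [List.mem_cons, List.not_mem_nil, or_false, not_or] at ha
    rw [f₃ a ha.2.1, f₂ a ha.1, f₁ a ha.2.2]
  have h₃ : E.High b m₃ := h.of_frame ok₃ (g₃ 3 (by decide)) (g₃ 4 (by decide)) (g₃ 5 (by decide))
    (g₃ 6 (by decide)) (g₃ 10 (by decide))
  have e29 : ∀ i < E.k, m₁ 29 i = E.out m (m 10 i) j := fun i hi => by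
    rw [v₁ i hi]; simp only [Expr.nat, Op.nat, h.inv.ok.H, h30]
  have e11 : ∀ i < E.k, m₃ 11 i = E.out m (m 10 i) j - 1 := fun i hi => by
    rw [f₃ 11 (by decide), v₂ i hi]; simp only [Expr.nat, Op.nat]; rw [e29 i hi]
  have e10 : m₃ 10 = m 10 := g₃ 10 (by decide)
  have e28 : ∀ i < E.k, (m₃ 28 i ≠ 0 ↔ j < E.H ∧ E.out m (m 10 i) j ≠ 0) := fun i hi => by
    rw [v₃ i hi, Expr.nat_mul_ne_zero, Expr.nat_lt_ne_zero, Expr.nat_lt_ne_zero]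
    simp only [Expr.nat, ok₂.H]
    rw [f₂ 30 (by decide), f₁ 30 (by decide), h30, f₂ 29 (by decide), e29 i hi,
      Nat.pos_iff_ne_zero]
  have c₃ : ∀ u v, E.cls m₃ u v = E.cls m u v := fun u v => by rw [cls, g₃ 3 (by decide)]
  have d₀ : ∀ u, deg m₃ u = deg m u := fun u => by rw [deg, g₃ 5 (by decide)]
  -- a token at the tail of an edge of class `j + 1` points to the head of this edge
  have point : ∀ i < E.k, ∀ v < E.n, E.cls m (m 10 i) v = j + 1 → b (m 10 i) < deg m (m 10 i) →
      m₃ 28 i ≠ 0 ∧ m₃ 11 i = v := fun i hi v hv hc hd => by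
    have hu := h.loc i hi
    have hjH : j < E.H := by
      by_contra hjH
      obtain rfl : j = E.H := by omega
      have := h.surplus _ hu ⟨v, hv, hc⟩
      have := h.inv.wf.deg_le hu
      omega
    have := h.inv.wf.slot _ hu v hv j hjH hc
    exact ⟨(e28 i hi).2 ⟨hjH, by omega⟩, by rw [e11 i hi]; omega⟩
  refine Runs.then (D := 2600 * (E.H * E.levels)) (D' := 40 * (E.H * E.levels)) (by omega)
    ((runs_moveAt h₃.inv hj ((congrFun (g₃ 30 (by decide)) 0).trans h30) fun i hi hg => by
      obtain ⟨h1, h2⟩ := (e28 i hi).1 hg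
      have := h.inv.wf.out_le _ (h.loc i hi) j h1
      rw [e11 i hi]; omega).mono le_rfl fun m₄ h₄ => ?_)
  obtain ⟨F, hm⟩ := h₄
  have st := h₃.step hm fun u hu hd v hv hc => by
    obtain ⟨i, hi, rfl⟩ := h₃.cover u hu hd
    rw [c₃, e10] at hc
    rw [d₀, e10] at hd
    exact ⟨i, hi, point i hi v hv hc hd⟩
  obtain ⟨d₁, d₂, d₃⟩ := h₃.deg_moved hm
  refine Runs.setIf hm.flipped.inv.ok rfl (by simp only [Expr.cost]; omega) (fun i hi _ =>
    hm.flipped.inv.ok.lt_of_grade hi rfl) fun m₅ ok₅ f₅ v₅ => ?_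
  have v₅' : ∀ i < E.k, m₅ 10 i = if m₄ 15 i ≠ 0 ∧ m₄ 12 i = m 10 i then m₃ 11 i else m 10 i := by
    intro i hi
    have hg : (eMul (reg 15) (eEq (reg 12) (reg 10))).nat m₄ i ≠ 0 ↔
        m₄ 15 i ≠ 0 ∧ m₄ 12 i = m 10 i := by
      rw [Expr.nat_mul_ne_zero, Expr.nat_eq_ne_zero]
      simp only [Expr.nat]
      rw [hm.frame 10 (by decide), e10]
    by_cases hc : m₄ 15 i ≠ 0 ∧ m₄ 12 i = m 10 i
    · rw [v₅ i hi, if_pos (hg.2 hc), if_pos hc]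
      exact congrFun (hm.frame 11 (by decide)) i
    · rw [v₅ i hi, if_neg (mt hg.1 hc), if_neg hc, hm.frame 10 (by decide), e10]
  have stay : ∀ i < E.k, (∀ v, ¬ F (m 10 i) v) → m₅ 10 i = m 10 i := fun i hi hno => by
    rw [v₅' i hi, if_neg]
    rintro ⟨hg, he⟩
    have := hm.success i hi hg
    rw [he] at this
    exact hno _ this
  have go : ∀ i < E.k, ∀ v, F (m 10 i) v → m₅ 10 i = v := fun i hi v hF => by
    obtain ⟨hv, hu, hc, _⟩ := hm.gap _ _ hF
    have hd := h₃.gap hm hF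
    rw [c₃] at hc
    rw [d₀] at hd
    obtain ⟨p1, p2⟩ := point i hi v hv hc (by omega)
    have hF' : F (m 10 i) (m₃ 11 i) := by rwa [p2]
    have hg : m₄ 15 i ≠ 0 := fun h0 => hm.failure i hi h0 p1 _ hF'
    rw [v₅' i hi, if_pos ⟨hg, hm.unique _ _ _ (hm.success i hi hg) hF'⟩, p2]
  have k3 : m₅ 3 = m₄ 3 := f₅ 3 (by decide)
  have k5 : m₅ 5 = m₄ 5 := f₅ 5 (by decide)
  have dd : ∀ u, deg m₅ u = deg m₄ u := fun u => congrFun k5 u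
  refine ⟨⟨hm.flipped.inv.of_frame ok₅ k3 (f₅ 4 (by decide)) k5 (f₅ 6 (by decide)), h.base_le,
    fun u hu => ?_, fun u hu => ?_, fun u hu v hv hc => ?_, fun u hu hs => ?_, fun i hi => ?_,
    fun u hu hd => ?_⟩,
    (Same.of_frame fun a ha => ?_).trans (hm.same.trans (Same.of_frame fun a ha => ?_)), ?_, ?_,
    (highGame_agree (g₃ 3 (by decide)) (g₃ 5 (by decide))).step (highGame_agree k3 k5) st⟩
  · rw [dd]
    by_cases h1 : ∃ w, F u w
    · exact (d₂ _ _ h1.choose_spec).ge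
    by_cases h2 : ∃ w, F w u
    · have := d₁ _ _ h2.choose_spec; omega
    rw [d₃ u hu (fun w hw => h1 ⟨w, hw⟩) fun w hw => h2 ⟨w, hw⟩]; exact h₃.ge u hu
  · rw [dd]
    by_cases h1 : ∃ w, F u w
    · have := d₂ _ _ h1.choose_spec; omega
    by_cases h2 : ∃ w, F w u
    · exact (d₁ _ _ h2.choose_spec).le
    rw [d₃ u hu (fun w hw => h1 ⟨w, hw⟩) fun w hw => h2 ⟨w, hw⟩]; exact h₃.le u hu
  · rw [cls, k3] at hc
    rcases (hm.flipped.edge u hu v hv).1 hc with h1 | h1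
    · exact h₃.edge u hu v hv h1.1
    · have := h₃.gap hm h1; omega
  · obtain ⟨v, hv, hc⟩ := hs
    rw [cls, k3] at hc
    exact h₃.surplus u hu ⟨v, hv, hm.flipped.surplus u hu v hv hc⟩
  · by_cases h1 : ∃ v, F (m 10 i) v
    · obtain ⟨v, hv⟩ := h1
      rw [go i hi v hv]; exact (hm.gap _ _ hv).1
    · rw [stay i hi fun x hx => h1 ⟨x, hx⟩]; exact h.loc i hi
  · rw [dd] at hd
    by_cases h1 : b u < deg m₃ u
    · obtain ⟨i, hi, hiu⟩ := h₃.cover u hu h1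
      rw [e10] at hiu
      refine ⟨i, hi, ?_⟩
      rw [stay i hi, hiu]
      intro x hx
      rw [hiu] at hx
      have := d₂ _ _ hx
      omega
    · obtain ⟨w, hw⟩ : ∃ w, F w u := by
        by_contra! h2
        by_cases h3 : ∃ w, F u w
        · have := d₂ _ _ h3.choose_spec; omega
        · have := d₃ u hu (fun w hw => h3 ⟨w, hw⟩) h2
          omega
      have hgap := h₃.gap hm hw
      obtain ⟨i, hi, rfl⟩ := h₃.cover w (hm.gap _ _ hw).2.1 (by omega)
      rw [e10] at hw
      exact ⟨i, hi, go i hi u hw⟩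
  · exact g₃ a fun h' => ha ((by decide : ∀ a ∈ [11, 28, 29], a ∈ [10, 11, 28, 29, 30, 46]) a h')
  · exact f₅ a (by rintro rfl; exact ha (by decide))
  · rw [f₅ 30 (by decide), hm.frame 30 (by decide), g₃ 30 (by decide)]
  · rw [f₅ 46 (by decide), hm.frame 46 (by decide), g₃ 46 (by decide)]

/-- A bound on the running time of `rebalance`. -/
def rebalanceTime (E : Env) : ℕ :=
  ((E.H + 1) * (2 * E.H + 1) + 1) * ((E.H + 1) * (2700 * (E.H * E.levels) + 10) + 30) + 30

/-- The degree of the tail of an edge exceeds the degree of its head by at most one. As degrees are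
truncated at `H`, this is `H`-balance. -/
def Balanced (E : Env) (m : Mem) : Prop :=
  ∀ u < E.n, ∀ v < E.n, E.cls m u v ≠ 0 → deg m u ≤ deg m v + 1

theorem runs_rebalanceLow {m : Mem} (h : E.Low b m) :
    E.Runs (rebalance passLow) m E.rebalanceTime fun m' =>
      E.Low b m' ∧ E.Same m m' ∧ E.Balanced m' := by
  refine (runs_rebalance (lowGame E b) (St := fun m' => E.Low b m' ∧ E.Same m m')
    (fun m' h' => h'.1.inv.ok) (fun m₁ m₂ h₁ ok₂ f₂ => ?_) (fun m' p q h' he => ?_)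
    (fun m₁ j h₁ hj h30 => (runs_passLow h₁.1 hj h30).mono le_rfl fun m₂ h₂ => ?_)
    ⟨h, Same.of_frame fun _ _ => rfl⟩ ?_).mono le_rfl fun m' h' => ?_
  · have f : ∀ a, a ∉ [30, 46] → m₂ a = m₁ a := fun a ha => by
      simp only [List.mem_cons, List.not_mem_nil, or_false, not_or] at ha
      exact f₂ a ha.1 ha.2
    exact ⟨⟨h₁.1.of_frame ok₂ (f 3 (by decide)) (f 4 (by decide)) (f 5 (by decide))
      (f 6 (by decide)) (f 10 (by decide)), h₁.2.trans (Same.of_frame fun a ha => f a fun h' => ha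
        ((by decide : ∀ a ∈ [30, 46], a ∈ [10, 11, 28, 29, 30, 46]) a h'))⟩,
      lowGame_agree (f 3 (by decide)) (f 5 (by decide))⟩
  · obtain ⟨hp, hq, hc, -⟩ := he
    exact ⟨Nat.pos_of_ne_zero hc, h'.1.inv.wf.cls_le q hq p hp⟩
  · exact ⟨⟨h₂.1, h₁.2.trans h₂.2.1⟩, h₂.2.2⟩
  · refine TokenGame.Slack.init (ρ := fun p => E.H - b p) (fun p q he => ?_) (fun p => by omega)
      fun p => ?_
    · obtain ⟨hp, hq, hc, hb⟩ := he
      have := h.base_le q hq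
      omega
    · simp only [lowGame]
      by_cases hp : p < E.n
      · by_cases hb : b p < E.H
        · have hd := h.le p hp
          have hs : ¬ E.HasSurplus m p := by
            rintro ⟨v, hv, hc⟩
            have := h.inv.wf.surplus p hp v hv hc
            omega
          have h1 := (Finset.card_le_card (Finset.monotone_filter_right (Finset.range E.n)
            fun u _ (hu : u < E.n ∧ p < E.n ∧ E.cls m p u ≠ 0 ∧ b p = b u + 1) => hu.2.2.1)).trans
            (h.inv.wf.card_out_le hp hs)
          rw [if_pos hb]
          split_ifs <;> omega
        · rw [if_neg hb]
          split_ifs <;> omega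
      · simp only [hp, false_and, and_false, if_false, Finset.filter_false, Finset.card_empty]
        split_ifs <;> omega
  · obtain ⟨⟨h1, h2⟩, -, h3⟩ := h'
    refine ⟨h1, h2, fun u hu v hv hc => ?_⟩
    have e1 := h1.edge u hu v hv hc
    have e2 := h1.le u hu
    have e3 := h1.ge v hv
    by_contra hlt
    have := (h3 v u ⟨hv, hu, hc, by omega⟩ ⟨hv, by omega⟩).2
    omega

theorem runs_rebalanceHigh {m : Mem} (h : E.High b m) :
    E.Runs (rebalance passHigh) m E.rebalanceTime fun m' =>
      E.High b m' ∧ E.Same m m' ∧ (highGame E b).Progress m m' ∧ E.Balanced m' := by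
  refine (runs_rebalance (highGame E b) (St := fun m' => E.High b m' ∧ E.Same m m')
    (fun m' h' => h'.1.inv.ok) (fun m₁ m₂ h₁ ok₂ f₂ => ?_) (fun m' p q h' he => ?_)
    (fun m₁ j h₁ hj h30 => (runs_passHigh h₁.1 hj h30).mono le_rfl fun m₂ h₂ => ?_)
    ⟨h, Same.of_frame fun _ _ => rfl⟩ ?_).mono le_rfl fun m' h' => ?_
  · have f : ∀ a, a ∉ [30, 46] → m₂ a = m₁ a := fun a ha => by
      simp only [List.mem_cons, List.not_mem_nil, or_false, not_or] at ha
      exact f₂ a ha.1 ha.2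
    exact ⟨⟨h₁.1.of_frame ok₂ (f 3 (by decide)) (f 4 (by decide)) (f 5 (by decide))
      (f 6 (by decide)) (f 10 (by decide)), h₁.2.trans (Same.of_frame fun a ha => f a fun h' => ha
        ((by decide : ∀ a ∈ [30, 46], a ∈ [10, 11, 28, 29, 30, 46]) a h'))⟩,
      highGame_agree (f 3 (by decide)) (f 5 (by decide))⟩
  · obtain ⟨hp, hq, hc, -⟩ := he
    exact ⟨Nat.pos_of_ne_zero hc, h'.1.inv.wf.cls_le p hp q hq⟩
  · exact ⟨⟨h₂.1, h₁.2.trans h₂.2.1⟩, h₂.2.2⟩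
  · refine TokenGame.Slack.init (ρ := fun p => min (b p) E.H) (fun p q he => ?_)
      (fun p => min_le_right _ _) fun p => ?_
    · obtain ⟨hp, hq, hc, hb⟩ := he
      have := h.base_le p hp
      omega
    · simp only [highGame]
      by_cases hp : p < E.n
      · by_cases hb : b p < E.H
        · have hd := h.le p hp
          have hs : ¬ E.HasSurplus m p := fun hs => by
            have := h.surplus p hp hs
            omega
          have h1 := (Finset.card_le_card (Finset.monotone_filter_right (Finset.range E.n)
            fun u _ (hu : p < E.n ∧ u < E.n ∧ E.cls m p u ≠ 0 ∧ b p = b u + 1) => hu.2.2.1)).trans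
            (h.inv.wf.card_out_le hp hs)
          have := h.inv.wf.deg_le hp
          rw [if_pos hb]
          split_ifs <;> omega
        · rw [if_neg hb]
          omega
      · simp only [hp, false_and, if_false, Finset.filter_false, Finset.card_empty]
        split_ifs <;> omega
  · obtain ⟨⟨h1, h2⟩, h4, h3⟩ := h'
    refine ⟨h1, h2, h4, fun u hu v hv hc => ?_⟩
    have e1 := h1.edge u hu v hv hc
    have e2 := h1.le u hu
    have e3 := h1.ge v hv
    by_contra hlt
    have := (h3 u v ⟨hu, hv, hc, by omega⟩ ⟨hu, by omega⟩).2
    omega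

end Env

/-! ### Insertion of a batch -/

/-- Every processor whose edge is pending proposes it to the end of smaller degree, and every vertex
of degree less than `H` accepts one proposal. Register `22` tells whether the edge has been
accepted. The accepted edge is directed from the vertex in register `11` to the one in
register `12`. -/
def propose : Prog :=
  .seq (set 11 (reg 1)) <| .seq (set 12 (reg 2)) <|
  .seq (setIf (eLt (.load 5 (reg 2)) (.load 5 (reg 1))) 11 (reg 2)) <|
  .seq (setIf (eLt (.load 5 (reg 2)) (.load 5 (reg 1))) 12 (reg 1)) <|
  .seq (set 26 (eMul (eEq (reg 22) (.const 0)) (eLt (.load 5 (reg 11)) eH))) <|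
  .seq (put (reg 26) 25 (reg 11) .pid) <|
  .seq (set 15 (eMul (eLt (.const 0) (reg 26)) (eEq (.load 25 (reg 11)) .pid))) <|
  .seq (setIf (reg 15) 22 (.const 1)) <| .seq (setIf (reg 15) 10 (reg 11)) <|
  .seq (set 13 (reg 11)) (set 14 (.const 0))

namespace Env

variable {E : Env}

variable (E) in
/-- There is an edge between `u` and `v`. -/
abbrev Adj (m : Mem) (u v : ℕ) : Prop := E.cls m u v ≠ 0 ∨ E.cls m v u ≠ 0

/-- Processor `i` is in charge of the edge between `u` and `v`. -/
def Joins (m : Mem) (i u v : ℕ) : Prop := m 1 i = u ∧ m 2 i = v ∨ m 1 i = v ∧ m 2 i = u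

/-- The arrays `1` and `2` hold the ends of the edges of a batch. -/
structure IsBatch (E : Env) (m : Mem) : Prop where
  lt : ∀ i < E.k, m 1 i < E.n ∧ m 2 i < E.n
  ne : ∀ i < E.k, m 1 i ≠ m 2 i
  inj : ∀ i < E.k, ∀ i' < E.k, ∀ u v, Joins m i u v → Joins m i' u v → i = i'

/-- The effect of `propose`. -/
structure Proposed (E : Env) (m m' : Mem) : Prop where
  ok : E.Ok m'
  frame : ∀ a, a ∉ [10, 11, 12, 13, 14, 15, 22, 25, 26] → m' a = m a
  ends : ∀ i < E.k, Joins m i (m' 11 i) (m' 12 i)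
  deg_le : ∀ i < E.k, deg m (m' 11 i) ≤ deg m (m' 12 i)
  head : ∀ i < E.k, m' 13 i = m' 11 i
  slot : ∀ i < E.k, m' 14 i = 0
  pending : ∀ i < E.k, m' 15 i ≠ 0 → m 22 i = 0 ∧ deg m (m' 11 i) < E.H
  unique : ∀ i < E.k, ∀ i' < E.k, m' 15 i ≠ 0 → m' 15 i' ≠ 0 → m' 11 i = m' 11 i' → i = i'
  accept : ∀ i < E.k, m 22 i = 0 → deg m (m' 11 i) < E.H → ∃ i' < E.k, m' 15 i' ≠ 0 ∧
    m' 11 i' = m' 11 i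
  done : ∀ i < E.k, (m' 22 i ≠ 0 ↔ m 22 i ≠ 0 ∨ m' 15 i ≠ 0)
  loc : ∀ i < E.k, (m' 15 i ≠ 0 → m' 10 i = m' 11 i) ∧ (m' 15 i = 0 → m' 10 i = m 10 i)

theorem runs_propose {m : Mem} (h : E.Ok m) : E.Runs propose m 150 (E.Proposed m) := by
  have hQ : 1 < E.Q ^ 2 := Nat.one_lt_pow (by decide) E.two_le_Q
  unfold propose
  refine Runs.then (D := 10) (D' := 140) (by omega) (Runs.set h rfl (by decide)
    (fun i hi => h.lt_of_grade hi rfl) fun m₁ ok₁ f₁ v₁ => ?_)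
  refine Runs.then (D := 10) (D' := 130) (by omega) (Runs.set ok₁ rfl (by decide)
    (fun i hi => ok₁.lt_of_grade hi rfl) fun m₂ ok₂ f₂ v₂ => ?_)
  refine Runs.then (D := 15) (D' := 115) (by omega) (Runs.setIf ok₂ rfl (by decide)
    (fun i hi _ => ok₂.lt_of_grade hi rfl) fun m₃ ok₃ f₃ v₃ => ?_)
  refine Runs.then (D := 15) (D' := 100) (by omega) (Runs.setIf ok₃ rfl (by decide)
    (fun i hi _ => ok₃.lt_of_grade hi rfl) fun m₄ ok₄ f₄ v₄ => ?_)
  have g₄ : ∀ a, a ∉ [11, 12] → m₄ a = m a := fun a ha => by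
    simp only [List.mem_cons, List.not_mem_nil, or_false, not_or] at ha
    rw [f₄ a ha.2, f₃ a ha.1, f₂ a ha.2, f₁ a ha.1]
  -- the ends of the edge, ordered by degree
  have ends : ∀ i < E.k, Joins m i (m₄ 11 i) (m₄ 12 i) ∧
      deg m (m₄ 11 i) ≤ deg m (m₄ 12 i) := by
    intro i hi
    have c₂ : (eLt (.load 5 (reg 2)) (.load 5 (reg 1))).nat m₂ i ≠ 0 ↔
        deg m (m 2 i) < deg m (m 1 i) := by
      rw [Expr.nat_lt_ne_zero]; simp only [Expr.nat]
      rw [f₂ 5 (by decide), f₁ 5 (by decide), f₂ 2 (by decide), f₁ 2 (by decide),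
        f₂ 1 (by decide), f₁ 1 (by decide)]
    have c₃ : (eLt (.load 5 (reg 2)) (.load 5 (reg 1))).nat m₃ i ≠ 0 ↔
        deg m (m 2 i) < deg m (m 1 i) := by
      rw [← c₂, Expr.nat_lt_ne_zero, Expr.nat_lt_ne_zero]; simp only [Expr.nat]
      rw [f₃ 5 (by decide), f₃ 2 (by decide), f₃ 1 (by decide)]
    have e1 : m₂ 11 i = m 1 i := by rw [f₂ 11 (by decide), v₁ i hi]; rfl
    have e2 : m₃ 12 i = m 2 i := by
      rw [f₃ 12 (by decide), v₂ i hi]; simp only [Expr.nat]; rw [f₁ 2 (by decide)]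
    have e3 : (reg 2).nat m₂ i = m 2 i := by
      simp only [Expr.nat]; rw [f₂ 2 (by decide), f₁ 2 (by decide)]
    have e4 : (reg 1).nat m₃ i = m 1 i := by
      simp only [Expr.nat]; rw [f₃ 1 (by decide), f₂ 1 (by decide), f₁ 1 (by decide)]
    rw [f₄ 11 (by decide), v₃ i hi, v₄ i hi, e1, e2, e3, e4]
    by_cases hd : deg m (m 2 i) < deg m (m 1 i)
    · rw [if_pos (c₂.2 hd), if_pos (c₃.2 hd)]
      exact ⟨.inr ⟨rfl, rfl⟩, hd.le⟩
    · rw [if_neg (mt c₂.1 hd), if_neg (mt c₃.1 hd)]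
      exact ⟨.inl ⟨rfl, rfl⟩, not_lt.1 hd⟩
  refine Runs.then (D := 20) (D' := 80) (by omega) (Runs.set ok₄ rfl (by decide)
    (fun i hi => ok₄.lt_of_grade hi rfl) fun m₅ ok₅ f₅ v₅ => ?_)
  have want : ∀ i < E.k, (m₅ 26 i ≠ 0 ↔ m 22 i = 0 ∧ deg m (m₄ 11 i) < E.H) := fun i hi => by
    rw [v₅ i hi, Expr.nat_mul_ne_zero, Expr.nat_eq_ne_zero, Expr.nat_lt_ne_zero]
    simp only [Expr.nat, ok₄.H]
    rw [g₄ 22 (by decide), g₄ 5 (by decide)]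
  refine Runs.then (D := 10) (D' := 70) (by omega) (Runs.put ok₅ rfl (by decide)
    (fun i hi _ => ?_) fun f hf ok₆ => ?_)
  · exact hi.trans E.k_lt
  simp only [Expr.nat] at hf
  rw [f₅ 11 (by decide)] at hf
  have f₆ : ∀ a ≠ 25, Function.update m₅ 25 f a = m₅ a := fun a ha => Function.update_of_ne ha _ _
  have e₆ : Function.update m₅ 25 f 25 = f := Function.update_self _ _ _
  generalize Function.update m₅ 25 f = m₆ at ok₆ f₆ e₆
  refine Runs.then (D := 20) (D' := 50) (by omega) (Runs.set ok₆ rfl (by decide)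
    (fun i hi => ok₆.lt_of_grade hi rfl) fun m₇ ok₇ f₇ v₇ => ?_)
  refine Runs.then (D := 10) (D' := 40) (by omega) (Runs.setIf ok₇ rfl (by decide)
    (fun i hi _ => ok₇.lt_of_grade hi rfl) fun m₈ ok₈ f₈ v₈ => ?_)
  refine Runs.then (D := 10) (D' := 30) (by omega) (Runs.setIf ok₈ rfl (by decide)
    (fun i hi _ => ok₈.lt_of_grade hi rfl) fun m₉ ok₉ f₉ v₉ => ?_)
  refine Runs.then (D := 10) (D' := 20) (by omega) (Runs.set ok₉ rfl (by decide)
    (fun i hi => ok₉.lt_of_grade hi rfl) fun m₁₀ ok₁₀ f₁₀ v₁₀ => ?_)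
  refine Runs.set ok₁₀ rfl (by decide) (fun i hi => ok₁₀.lt_of_grade hi rfl)
    fun m' ok' f' v' => ?_
  have r11 : m' 11 = m₄ 11 := by
    rw [f' 11 (by decide), f₁₀ 11 (by decide), f₉ 11 (by decide), f₈ 11 (by decide),
      f₇ 11 (by decide), f₆ 11 (by decide), f₅ 11 (by decide)]
  have r12 : m' 12 = m₄ 12 := by
    rw [f' 12 (by decide), f₁₀ 12 (by decide), f₉ 12 (by decide), f₈ 12 (by decide),
      f₇ 12 (by decide), f₆ 12 (by decide), f₅ 12 (by decide)]
  have s11 : m₇ 11 = m₄ 11 := by rw [f₇ 11 (by decide), f₆ 11 (by decide), f₅ 11 (by decide)]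
  have s15 : m' 15 = m₇ 15 := by
    rw [f' 15 (by decide), f₁₀ 15 (by decide), f₉ 15 (by decide), f₈ 15 (by decide)]
  have r15 : ∀ i < E.k, (m' 15 i ≠ 0 ↔ m₅ 26 i ≠ 0 ∧ f (m₄ 11 i) = i) := fun i hi => by
    rw [s15, v₇ i hi, Expr.nat_mul_ne_zero, Expr.nat_eq_ne_zero, Expr.nat_lt_ne_zero]
    simp only [Expr.nat]
    rw [e₆, f₆ 26 (by decide), f₆ 11 (by decide), f₅ 11 (by decide), Nat.pos_iff_ne_zero]
  refine ⟨ok', fun a ha => ?_, fun i hi => ?_, fun i hi => ?_, fun i hi => ?_, fun i hi => ?_,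
    fun i hi hg => ?_, fun i hi i' hi' hg hg' e => ?_, fun i hi h0 hd => ?_, fun i hi => ?_,
    fun i hi => ?_⟩
  · simp only [List.mem_cons, List.not_mem_nil, or_false, not_or] at ha
    rw [f' a (by tauto), f₁₀ a (by tauto), f₉ a (by tauto), f₈ a (by tauto), f₇ a (by tauto),
      f₆ a (by tauto), f₅ a (by tauto), g₄ a (by simp; tauto)]
  · rw [r11, r12]; exact (ends i hi).1
  · rw [r11, r12]; exact (ends i hi).2
  · rw [f' 13 (by decide), v₁₀ i hi, r11]; simp only [Expr.nat]
    rw [f₉ 11 (by decide), f₈ 11 (by decide), s11]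
  · rw [v' i hi]; rfl
  · rw [r11]; exact (want i hi).1 ((r15 i hi).1 hg).1
  · rw [r11] at e
    rw [← ((r15 i hi).1 hg).2, ← ((r15 i' hi').1 hg').2, e]
  · rw [r11] at hd ⊢
    rcases hf (m₄ 11 i) with ⟨i', hi', hg, ha, hv⟩ | ⟨hno, _⟩
    · exact ⟨i', hi', (r15 i' hi').2 ⟨hg, (congrArg f ha).trans hv⟩, ha⟩
    · exact absurd rfl (hno i hi ((want i hi).2 ⟨h0, hd⟩))
  · rw [f' 22 (by decide), f₁₀ 22 (by decide), f₉ 22 (by decide), v₈ i hi, s15,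
      f₇ 22 (by decide), f₆ 22 (by decide), f₅ 22 (by decide), g₄ 22 (by decide)]
    by_cases hg : m₇ 15 i = 0
    · rw [if_neg (by simpa only [Expr.nat, not_not] using hg)]; simp [hg]
    · rw [if_pos (by simpa only [Expr.nat] using hg)]; simp [hg, Expr.nat]
  · have s15' : m₈ 15 = m₇ 15 := f₈ 15 (by decide)
    rw [f' 10 (by decide), f₁₀ 10 (by decide), v₉ i hi, s15, r11]
    constructor
    · intro hg
      rw [if_pos (by simpa only [Expr.nat, s15'] using hg)]
      simp only [Expr.nat]
      rw [f₈ 11 (by decide), s11]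
    · intro hg
      rw [if_neg (by simpa only [Expr.nat, s15', not_not] using hg), f₈ 10 (by decide),
        f₇ 10 (by decide), f₆ 10 (by decide), f₅ 10 (by decide), g₄ 10 (by decide)]

/-- The effect of `link` followed by `refresh`. -/
structure Inserted (E : Env) (m m' : Mem) : Prop where
  inv : E.Inv m'
  frame : ∀ a, a ∉ [3, 4, 5, 21, 31] → a ∉ refreshArrs → m' a = m a
  edge : ∀ u < E.n, ∀ v < E.n, (E.cls m' u v ≠ 0 ↔ E.cls m u v ≠ 0 ∨ E.LinkReq m u v)
  surplus : ∀ u < E.n, E.HasSurplus m' u → E.HasSurplus m u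
  phantom : ∀ u < E.n, ∀ s < E.H, (E.Phantom m' u s ↔ E.Phantom m u s)
  deg_new : ∀ u v, E.LinkReq m u v → deg m' u = deg m u + 1
  deg_old : ∀ u, (∀ v, ¬ E.LinkReq m u v) → deg m' u = deg m u

theorem runs_link_refresh {m : Mem} (h : E.Inv m) (hp : E.LinkPre m)
    (h13 : ∀ i < E.k, m 13 i = m 11 i) (h14 : ∀ i < E.k, m 14 i = 0) :
    E.Runs (.seq link refresh) m (2200 * (E.H * E.levels)) (E.Inserted m) := by
  have hHL : E.H ≤ E.H * E.levels := Nat.le_mul_of_pos_right _ E.one_le_levels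
  have req : ∀ i < E.k, m 15 i ≠ 0 → E.LinkReq m (m 11 i) (m 12 i) := fun i hi hg =>
    ⟨i, hi, hg, rfl, rfl⟩
  refine Runs.then (D := 200 * E.H) (D' := 2000 * (E.H * E.levels)) (by omega)
    ((runs_link h.ok (fun i hi hg => ⟨(hp.lt _ _ (req i hi hg)).1, (hp.lt _ _ (req i hi hg)).2,
      hp.room _ _ (req i hi hg), h.wf.free_slot (hp.lt _ _ (req i hi hg)).1
        (hp.room _ _ (req i hi hg))⟩) hp.unique).mono le_rfl fun m₁ h₁ => ?_)
  obtain ⟨sl, lk⟩ := h₁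
  have w₁ := lk.wf hp h.wf
  have h6 : m₁ 6 = m 6 := lk.frame 6 (by decide)
  have t₁ : E.TreeOk m₁ := fun t z h1 h2 => by
    simp only [tree, h6]; exact h.treeOk t z h1 h2
  have r15 : m₁ 15 = m 15 := lk.frame 15 (by decide)
  have r14 : m₁ 14 = m 14 := lk.frame 14 (by decide)
  have r13 : m₁ 13 = m 13 := lk.frame 13 (by decide)
  have r12 : m₁ 12 = m 12 := lk.frame 12 (by decide)
  have r11 : m₁ 11 = m 11 := lk.frame 11 (by decide)
  refine (runs_refresh lk.ok t₁ (fun i hi hg => ?_) w₁.out_le).mono le_rfl fun m' rf => ?_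
  · rw [r15] at hg
    have := hp.lt _ _ (req i hi hg)
    rw [r11, r12, r13, r14, h13 i hi, h14 i hi]
    exact ⟨this.1, this.2, this.1, Nat.zero_le _⟩
  have s3 : ∀ u v, E.cls m' u v = E.cls m₁ u v := fun u v => by rw [cls, rf.frame 3 (by decide)]
  have s4 : ∀ u v, E.out m' u v = E.out m₁ u v := fun u v => by rw [out, rf.frame 4 (by decide)]
  have s5 : ∀ u, deg m' u = deg m₁ u := fun u => by rw [deg, rf.frame 5 (by decide)]
  refine ⟨h.of_refreshed w₁ h6 rf (act := fun u => ∃ v, E.LinkReq m u v) ?_ ?_ ?_,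
    fun a h1 h2 => by rw [rf.frame a h2, lk.frame a h1], fun u hu v hv => by
    rw [s3, lk.cls_ne_zero hv], fun u hu => ?_, fun u hu s hs => ?_, fun u v hr => by
    rw [s5, lk.deg_new u v hr], fun u hr => by rw [s5, lk.deg_old u hr]⟩
  · rintro u hu ⟨_, i, hi, hg, h1, _⟩ s hs v ho
    exact ⟨i, hi, by rwa [r15], .inr (.inr (.inr (.inr ⟨.inr (by rw [r11, h1]), hs, ho⟩)))⟩
  · intro u hu hne
    by_contra! hno
    exact hne (lk.deg_old u hno)
  · intro u hu v hv hne
    have hr : E.LinkReq m u v := by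
      by_contra hr; exact hne (lk.cls_old u v hv hr)
    have h0 := (hp.new u v hr).1
    have h1 := lk.cls_new u v hr
    have h2 := (lk.free u v hr).1
    exact ⟨⟨v, hr⟩, fun s _ h3 => by omega, fun h3 => by omega⟩
  · rintro ⟨v, hv, hc⟩
    rw [s3] at hc
    exact ⟨v, hv, lk.cls_surplus hv hc⟩
  · rw [← lk.phantom_iff hp hs]
    simp only [Phantom, s3, s4]

open Classical in
variable (E) in
/-- A measure of the progress of insertions at `u`: it never decreases, and it increases whenever
`u` accepts an edge. It combines, in lexicographic order, the degree of `u` and the number of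
out-neighbours whose degree is smaller by one, of which there are at most `H` if `u` has no surplus
edges. -/
noncomputable def credit (m : Mem) (u : ℕ) : ℕ :=
  (E.H + 1) * deg m u + (E.H - ((Finset.range E.n).filter fun c =>
    u < E.n ∧ c < E.n ∧ E.cls m u c ≠ 0 ∧ deg m u = deg m c + 1).card)

theorem credit_le {m : Mem} (h : E.Wf m) {u : ℕ} (hu : u < E.n) :
    E.credit m u ≤ E.H * E.H + 2 * E.H := by
  have h1 : (E.H + 1) * deg m u ≤ (E.H + 1) * E.H := Nat.mul_le_mul_left _ (h.deg_le hu)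
  have h2 : (E.H + 1) * E.H = E.H * E.H + E.H := by ring
  unfold credit
  omega

/-- If the degree of `u` has increased, then this outweighs everything else. Otherwise, `u` cannot
have gained out-neighbours of smaller degree, and if it has passed on a token, then it has lost
one. -/
theorem credit_mono {m m₁ m' : Mem} (h : E.Inv m) (hm₁ : E.Inserted m m₁)
    (hle : ∀ u v, E.LinkReq m u v → deg m u ≤ deg m v) (hroom : ∀ u v, E.LinkReq m u v →
      deg m u < E.H) (h' : E.High (deg m) m') (hpr : (highGame E (deg m)).Progress m₁ m')
    {u : ℕ} (hu : u < E.n) :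
    E.credit m u ≤ E.credit m' u ∧ ∀ v, E.LinkReq m u v → E.credit m u + 1 ≤ E.credit m' u := by
  have h1 := h'.ge u hu
  have h2 := h'.le u hu
  rcases h1.eq_or_lt with h3 | h3
  · have c1 := Finset.card_le_card (Finset.monotone_filter_right (Finset.range E.n)
      fun c _ (hc : u < E.n ∧ c < E.n ∧ E.cls m' u c ≠ 0 ∧ deg m' u = deg m' c + 1) =>
        show u < E.n ∧ c < E.n ∧ E.cls m' u c ≠ 0 ∧ deg m u = deg m c + 1 from
        ⟨hu, hc.2.1, hc.2.2.1, by
          have := h'.edge u hu c hc.2.1 hc.2.2.1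
          have := h'.ge c hc.2.1
          omega⟩)
    have c2 := Finset.card_le_card (Finset.monotone_filter_right (Finset.range E.n)
      fun c _ (hc : u < E.n ∧ c < E.n ∧ E.cls m' u c ≠ 0 ∧ deg m u = deg m c + 1) =>
        show u < E.n ∧ c < E.n ∧ E.cls m₁ u c ≠ 0 ∧ deg m u = deg m c + 1 from hpr.1 u c hc)
    have c3 := Finset.card_le_card (Finset.monotone_filter_right (Finset.range E.n)
      fun c _ (hc : u < E.n ∧ c < E.n ∧ E.cls m₁ u c ≠ 0 ∧ deg m u = deg m c + 1) =>
        show u < E.n ∧ c < E.n ∧ E.cls m u c ≠ 0 ∧ deg m u = deg m c + 1 from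
        ⟨hu, hc.2.1, ((hm₁.edge u hu c hc.2.1).1 hc.2.2.1).resolve_right fun hr => by
          have := hle u c hr
          omega, hc.2.2.2⟩)
    unfold credit
    rw [← h3]
    rw [← h3] at c1
    refine ⟨by omega, fun v hr => ?_⟩
    have hb := hroom u v hr
    have hd := hm₁.deg_new u v hr
    have hp := hpr.2 u
    simp only [highGame, if_pos hb] at hp
    rw [if_neg (by omega), if_pos (by omega)] at hp
    have hs : ¬ E.HasSurplus m u := by
      rintro ⟨v, hv, hc⟩
      have := h.wf.surplus u hu v hv hc
      omega
    have c4 := (Finset.card_le_card (Finset.monotone_filter_right (Finset.range E.n)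
      fun c _ (hc : u < E.n ∧ c < E.n ∧ E.cls m u c ≠ 0 ∧ deg m u = deg m c + 1) =>
        hc.2.2.1)).trans (h.wf.card_out_le hu hs)
    omega
  · have h4 : deg m' u = deg m u + 1 := by omega
    have h5 : (E.H + 1) * (deg m u + 1) = (E.H + 1) * deg m u + E.H + 1 := by ring
    unfold credit
    rw [h4, h5]
    exact ⟨by omega, fun _ _ => by omega⟩

end Env

/-- One sub-batch of an insertion. -/
def insertStep : Prog :=
  .seq propose <| .seq (.seq link refresh) (rebalance passHigh)

/-- The edges that are still pending become surplus edges. -/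
def insertRest : Prog :=
  .seq (set 11 (reg 2)) <| .seq (set 12 (reg 1)) <| .seq (set 13 (reg 2)) <| .seq (set 14 eH) <|
  .seq (set 15 (eEq (reg 22) (.const 0))) <|
  .seq (put (reg 15) 3 (eAdd (eMul (reg 12) eN) (reg 11)) (eAdd eH (.const 1))) refresh

/-- The insertion of a batch. -/
def insertProg : Prog :=
  .seq (set 22 (.const 0)) <| .seq (set 10 (reg 1)) <|
  .seq (setSca 47 (eAdd (eMul (.const 2) (eAdd (eMul eH eH) (eMul (.const 2) eH))) (.const 1))) <|
  .seq (countdown 47 insertStep) insertRest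

namespace Env

variable {E : Env}

/-- The state of the data structure between two operations: every slot in use holds an edge. -/
structure Stable (E : Env) (m : Mem) : Prop where
  inv : E.Inv m
  balanced : E.Balanced m
  full : ∀ u < E.n, ∀ s < E.H, ¬ E.Phantom m u s

theorem Stable.of_frame {m m' : Mem} (h : E.Stable m) (ok : E.Ok m') (h3 : m' 3 = m 3)
    (h4 : m' 4 = m 4) (h5 : m' 5 = m 5) (h6 : m' 6 = m 6) : E.Stable m' := by
  obtain ⟨a1, a2, a3⟩ := h
  refine ⟨a1.of_frame ok h3 h4 h5 h6, ?_, ?_⟩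
  · simpa only [Balanced, cls, deg, h3, h5]
  · simpa only [Phantom, cls, out, h3, h4]

/-- The state after `s` sub-batches of an insertion to `m₀`. Register `22` is nonzero for the edges
that have been accepted. In every sub-batch, the end of smaller degree of a pending edge accepts
some edge, unless both ends have degree `H`. -/
structure Inserting (E : Env) (m₀ : Mem) (s : ℕ) (m : Mem) : Prop where
  stable : E.Stable m
  loc : ∀ i < E.k, m 10 i < E.n
  fst : m 1 = m₀ 1
  snd : m 2 = m₀ 2
  adj : ∀ u < E.n, ∀ v < E.n, (E.Adj m u v ↔ E.Adj m₀ u v ∨ ∃ i < E.k, m 22 i ≠ 0 ∧ Joins m₀ i u v)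
  credit : ∀ i < E.k, m 22 i = 0 → (deg m (m₀ 1 i) = E.H ∧ deg m (m₀ 2 i) = E.H) ∨
    s ≤ E.credit m (m₀ 1 i) + E.credit m (m₀ 2 i)

theorem Inserting.of_frame {m₀ m m' : Mem} {s : ℕ} (h : E.Inserting m₀ s m) (ok : E.Ok m')
    (hf : ∀ a, a ∈ [1, 2, 3, 4, 5, 6, 10, 22] → m' a = m a) : E.Inserting m₀ s m' := by
  obtain ⟨a1, a2, a3, a4, a5, a6⟩ := h
  have h3 := hf 3 (by decide)
  have h5 := hf 5 (by decide)
  refine ⟨a1.of_frame ok h3 (hf 4 (by decide)) h5 (hf 6 (by decide)), ?_, ?_, ?_, ?_, ?_⟩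
  · rwa [hf 10 (by decide)]
  · rwa [hf 1 (by decide)]
  · rwa [hf 2 (by decide)]
  · simpa only [Adj, cls, h3, hf 22 (by decide)]
  · simpa only [Env.credit, deg, cls, h3, h5, hf 22 (by decide)]

theorem Joins.symm {m : Mem} {i u v : ℕ} (h : Joins m i u v) : Joins m i v u := by
  unfold Joins at *; tauto

theorem IsBatch.joins_lt {m : Mem} (hb : E.IsBatch m) {i u v : ℕ} (hi : i < E.k)
    (h : Joins m i u v) : u < E.n ∧ v < E.n ∧ u ≠ v := by
  have h1 := hb.lt i hi
  have h2 := hb.ne i hi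
  unfold Joins at h
  omega

theorem runs_insertStep {m₀ m : Mem} {s : ℕ} (hb : E.IsBatch m₀)
    (hnew : ∀ i < E.k, ∀ u v, Joins m₀ i u v → ¬ E.Adj m₀ u v) (h : E.Inserting m₀ s m) :
    E.Runs insertStep m (E.rebalanceTime + 2400 * (E.H * E.levels)) fun m' =>
      E.Inserting m₀ (s + 1) m' ∧ m' 47 = m 47 := by
  have hL : 1 ≤ E.H * E.levels := Nat.mul_pos E.one_le_H E.one_le_levels
  have joins : ∀ {i u v}, Joins m i u v ↔ Joins m₀ i u v := by
    intro i u v; unfold Joins; rw [h.fst, h.snd]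
  unfold insertStep
  refine Runs.then (D := 150) (D' := E.rebalanceTime + 2200 * (E.H * E.levels)) (by omega)
    ((runs_propose h.stable.inv.ok).mono le_rfl fun m₁ pr => ?_)
  have s₁ : E.Stable m₁ := h.stable.of_frame pr.ok (pr.frame 3 (by decide))
    (pr.frame 4 (by decide)) (pr.frame 5 (by decide)) (pr.frame 6 (by decide))
  have c₁ : ∀ u v, E.cls m₁ u v = E.cls m u v := fun u v => by rw [cls, pr.frame 3 (by decide)]
  have d₁ : ∀ u, deg m₁ u = deg m u := fun u => by rw [deg, pr.frame 5 (by decide)]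
  have cr₁ : ∀ u, E.credit m₁ u = E.credit m u := fun u => by simp only [Env.credit, c₁, d₁]
  have req : ∀ {v x}, E.LinkReq m₁ v x → ∃ i < E.k, m₁ 15 i ≠ 0 ∧ m 22 i = 0 ∧ m₁ 11 i = v ∧
      Joins m₀ i v x ∧ deg m₁ v ≤ deg m₁ x ∧ deg m₁ v < E.H := by
    rintro v x ⟨i, hi, hg, rfl, rfl⟩
    obtain ⟨h1, h2⟩ := pr.pending i hi hg
    exact ⟨i, hi, hg, h1, rfl, joins.1 (pr.ends i hi), by rw [d₁, d₁]; exact pr.deg_le i hi,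
      by rwa [d₁]⟩
  -- the accepted edges are new, and no vertex accepts more than one
  have lp : E.LinkPre m₁ := by
    refine ⟨fun v x x' h1 h2 => ?_, fun v x h1 => ?_, fun v x h1 => ?_, fun v x h1 => ?_⟩
    · obtain ⟨i, hi, hg, rfl, rfl⟩ := h1
      obtain ⟨i', hi', hg', e, rfl⟩ := h2
      rw [pr.unique i hi i' hi' hg hg' e.symm]
    · obtain ⟨i, hi, -, -, -, hj, -⟩ := req h1
      have := hb.joins_lt hi hj
      exact ⟨this.1, this.2.1⟩
    · obtain ⟨i, hi, hg, h0, hv, hj, -⟩ := req h1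
      have hlt := hb.joins_lt hi hj
      have hno : ¬ E.Adj m v x := by
        rw [h.adj v hlt.1 x hlt.2.1]
        rintro (h2 | ⟨i', hi', h2, h3⟩)
        · exact hnew i hi v x hj h2
        · exact h2 ((hb.inj i hi i' hi' v x hj h3) ▸ h0)
      rw [Adj, not_or, not_not, not_not] at hno
      refine ⟨by rw [c₁]; exact hno.1, by rw [c₁]; exact hno.2, fun h2 => ?_⟩
      obtain ⟨i', hi', -, -, hx, hj', -⟩ := req h2
      obtain rfl := hb.inj i hi i' hi' v x hj hj'.symm
      exact hlt.2.2 (hv.symm.trans hx)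
    · obtain ⟨i, hi, -, -, -, -, -, h2⟩ := req h1
      exact h2
  refine Runs.then (D := 2200 * (E.H * E.levels)) (D' := E.rebalanceTime) (by omega)
    ((runs_link_refresh s₁.inv lp pr.head pr.slot).mono le_rfl fun m₂ ins => ?_)
  -- the vertices that have accepted an edge hold the tokens; their processors know them
  have hi₂ : E.High (deg m₁) m₂ := by
    refine ⟨ins.inv, fun u hu => s₁.inv.wf.deg_le hu, fun u hu => ?_, fun u hu => ?_,
      fun u hu v hv hc => ?_, fun u hu hs => ?_, fun i hi => ?_, fun u hu hd => ?_⟩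
    · by_cases hr : ∃ v, E.LinkReq m₁ u v
      · have := ins.deg_new u _ hr.choose_spec; omega
      · rw [ins.deg_old u fun v hv => hr ⟨v, hv⟩]
    · by_cases hr : ∃ v, E.LinkReq m₁ u v
      · have := ins.deg_new u _ hr.choose_spec; omega
      · rw [ins.deg_old u fun v hv => hr ⟨v, hv⟩]; omega
    · rcases (ins.edge u hu v hv).1 hc with hc | hr
      · exact s₁.balanced u hu v hv hc
      · obtain ⟨_, _, _, _, _, _, h2, _⟩ := req hr
        omega
    · obtain ⟨v, hv, hc⟩ := ins.surplus u hu hs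
      exact s₁.inv.wf.surplus u hu v hv hc
    · rw [ins.frame 10 (by decide) (by decide)]
      by_cases hg : m₁ 15 i = 0
      · rw [(pr.loc i hi).2 hg]; exact h.loc i hi
      · rw [(pr.loc i hi).1 hg]
        exact (hb.joins_lt hi (joins.1 (pr.ends i hi))).1
    · obtain ⟨v, hr⟩ : ∃ v, E.LinkReq m₁ u v := by
        by_contra! hno
        rw [ins.deg_old u hno] at hd
        omega
      obtain ⟨i, hi, hg, rfl, -⟩ := hr
      exact ⟨i, hi, by rw [ins.frame 10 (by decide) (by decide), (pr.loc i hi).1 hg]⟩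
  refine (runs_rebalanceHigh hi₂).mono le_rfl fun m₃ h₃ => ?_
  obtain ⟨hi₃, sm, pg, bal⟩ := h₃
  have mono := fun {u : ℕ} (hu : u < E.n) => credit_mono s₁.inv ins
    (fun u v hr => by obtain ⟨_, _, _, _, _, _, h2, _⟩ := req hr; exact h2)
    (fun u v hr => by obtain ⟨_, _, _, _, _, _, _, h2⟩ := req hr; exact h2) hi₃ pg hu
  have e22 : m₃ 22 = m₁ 22 := by
    rw [sm.frame 22 (by decide) (by decide), ins.frame 22 (by decide) (by decide)]
  have fr : ∀ a, a ∉ [3, 4, 5, 21, 31] → a ∉ refreshArrs → a ∉ [10, 11, 28, 29, 30, 46] →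
      a ∉ moveArrs → a ∉ [10, 11, 12, 13, 14, 15, 22, 25, 26] → m₃ a = m a :=
    fun a b1 b2 b3 b4 b5 => by rw [sm.frame a b3 b4, ins.frame a b1 b2, pr.frame a b5]
  refine ⟨⟨⟨hi₃.inv, bal, fun u hu s hs => ?_⟩, hi₃.loc, ?_, ?_, fun u hu v hv => ?_,
    fun i hi h0 => ?_⟩, fr 47 (by decide) (by decide) (by decide) (by decide) (by decide)⟩
  · rw [sm.phantom u hu s hs, ins.phantom u hu s hs]; exact s₁.full u hu s hs
  · rw [fr 1 (by decide) (by decide) (by decide) (by decide) (by decide), h.fst]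
  · rw [fr 2 (by decide) (by decide) (by decide) (by decide) (by decide), h.snd]
  · have h1 : E.Adj m₃ u v ↔ E.Adj m u v ∨ E.LinkReq m₁ u v ∨ E.LinkReq m₁ v u := by
      refine (sm.edge u hu v hv).trans ?_
      rw [ins.edge u hu v hv, ins.edge v hv u hu, c₁, c₁]
      tauto
    rw [h1, h.adj u hu v hv, or_assoc, e22]
    refine or_congr_right ⟨?_, ?_⟩
    · rintro (⟨i, hi, hg, hj⟩ | hr | hr)
      · exact ⟨i, hi, (pr.done i hi).2 (.inl hg), hj⟩
      · obtain ⟨i, hi, hg, -, -, hj, -⟩ := req hr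
        exact ⟨i, hi, (pr.done i hi).2 (.inr hg), hj⟩
      · obtain ⟨i, hi, hg, -, -, hj, -⟩ := req hr
        exact ⟨i, hi, (pr.done i hi).2 (.inr hg), hj.symm⟩
    · rintro ⟨i, hi, hg, hj⟩
      rcases (pr.done i hi).1 hg with hg | hg
      · exact .inl ⟨i, hi, hg, hj⟩
      · have h2 := joins.1 (pr.ends i hi)
        have hr : E.LinkReq m₁ (m₁ 11 i) (m₁ 12 i) := ⟨i, hi, hg, rfl, rfl⟩
        right
        unfold Joins at hj h2
        rcases hj with ⟨rfl, rfl⟩ | ⟨rfl, rfl⟩ <;> rcases h2 with ⟨e1, e2⟩ | ⟨e1, e2⟩ <;>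
          rw [← e1, ← e2] at hr <;> tauto
  · rw [e22] at h0
    have h22 : m 22 i = 0 := by
      by_contra hg; exact (pr.done i hi).2 (.inl hg) h0
    obtain ⟨ha, hb', -⟩ := hb.joins_lt hi (u := m₀ 1 i) (v := m₀ 2 i) (.inl ⟨rfl, rfl⟩)
    have full : ∀ u < E.n, deg m u = E.H → deg m₃ u = E.H := fun u hu e => by
      have := hi₃.ge u hu
      have := hi₃.inv.wf.deg_le hu
      have := d₁ u
      omega
    rcases h.credit i hi h22 with ⟨e1, e2⟩ | hcr
    · exact .inl ⟨full _ ha e1, full _ hb' e2⟩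
    have m1 := mono ha
    have m2 := mono hb'
    rw [cr₁] at m1 m2
    have h2 : (m₀ 1 i = m₁ 11 i ∧ m₀ 2 i = m₁ 12 i) ∨ (m₀ 1 i = m₁ 12 i ∧ m₀ 2 i = m₁ 11 i) :=
      joins.1 (pr.ends i hi)
    -- the end of smaller degree accepts an edge unless it has degree `H`
    by_cases hd : deg m (m₁ 11 i) < E.H
    · obtain ⟨i', hi', hg', e⟩ := pr.accept i hi h22 hd
      have hr : E.LinkReq m₁ (m₁ 11 i) (m₁ 12 i') := ⟨i', hi', hg', e, rfl⟩
      right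
      rcases h2 with ⟨e1, e2⟩ | ⟨e1, e2⟩
      · have := m1.2 _ (e1 ▸ hr)
        omega
      · have := m2.2 _ (e2 ▸ hr)
        omega
    · have h3 := pr.deg_le i hi
      have h4 := h.stable.inv.wf.deg_le ha
      have h5 := h.stable.inv.wf.deg_le hb'
      left
      rcases h2 with ⟨e1, e2⟩ | ⟨e1, e2⟩ <;> rw [← e1, ← e2] at h3
      · rw [← e1] at hd
        exact ⟨full _ ha (by omega), full _ hb' (by omega)⟩
      · rw [← e2] at hd
        exact ⟨full _ ha (by omega), full _ hb' (by omega)⟩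

theorem runs_insertRest {m₀ m : Mem} (hb : E.IsBatch m₀)
    (hnew : ∀ i < E.k, ∀ u v, Joins m₀ i u v → ¬ E.Adj m₀ u v)
    (h : E.Inserting m₀ (2 * (E.H * E.H + 2 * E.H) + 1) m) :
    E.Runs insertRest m (2100 * (E.H * E.levels)) fun m' => E.Stable m' ∧
      ∀ u < E.n, ∀ v < E.n, (E.Adj m' u v ↔ E.Adj m₀ u v ∨ ∃ i < E.k, Joins m₀ i u v) := by
  have hL : 1 ≤ E.H * E.levels := Nat.mul_pos E.one_le_H E.one_le_levels
  have hn := E.two_le_n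
  have inv := h.stable.inv
  have ok := inv.ok
  have hQ : E.H + 1 < E.Q ^ 2 :=
    (show E.H + 1 < E.Q by unfold Q; omega).trans_le (Nat.le_self_pow (by decide) _)
  -- both ends of a pending edge have degree `H`: otherwise the sum of their credits would exceed
  -- its maximum
  have full : ∀ i < E.k, m 22 i = 0 → deg m (m₀ 1 i) = E.H ∧ deg m (m₀ 2 i) = E.H := by
    intro i hi h0
    refine (h.credit i hi h0).resolve_right fun hle => ?_
    have := credit_le inv.wf (hb.lt i hi).1
    have := credit_le inv.wf (hb.lt i hi).2
    omega
  unfold insertRest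
  refine Runs.then (D := 10) (D' := 2090 * (E.H * E.levels)) (by omega) (Runs.set ok rfl
    (by decide) (fun i hi => ok.lt_of_grade hi rfl) fun m₁ ok₁ f₁ v₁ => ?_)
  refine Runs.then (D := 10) (D' := 2080 * (E.H * E.levels)) (by omega) (Runs.set ok₁ rfl
    (by decide) (fun i hi => ok₁.lt_of_grade hi rfl) fun m₂ ok₂ f₂ v₂ => ?_)
  refine Runs.then (D := 10) (D' := 2070 * (E.H * E.levels)) (by omega) (Runs.set ok₂ rfl
    (by decide) (fun i hi => ok₂.lt_of_grade hi rfl) fun m₃ ok₃ f₃ v₃ => ?_)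
  refine Runs.then (D := 10) (D' := 2060 * (E.H * E.levels)) (by omega) (Runs.set ok₃ rfl
    (by decide) (fun i hi => ok₃.lt_of_grade hi rfl) fun m₄ ok₄ f₄ v₄ => ?_)
  refine Runs.then (D := 10) (D' := 2050 * (E.H * E.levels)) (by omega) (Runs.set ok₄ rfl
    (by decide) (fun i hi => ok₄.lt_of_grade hi rfl) fun m₅ ok₅ f₅ v₅ => ?_)
  have r11 : ∀ i < E.k, m₅ 11 i = m₀ 2 i := fun i hi => by
    rw [f₅ 11 (by decide), f₄ 11 (by decide), f₃ 11 (by decide), f₂ 11 (by decide), v₁ i hi]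
    simp only [Expr.nat]; rw [h.snd]
  have r12 : ∀ i < E.k, m₅ 12 i = m₀ 1 i := fun i hi => by
    rw [f₅ 12 (by decide), f₄ 12 (by decide), f₃ 12 (by decide), v₂ i hi]
    simp only [Expr.nat]; rw [f₁ 1 (by decide), h.fst]
  have r13 : ∀ i < E.k, m₅ 13 i = m₀ 2 i := fun i hi => by
    rw [f₅ 13 (by decide), f₄ 13 (by decide), v₃ i hi]
    simp only [Expr.nat]; rw [f₂ 2 (by decide), f₁ 2 (by decide), h.snd]
  have r14 : ∀ i < E.k, m₅ 14 i = E.H := fun i hi => by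
    rw [f₅ 14 (by decide), v₄ i hi]; simp only [Expr.nat]; rw [ok₃.H]
  have g₅ : ∀ a, a ∉ [11, 12, 13, 14, 15] → m₅ a = m a := fun a ha => by
    simp only [List.mem_cons, List.not_mem_nil, or_false, not_or] at ha
    rw [f₅ a (by tauto), f₄ a (by tauto), f₃ a (by tauto), f₂ a (by tauto), f₁ a (by tauto)]
  have r15 : ∀ i < E.k, (m₅ 15 i ≠ 0 ↔ m 22 i = 0) := fun i hi => by
    rw [v₅ i hi, Expr.nat_eq_ne_zero]; simp only [Expr.nat]
    rw [f₄ 22 (by decide), f₃ 22 (by decide), f₂ 22 (by decide), f₁ 22 (by decide)]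
  refine Runs.then (D := 20) (D' := 2000 * (E.H * E.levels)) (by omega) (Runs.put ok₅ rfl
    (by decide) (fun i hi _ => ?_) fun f hf ok₆ => ?_)
  · simp only [Expr.nat, Op.nat, ok₅.H]; exact hQ
  have hw := hf.matrix (b := E.n) (A := m₅ 12) (B := m₅ 11) fun i hi hg => by
    simp only [Expr.nat, Op.nat, ok₅.n]
    exact ⟨trivial, by rw [r11 i hi]; exact (hb.lt i hi).2⟩
  have e₁ : ∀ a ≠ 3, Function.update m₅ 3 f a = m₅ a := fun a ha => Function.update_of_ne ha _ _
  have e₁' : Function.update m₅ 3 f 3 = f := Function.update_self _ _ _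
  generalize Function.update m₅ 3 f = m₆ at ok₆ e₁ e₁'
  set P : ℕ → ℕ → Prop := fun u v => ∃ i < E.k, m 22 i = 0 ∧ m₀ 1 i = u ∧ m₀ 2 i = v with hP
  have cP : ∀ u v, P u v → E.cls m₆ u v = E.H + 1 := by
    rintro u v ⟨i, hi, hg, rfl, rfl⟩
    rw [cls, e₁']
    rcases hw (m₀ 1 i) (m₀ 2 i) (hb.lt i hi).2 with ⟨i', hi', hg', hA, hB, e⟩ | ⟨hno, _⟩
    · rw [e]; simp only [Expr.nat, Op.nat, ok₅.H]
    · exact absurd ⟨r12 i hi, r11 i hi⟩ (hno i hi ((r15 i hi).2 hg))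
  have cO : ∀ u v, v < E.n → ¬ P u v → E.cls m₆ u v = E.cls m u v := by
    intro u v hv hno
    rw [cls, e₁']
    rcases hw u v hv with ⟨i, hi, hg, hA, hB, _⟩ | ⟨_, e⟩
    · exact absurd ⟨i, hi, (r15 i hi).1 hg, (r12 i hi).symm.trans hA, (r11 i hi).symm.trans hB⟩ hno
    · rw [e, g₅ 3 (by decide)]
  have o₆ : ∀ u s, E.out m₆ u s = E.out m u s := fun u s => by
    rw [out, e₁ 4 (by decide), g₅ 4 (by decide)]
  have d₆ : ∀ u, deg m₆ u = deg m u := fun u => by rw [deg, e₁ 5 (by decide), g₅ 5 (by decide)]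
  have new : ∀ u v, P u v → u < E.n ∧ v < E.n ∧ E.cls m u v = 0 ∧ E.cls m v u = 0 ∧ ¬ P v u := by
    rintro u v ⟨i, hi, hg, hu, hv⟩
    have hj : Joins m₀ i u v := .inl ⟨hu, hv⟩
    have hlt := hb.joins_lt hi hj
    have hno : ¬ E.Adj m u v := by
      rw [h.adj u hlt.1 v hlt.2.1]
      rintro (h2 | ⟨i', hi', h2, h3⟩)
      · exact hnew i hi u v hj h2
      · exact h2 ((hb.inj i hi i' hi' u v hj h3) ▸ hg)
    rw [Adj, not_or, not_not, not_not] at hno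
    refine ⟨hlt.1, hlt.2.1, hno.1, hno.2, ?_⟩
    rintro ⟨i', hi', -, hv', hu'⟩
    obtain rfl := hb.inj i hi i' hi' u v hj (.inr ⟨hv', hu'⟩)
    exact hlt.2.2 (hu.symm.trans hv')
  have ne : ∀ u v, v < E.n → (E.cls m₆ u v ≠ 0 ↔ E.cls m u v ≠ 0 ∨ P u v) := fun u v hv => by
    by_cases hp : P u v
    · simp [cP u v hp, hp]
    · simp [cO u v hv hp, hp]
  have core : ∀ u v s, v < E.n → s < E.H → (E.cls m₆ u v = s + 1 ↔ E.cls m u v = s + 1) := by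
    intro u v s hv hs
    by_cases hp : P u v
    · rw [cP u v hp, (new u v hp).2.2.1]; omega
    · rw [cO u v hv hp]
  have w₆ : E.Wf m₆ := by
    refine ⟨fun u hu v hv => ?_, fun u hu v hv hc => ?_, fun u hu s hs => ?_,
      fun u hu v hv s hs hc => ?_, fun u hu => ?_, fun u hu v hv hc => ?_⟩
    · by_cases hp : P u v
      · rw [cP u v hp]
      · rw [cO u v hv hp]; exact inv.wf.cls_le u hu v hv
    · by_contra h0
      rcases (ne u v hv).1 hc with h1 | h1 <;> rcases (ne v u hu).1 h0 with h2 | h2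
      · exact h2 (inv.wf.asymm u hu v hv h1)
      · exact h1 (new v u h2).2.2.2.1
      · exact h2 (new u v h1).2.2.2.1
      · exact (new u v h1).2.2.2.2 h2
    · rw [o₆]; exact inv.wf.out_le u hu s hs
    · rw [o₆]; exact inv.wf.slot u hu v hv s hs ((core u v s hv hs).1 hc)
    · rw [d₆, inv.wf.deg_eq u hu]; simp only [o₆]
    · rw [d₆]
      by_cases hp : P u v
      · obtain ⟨i, hi, hg, rfl, rfl⟩ := hp
        exact (full i hi hg).1
      · exact inv.wf.surplus u hu v hv (by rwa [cO u v hv hp] at hc)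
  have h6 : m₆ 6 = m 6 := (e₁ 6 (by decide)).trans (g₅ 6 (by decide))
  have t₆ : E.TreeOk m₆ := fun t z h1 h2 => by
    simp only [tree, h6]; exact inv.treeOk t z h1 h2
  have q15 : m₆ 15 = m₅ 15 := e₁ 15 (by decide)
  have q14 : ∀ i < E.k, m₆ 14 i = E.H := fun i hi => by rw [e₁ 14 (by decide), r14 i hi]
  have q13 : ∀ i < E.k, m₆ 13 i = m₀ 2 i := fun i hi => by rw [e₁ 13 (by decide), r13 i hi]
  have q12 : ∀ i < E.k, m₆ 12 i = m₀ 1 i := fun i hi => by rw [e₁ 12 (by decide), r12 i hi]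
  have q11 : ∀ i < E.k, m₆ 11 i = m₀ 2 i := fun i hi => by rw [e₁ 11 (by decide), r11 i hi]
  refine (runs_refresh ok₆ t₆ (fun i hi hg => ?_) w₆.out_le).mono le_rfl fun m' rf => ?_
  · rw [q11 i hi, q12 i hi, q13 i hi, q14 i hi]
    exact ⟨(hb.lt i hi).2, (hb.lt i hi).1, (hb.lt i hi).2, by omega⟩
  have s3 : ∀ u v, E.cls m' u v = E.cls m₆ u v := fun u v => by rw [cls, rf.frame 3 (by decide)]
  have s4 : ∀ u v, E.out m' u v = E.out m₆ u v := fun u v => by rw [out, rf.frame 4 (by decide)]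
  have s5 : ∀ u, deg m' u = deg m₆ u := fun u => by rw [deg, rf.frame 5 (by decide)]
  refine ⟨⟨inv.of_refreshed w₆ h6 rf (act := fun u => ∃ v, P u v) ?_ ?_ ?_, fun u hu v hv hc => ?_,
    fun u hu s hs hph => ?_⟩, fun u hu v hv => ?_⟩
  · rintro u hu ⟨_, i, hi, hg, h1, _⟩ s hs v ho
    exact ⟨i, hi, by rw [q15]; exact (r15 i hi).2 hg,
      .inr (.inr (.inr (.inr ⟨.inl (by rw [q12 i hi, h1]), hs, ho⟩)))⟩
  · exact fun u hu hne => absurd (d₆ u) hne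
  · intro u hu v hv hne
    have hp : P u v := by
      by_contra hp; exact hne (cO u v hv hp)
    have h0 := (new u v hp).2.2.1
    have hp' := hp
    obtain ⟨i, hi, hg, h1, h2⟩ := hp
    refine ⟨⟨v, hp'⟩, fun s _ h3 => by omega, fun _ => ⟨⟨i, hi, by rw [q15]; exact (r15 i hi).2 hg,
      .inl ⟨by rw [q11 i hi, h2], (q14 i hi).symm, by rw [q12 i hi, h1]⟩⟩, ⟨i, hi, by
      rw [q15]; exact (r15 i hi).2 hg, .inr (.inl ⟨by rw [q12 i hi, h1], rfl,
      by rw [q11 i hi, h2]⟩)⟩⟩⟩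
  · rw [s3] at hc
    rw [s5, s5, d₆, d₆]
    rcases (ne u v hv).1 hc with hc | ⟨i, hi, hg, rfl, rfl⟩
    · exact h.stable.balanced u hu v hv hc
    · have := full i hi hg; omega
  · refine h.stable.full u hu s hs ⟨by rw [← o₆, ← s4]; exact hph.1, fun v hv hc => ?_⟩
    exact hph.2 v hv (by rw [s3]; exact (core u v s hv hs).2 hc)
  · have h1 : E.Adj m' u v ↔ E.Adj m u v ∨ P u v ∨ P v u := by
      rw [Adj, s3, s3, ne u v hv, ne v u hu]; exact or_or_or_comm
    rw [h1, h.adj u hu v hv, or_assoc]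
    refine or_congr_right ⟨?_, ?_⟩
    · rintro (⟨i, hi, _, hj⟩ | ⟨i, hi, _, a, b⟩ | ⟨i, hi, _, a, b⟩)
      · exact ⟨i, hi, hj⟩
      · exact ⟨i, hi, .inl ⟨a, b⟩⟩
      · exact ⟨i, hi, .inr ⟨a, b⟩⟩
    · rintro ⟨i, hi, hj⟩
      by_cases hg : m 22 i = 0
      · rcases hj with ⟨a, b⟩ | ⟨a, b⟩
        · exact .inr (.inl ⟨i, hi, hg, a, b⟩)
        · exact .inr (.inr ⟨i, hi, hg, a, b⟩)
      · exact .inl ⟨i, hi, hg, hj⟩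

/-- A bound on the running time of an insertion. -/
def insertTime (E : Env) : ℕ :=
  (2 * (E.H * E.H + 2 * E.H) + 1) * (E.rebalanceTime + 2400 * (E.H * E.levels) + 10) +
    2200 * (E.H * E.levels)

theorem runs_insert {m : Mem} (h : E.Stable m) (hb : E.IsBatch m)
    (hnew : ∀ i < E.k, ∀ u v, Joins m i u v → ¬ E.Adj m u v) :
    E.Runs insertProg m E.insertTime fun m' => E.Stable m' ∧
      ∀ u < E.n, ∀ v < E.n, (E.Adj m' u v ↔ E.Adj m u v ∨ ∃ i < E.k, Joins m i u v) := by
  have hL : 1 ≤ E.H * E.levels := Nat.mul_pos E.one_le_H E.one_le_levels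
  have hk := E.one_le_k
  unfold insertProg insertTime
  set S := 2 * (E.H * E.H + 2 * E.H) + 1 with hS
  set D := E.rebalanceTime + 2400 * (E.H * E.levels) with hD
  refine Runs.then (D := 10) (D' := S * (D + 10) + 2190 * (E.H * E.levels)) (by omega)
    (Runs.set h.inv.ok rfl (by decide) (fun i hi => h.inv.ok.lt_of_grade hi rfl)
    fun m₁ ok₁ f₁ v₁ => ?_)
  refine Runs.then (D := 10) (D' := S * (D + 10) + 2180 * (E.H * E.levels)) (by omega)
    (Runs.set ok₁ rfl (by decide) (fun i hi => ok₁.lt_of_grade hi rfl) fun m₂ ok₂ f₂ v₂ => ?_)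
  refine Runs.then (D := 20) (D' := S * (D + 10) + 2160 * (E.H * E.levels)) (by omega)
    (Runs.setSca ok₂ rfl (by decide) (ok₂.lt_of_grade (by omega) rfl) fun m₃ ok₃ f₃ v₃ => ?_)
  simp only [Expr.nat, Op.nat, ok₂.H, ← hS] at v₃
  have f : ∀ a, a ∉ [10, 22, 47] → m₃ a = m a := fun a ha => by
    simp only [List.mem_cons, List.not_mem_nil, or_false, not_or] at ha
    rw [f₃ a (by tauto), f₂ a (by tauto), f₁ a (by tauto)]
  have e22 : ∀ i < E.k, m₃ 22 i = 0 := fun i hi => by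
    rw [f₃ 22 (by decide), f₂ 22 (by decide), v₁ i hi]; rfl
  have start : E.Inserting m 0 m₃ := by
    refine ⟨h.of_frame ok₃ (f 3 (by decide)) (f 4 (by decide)) (f 5 (by decide)) (f 6 (by decide)),
      fun i hi => ?_, f 1 (by decide), f 2 (by decide), fun u hu v hv => ?_,
      fun i hi _ => .inr (Nat.zero_le _)⟩
    · rw [f₃ 10 (by decide), v₂ i hi]; simp only [Expr.nat]
      rw [f₁ 1 (by decide)]; exact (hb.lt i hi).1
    · rw [Adj, cls, cls, f 3 (by decide)]
      refine ⟨.inl, fun h' => h'.resolve_right ?_⟩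
      rintro ⟨i, hi, hg, _⟩
      exact hg (e22 i hi)
  refine Runs.then (D := S * (D + 10) + 2) (D' := 2100 * (E.H * E.levels)) (by omega)
    ((Runs.countdown (r := 47) (D := D) (by decide)
      (I := fun q m' => ∃ s, q + s = S ∧ E.Inserting m s m' ∧ m' 47 0 = q)
      (fun q m' h' => ?_) (fun q m' h' => ?_) (fun q m₄ m₅ h₄ ok₅ f₅ v₅ => ?_) S m₃
      ⟨0, rfl, start, v₃⟩).mono le_rfl fun m' h' => ?_)
  · obtain ⟨_, -, h', -⟩ := h'; exact h'.stable.inv.ok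
  · obtain ⟨_, -, -, h'⟩ := h'; exact h'
  · obtain ⟨s, hs, h₄, -⟩ := h₄
    refine (runs_insertStep hb hnew (h₄.of_frame ok₅ fun a ha => f₅ a ?_)).mono le_rfl
      fun m₆ h₆ => ⟨s + 1, by omega, h₆.1, by rw [h₆.2, v₅]⟩
    rintro rfl
    exact absurd ha (by decide)
  · obtain ⟨s, hs, h', -⟩ := h'
    obtain rfl : s = S := by omega
    exact runs_insertRest hb hnew h'

end Env

/-! ### Deletion of a batch -/

/-- The edges of the batch are removed from the orientation, but their slots remain in use. The tail
and the slot of every removed edge are stored in the registers `23` and `24`. -/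
def unlink : Prog :=
  .seq (set 12 (reg 1)) <| .seq (set 11 (reg 2)) <|
  .seq (setIf (eEq (.load 3 (eAdd (eMul (reg 1) eN) (reg 2))) (.const 0)) 12 (reg 2)) <|
  .seq (setIf (eEq (.load 3 (eAdd (eMul (reg 1) eN) (reg 2))) (.const 0)) 11 (reg 1)) <|
  .seq (set 14 (eSub (.load 3 (eAdd (eMul (reg 12) eN) (reg 11))) (.const 1))) <|
  .seq (set 13 (reg 11)) <| .seq (set 15 (.const 1)) <| .seq (set 23 (reg 12)) <|
  .seq (set 24 (reg 14)) <|
  .seq (put (reg 15) 3 (eAdd (eMul (reg 12) eN) (reg 11)) (.const 0)) refresh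

/-- The removed edges whose slot is given by the scalar `32` leave this slot. -/
def deleteStep : Prog :=
  .seq (set 11 (reg 23)) <| .seq (set 12 (reg 23)) <| .seq (set 14 (sca 32)) <|
  .seq (set 15 (eEq (reg 24) (sca 32))) <| .seq fixSlot <| .seq refresh <|
  .seq (set 10 (reg 23)) (rebalance passLow)

/-- The deletion of a batch. -/
def deleteProg : Prog :=
  .seq unlink <| .seq (setSca 32 eH) <| countdown 32 deleteStep

namespace Env

variable {E : Env}

/-- The state during a deletion from `m₀`, when the slots from `j` on have been treated: the edges
of the batch have been removed, but those that were stored in slots below `j` still occupy them. -/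
structure Deleting (E : Env) (m₀ : Mem) (j : ℕ) (m : Mem) : Prop where
  inv : E.Inv m
  balanced : E.Balanced m
  le : j ≤ E.H
  tail : ∀ i < E.k, m 23 i < E.n
  phantom : ∀ u < E.n, ∀ s < E.H, (E.Phantom m u s ↔ s < j ∧ ∃ i < E.k, m 23 i = u ∧ m 24 i = s)
  adj : ∀ u < E.n, ∀ v < E.n, (E.Adj m u v ↔ E.Adj m₀ u v ∧ ¬ ∃ i < E.k, Joins m₀ i u v)

theorem Deleting.of_frame {m₀ m m' : Mem} {j : ℕ} (h : E.Deleting m₀ j m) (ok : E.Ok m')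
    (hf : ∀ a, a ∈ [3, 4, 5, 6, 23, 24] → m' a = m a) : E.Deleting m₀ j m' := by
  obtain ⟨a1, a2, a3, a4, a5, a6⟩ := h
  have h3 := hf 3 (by decide)
  have h4 := hf 4 (by decide)
  have h5 := hf 5 (by decide)
  refine ⟨a1.of_frame ok h3 h4 h5 (hf 6 (by decide)), ?_, a3, ?_, ?_, ?_⟩
  · simpa only [Balanced, cls, deg, h3, h5]
  · rwa [hf 23 (by decide)]
  · simpa only [Phantom, cls, out, h3, h4, hf 23 (by decide), hf 24 (by decide)]
  · simpa only [Adj, cls, h3]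

theorem runs_unlink {m : Mem} (h : E.Stable m) (hb : E.IsBatch m)
    (hadj : ∀ i < E.k, E.Adj m (m 1 i) (m 2 i)) :
    E.Runs unlink m (2150 * (E.H * E.levels)) (E.Deleting m E.H) := by
  have hL : 1 ≤ E.H * E.levels := Nat.mul_pos E.one_le_H E.one_le_levels
  have hn := E.two_le_n
  have hQ := E.Q_ge
  have inv := h.inv
  have ok := inv.ok
  unfold unlink
  refine Runs.then (D := 10) (D' := 2140 * (E.H * E.levels)) (by omega) (Runs.set ok rfl
    (by decide) (fun i hi => ok.lt_of_grade hi rfl) fun m₁ ok₁ f₁ v₁ => ?_)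
  refine Runs.then (D := 10) (D' := 2130 * (E.H * E.levels)) (by omega) (Runs.set ok₁ rfl
    (by decide) (fun i hi => ok₁.lt_of_grade hi rfl) fun m₂ ok₂ f₂ v₂ => ?_)
  refine Runs.then (D := 20) (D' := 2110 * (E.H * E.levels)) (by omega) (Runs.setIf ok₂ rfl
    (by decide) (fun i hi _ => ok₂.lt_of_grade hi rfl) fun m₃ ok₃ f₃ v₃ => ?_)
  refine Runs.then (D := 20) (D' := 2090 * (E.H * E.levels)) (by omega) (Runs.setIf ok₃ rfl
    (by decide) (fun i hi _ => ok₃.lt_of_grade hi rfl) fun m₄ ok₄ f₄ v₄ => ?_)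
  have g₄ : ∀ a, a ∉ [11, 12] → m₄ a = m a := fun a ha => by
    simp only [List.mem_cons, List.not_mem_nil, or_false, not_or] at ha
    rw [f₄ a ha.1, f₃ a ha.2, f₂ a ha.1, f₁ a ha.2]
  -- the edge, with its direction
  have ends : ∀ i < E.k, Joins m i (m₄ 12 i) (m₄ 11 i) ∧ E.cls m (m₄ 12 i) (m₄ 11 i) ≠ 0 := by
    intro i hi
    have c₂ : (eEq (.load 3 (eAdd (eMul (reg 1) eN) (reg 2))) (.const 0)).nat m₂ i ≠ 0 ↔
        E.cls m (m 1 i) (m 2 i) = 0 := by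
      rw [Expr.nat_eq_ne_zero]; simp only [Expr.nat, Op.nat, ok₂.n]
      rw [f₂ 3 (by decide), f₁ 3 (by decide), f₂ 2 (by decide), f₁ 2 (by decide),
        f₂ 1 (by decide), f₁ 1 (by decide)]
    have c₃ : (eEq (.load 3 (eAdd (eMul (reg 1) eN) (reg 2))) (.const 0)).nat m₃ i ≠ 0 ↔
        E.cls m (m 1 i) (m 2 i) = 0 := by
      rw [← c₂, Expr.nat_eq_ne_zero, Expr.nat_eq_ne_zero]; simp only [Expr.nat, Op.nat, ok₂.n, ok₃.n]
      rw [f₃ 3 (by decide), f₃ 2 (by decide), f₃ 1 (by decide)]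
    have e1 : m₂ 12 i = m 1 i := by rw [f₂ 12 (by decide), v₁ i hi]; rfl
    have e2 : m₃ 11 i = m 2 i := by
      rw [f₃ 11 (by decide), v₂ i hi]; simp only [Expr.nat]; rw [f₁ 2 (by decide)]
    have e3 : (reg 2).nat m₂ i = m 2 i := by
      simp only [Expr.nat]; rw [f₂ 2 (by decide), f₁ 2 (by decide)]
    have e4 : (reg 1).nat m₃ i = m 1 i := by
      simp only [Expr.nat]; rw [f₃ 1 (by decide), f₂ 1 (by decide), f₁ 1 (by decide)]
    rw [f₄ 12 (by decide), v₃ i hi, v₄ i hi, e1, e2, e3, e4]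
    by_cases hc : E.cls m (m 1 i) (m 2 i) = 0
    · rw [if_pos (c₂.2 hc), if_pos (c₃.2 hc)]
      exact ⟨.inr ⟨rfl, rfl⟩, (hadj i hi).resolve_left fun h' => h' hc⟩
    · rw [if_neg (mt c₂.1 hc), if_neg (mt c₃.1 hc)]
      exact ⟨.inl ⟨rfl, rfl⟩, hc⟩
  refine Runs.then (D := 20) (D' := 2070 * (E.H * E.levels)) (by omega) (Runs.set ok₄ rfl
    (by decide) (fun i hi => ok₄.lt_of_grade hi rfl) fun m₅ ok₅ f₅ v₅ => ?_)
  refine Runs.then (D := 10) (D' := 2060 * (E.H * E.levels)) (by omega) (Runs.set ok₅ rfl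
    (by decide) (fun i hi => ok₅.lt_of_grade hi rfl) fun m₆ ok₆ f₆ v₆ => ?_)
  refine Runs.then (D := 10) (D' := 2050 * (E.H * E.levels)) (by omega) (Runs.set ok₆ rfl
    (by decide) (fun i hi => ok₆.lt_of_grade hi rfl) fun m₇ ok₇ f₇ v₇ => ?_)
  refine Runs.then (D := 10) (D' := 2040 * (E.H * E.levels)) (by omega) (Runs.set ok₇ rfl
    (by decide) (fun i hi => ok₇.lt_of_grade hi rfl) fun m₈ ok₈ f₈ v₈ => ?_)
  refine Runs.then (D := 10) (D' := 2030 * (E.H * E.levels)) (by omega) (Runs.set ok₈ rfl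
    (by decide) (fun i hi => ok₈.lt_of_grade hi rfl) fun m₉ ok₉ f₉ v₉ => ?_)
  have g₉ : ∀ a, a ∉ [11, 12, 13, 14, 15, 23, 24] → m₉ a = m a := fun a ha => by
    simp only [List.mem_cons, List.not_mem_nil, or_false, not_or] at ha
    rw [f₉ a (by tauto), f₈ a (by tauto), f₇ a (by tauto), f₆ a (by tauto), f₅ a (by tauto),
      g₄ a (by simp; tauto)]
  set X := m₄ 12 with hX
  set V := m₄ 11 with hV
  set J : ℕ → ℕ := fun i => E.cls m (X i) (V i) - 1 with hJ
  have r12 : m₉ 12 = X := by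
    rw [f₉ 12 (by decide), f₈ 12 (by decide), f₇ 12 (by decide), f₆ 12 (by decide),
      f₅ 12 (by decide)]
  have r11 : m₉ 11 = V := by
    rw [f₉ 11 (by decide), f₈ 11 (by decide), f₇ 11 (by decide), f₆ 11 (by decide),
      f₅ 11 (by decide)]
  have r14' : ∀ i < E.k, m₅ 14 i = J i := fun i hi => by
    rw [v₅ i hi]; simp only [Expr.nat, Op.nat, ok₄.n]
    rw [g₄ 3 (by decide)]
  have r14 : ∀ i < E.k, m₉ 14 i = J i := fun i hi => by
    rw [f₉ 14 (by decide), f₈ 14 (by decide), f₇ 14 (by decide), f₆ 14 (by decide), r14' i hi]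
  have r13 : ∀ i < E.k, m₉ 13 i = V i := fun i hi => by
    rw [f₉ 13 (by decide), f₈ 13 (by decide), f₇ 13 (by decide), v₆ i hi]
    simp only [Expr.nat]; rw [f₅ 11 (by decide)]
  have r15 : ∀ i < E.k, m₉ 15 i ≠ 0 := fun i hi => by
    rw [f₉ 15 (by decide), f₈ 15 (by decide), v₇ i hi]; simp [Expr.nat]
  have r23 : ∀ i < E.k, m₉ 23 i = X i := fun i hi => by
    rw [f₉ 23 (by decide), v₈ i hi]; simp only [Expr.nat]
    rw [f₇ 12 (by decide), f₆ 12 (by decide), f₅ 12 (by decide)]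
  have r24 : ∀ i < E.k, m₉ 24 i = J i := fun i hi => by
    rw [v₉ i hi]; simp only [Expr.nat]
    rw [f₈ 14 (by decide), f₇ 14 (by decide), f₆ 14 (by decide), r14' i hi]
  have lt : ∀ i < E.k, X i < E.n ∧ V i < E.n ∧ X i ≠ V i := fun i hi =>
    hb.joins_lt hi (ends i hi).1
  have hJX : ∀ i < E.k, E.cls m (X i) (V i) = J i + 1 := fun i hi => by
    have := (ends i hi).2
    simp only [hJ]; omega
  refine Runs.then (D := 20) (D' := 2000 * (E.H * E.levels)) (by omega) (Runs.put ok₉ rfl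
    (by decide) (fun i hi _ => ?_) fun f hf ok₁₀ => ?_)
  · simp only [Expr.nat]; exact Nat.pow_pos (by omega)
  have hw := hf.matrix (b := E.n) (A := m₉ 12) (B := m₉ 11) fun i hi hg => by
    simp only [Expr.nat, Op.nat, ok₉.n]
    exact ⟨trivial, by rw [r11]; exact (lt i hi).2.1⟩
  have e₁ : ∀ a ≠ 3, Function.update m₉ 3 f a = m₉ a := fun a ha => Function.update_of_ne ha _ _
  have e₁' : Function.update m₉ 3 f 3 = f := Function.update_self _ _ _
  generalize Function.update m₉ 3 f = m₁₀ at ok₁₀ e₁ e₁'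
  have cP : ∀ i < E.k, E.cls m₁₀ (X i) (V i) = 0 := by
    intro i hi
    rw [cls, e₁']
    rcases hw (X i) (V i) (lt i hi).2.1 with ⟨i', hi', hg', hA, hB, e⟩ | ⟨hno, _⟩
    · rw [e]; rfl
    · exact absurd ⟨by rw [r12], by rw [r11]⟩ (hno i hi (r15 i hi))
  have cO : ∀ u v, v < E.n → (¬ ∃ i < E.k, X i = u ∧ V i = v) → E.cls m₁₀ u v = E.cls m u v := by
    intro u v hv hno
    rw [cls, e₁']
    rcases hw u v hv with ⟨i, hi, hg, hA, hB, _⟩ | ⟨_, e⟩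
    · exact absurd ⟨i, hi, by rw [← hA, r12], by rw [← hB, r11]⟩ hno
    · rw [e, g₉ 3 (by decide)]
  have o₁ : ∀ u s, E.out m₁₀ u s = E.out m u s := fun u s => by
    rw [out, e₁ 4 (by decide), g₉ 4 (by decide)]
  have d₁ : ∀ u, deg m₁₀ u = deg m u := fun u => by rw [deg, e₁ 5 (by decide), g₉ 5 (by decide)]
  have ne : ∀ u v, v < E.n → E.cls m₁₀ u v ≠ 0 → E.cls m₁₀ u v = E.cls m u v ∧
      ¬ ∃ i < E.k, X i = u ∧ V i = v := by
    intro u v hv h0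
    have : ¬ ∃ i < E.k, X i = u ∧ V i = v := by
      rintro ⟨i, hi, rfl, rfl⟩; exact h0 (cP i hi)
    exact ⟨cO u v hv this, this⟩
  have w₁ : E.Wf m₁₀ := by
    refine ⟨fun u hu v hv => ?_, fun u hu v hv hc => ?_, fun u hu s hs => ?_,
      fun u hu v hv s hs hc => ?_, fun u hu => ?_, fun u hu v hv hc => ?_⟩
    · by_cases h0 : E.cls m₁₀ u v = 0
      · omega
      · rw [(ne u v hv h0).1]; exact inv.wf.cls_le u hu v hv
    · have := inv.wf.asymm u hu v hv ((ne u v hv hc).1 ▸ hc)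
      by_contra h0
      exact h0 ((ne v u hu h0).1.trans this)
    · rw [o₁]; exact inv.wf.out_le u hu s hs
    · rw [o₁]; exact inv.wf.slot u hu v hv s hs ((ne u v hv (by omega)).1 ▸ hc)
    · rw [d₁, inv.wf.deg_eq u hu]; simp only [o₁]
    · rw [d₁]; exact inv.wf.surplus u hu v hv ((ne u v hv (by omega)).1 ▸ hc)
  have h6 : m₁₀ 6 = m 6 := (e₁ 6 (by decide)).trans (g₉ 6 (by decide))
  have t₁ : E.TreeOk m₁₀ := fun t z h1 h2 => by
    simp only [tree, h6]; exact inv.treeOk t z h1 h2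
  have q15 : m₁₀ 15 = m₉ 15 := e₁ 15 (by decide)
  have q14 : ∀ i < E.k, m₁₀ 14 i = J i := fun i hi => by rw [e₁ 14 (by decide), r14 i hi]
  have q13 : ∀ i < E.k, m₁₀ 13 i = V i := fun i hi => by rw [e₁ 13 (by decide), r13 i hi]
  have q12 : m₁₀ 12 = X := by rw [e₁ 12 (by decide), r12]
  have q11 : m₁₀ 11 = V := by rw [e₁ 11 (by decide), r11]
  refine (runs_refresh ok₁₀ t₁ (fun i hi _ => ?_) w₁.out_le).mono le_rfl fun m' rf => ?_
  · rw [q11, q12, q13 i hi, q14 i hi]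
    have := inv.wf.cls_le _ (lt i hi).1 _ (lt i hi).2.1
    have := hJX i hi
    exact ⟨(lt i hi).2.1, (lt i hi).1, (lt i hi).2.1, by omega⟩
  have s3 : ∀ u v, E.cls m' u v = E.cls m₁₀ u v := fun u v => by rw [cls, rf.frame 3 (by decide)]
  have s4 : ∀ u v, E.out m' u v = E.out m₁₀ u v := fun u v => by rw [out, rf.frame 4 (by decide)]
  have s5 : ∀ u, deg m' u = deg m₁₀ u := fun u => by rw [deg, rf.frame 5 (by decide)]
  have s23 : ∀ i < E.k, m' 23 i = X i := fun i hi => by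
    rw [rf.frame 23 (by decide), e₁ 23 (by decide), r23 i hi]
  have s24 : ∀ i < E.k, m' 24 i = J i := fun i hi => by
    rw [rf.frame 24 (by decide), e₁ 24 (by decide), r24 i hi]
  refine ⟨inv.of_refreshed w₁ h6 rf (act := fun u => ∃ i < E.k, X i = u) ?_ ?_ ?_,
    fun u hu v hv hc => ?_, le_rfl, fun i hi => ?_, fun u hu s hs => ?_, fun u hu v hv => ?_⟩
  · rintro u hu ⟨i, hi, h1⟩ s hs v ho
    exact ⟨i, hi, by rw [q15]; exact r15 i hi,
      .inr (.inr (.inr (.inr ⟨.inl (by rw [q12, h1]), hs, ho⟩)))⟩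
  · exact fun u hu hne => absurd (d₁ u) hne
  · intro u hu v hv hne
    obtain ⟨i, hi, hu', hv'⟩ : ∃ i < E.k, X i = u ∧ V i = v := by
      by_contra hno; exact hne (cO u v hv hno)
    have h1 := hJX i hi
    have h2 := cP i hi
    rw [hu', hv'] at h1 h2
    refine ⟨⟨i, hi, hu'⟩, fun s hs h3 => ⟨i, hi, by rw [q15]; exact r15 i hi, .inl
      ⟨by rw [q11, hv'], by rw [q14 i hi]; omega, by rw [q12, hu']⟩⟩, fun h3 =>
      ⟨⟨i, hi, by rw [q15]; exact r15 i hi, .inl ⟨by rw [q11, hv'], by rw [q14 i hi]; omega,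
        by rw [q12, hu']⟩⟩, ⟨i, hi, by rw [q15]; exact r15 i hi, .inr (.inl ⟨by rw [q12, hu'], rfl,
        by rw [q11, hv']⟩)⟩⟩⟩
  · rw [s3] at hc
    rw [s5, s5, d₁, d₁]
    exact h.balanced u hu v hv ((ne u v hv hc).1 ▸ hc)
  · rw [s23 i hi]; exact (lt i hi).1
  · have e : E.Phantom m' u s ↔ E.Phantom m₁₀ u s := by simp only [Phantom, s3, s4]
    rw [e, Phantom, o₁]
    constructor
    · rintro ⟨ho, hno⟩
      obtain ⟨v, hv, hc⟩ : ∃ v < E.n, E.cls m u v = s + 1 := by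
        by_contra! h2; exact h.full u hu s hs ⟨ho, h2⟩
      obtain ⟨i, hi, rfl, rfl⟩ : ∃ i < E.k, X i = u ∧ V i = v := by
        by_contra h2; exact hno v hv (by rw [cO u v hv h2, hc])
      have := hJX i hi
      exact ⟨hs, i, hi, s23 i hi, by rw [s24 i hi]; omega⟩
    · rintro ⟨-, i, hi, h1, h2⟩
      rw [s23 i hi] at h1
      rw [s24 i hi] at h2
      have h3 := hJX i hi
      rw [h1, h2] at h3
      have h4 := inv.wf.slot u hu _ (lt i hi).2.1 s hs h3
      refine ⟨by omega, fun v hv hc => ?_⟩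
      obtain ⟨h5, h6⟩ := ne u v hv (by omega)
      exact h6 ⟨i, hi, h1, inv.wf.head_unique hu (lt i hi).2.1 hv hs h3 (h5 ▸ hc)⟩
  · rw [Adj, s3, s3]
    constructor
    · intro hor
      have key : ∀ u v, u < E.n → v < E.n → E.cls m₁₀ u v ≠ 0 →
          E.cls m u v ≠ 0 ∧ ¬ ∃ i < E.k, Joins m i u v := by
        intro u v hu hv hc
        obtain ⟨h1, h2⟩ := ne u v hv hc
        refine ⟨h1 ▸ hc, ?_⟩
        rintro ⟨i, hi, hj⟩
        obtain ⟨h3, h4⟩ := ends i hi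
        have h5 : (X i = u ∧ V i = v) ∨ (X i = v ∧ V i = u) := by
          unfold Joins at hj h3; omega
        rcases h5 with h5 | ⟨h5, h6⟩
        · exact h2 ⟨i, hi, h5⟩
        · have h7 := inv.wf.asymm u hu v hv (h1 ▸ hc)
          rw [h5, h6] at h4
          exact h4 h7
      rcases hor with hc | hc
      · obtain ⟨h1, h2⟩ := key u v hu hv hc
        exact ⟨.inl h1, h2⟩
      · obtain ⟨h1, h2⟩ := key v u hv hu hc
        exact ⟨.inr h1, fun ⟨i, hi, hj⟩ => h2 ⟨i, hi, hj.symm⟩⟩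
    · rintro ⟨hor, hno⟩
      have key : ∀ u v, (∃ i < E.k, X i = u ∧ V i = v) → ∃ i < E.k, Joins m i u v := by
        rintro u v ⟨i, hi, rfl, rfl⟩
        exact ⟨i, hi, (ends i hi).1⟩
      rcases hor with hc | hc
      · left
        rw [cO u v hv fun h' => hno (key u v h')]; exact hc
      · right
        rw [cO v u hu fun h' => ?_]
        · exact hc
        · obtain ⟨i, hi, hj⟩ := key v u h'
          exact hno ⟨i, hi, hj.symm⟩

theorem runs_deleteStep {m₀ m : Mem} {j : ℕ} (h : E.Deleting m₀ (j + 1) m) (h32 : m 32 0 = j) :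
    E.Runs deleteStep m (E.rebalanceTime + 2300 * (E.H * E.levels)) fun m' =>
      E.Deleting m₀ j m' ∧ m' 32 = m 32 := by
  have hL : 1 ≤ E.H * E.levels := Nat.mul_pos E.one_le_H E.one_le_levels
  have hn := E.two_le_n
  have hj := h.le
  have ok := h.inv.ok
  unfold deleteStep
  refine Runs.then (D := 10) (D' := E.rebalanceTime + 2290 * (E.H * E.levels)) (by omega)
    (Runs.set ok rfl (by decide) (fun i hi => ok.lt_of_grade hi rfl) fun m₁ ok₁ f₁ v₁ => ?_)
  refine Runs.then (D := 10) (D' := E.rebalanceTime + 2280 * (E.H * E.levels)) (by omega)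
    (Runs.set ok₁ rfl (by decide) (fun i hi => ok₁.lt_of_grade hi rfl) fun m₂ ok₂ f₂ v₂ => ?_)
  refine Runs.then (D := 10) (D' := E.rebalanceTime + 2270 * (E.H * E.levels)) (by omega)
    (Runs.set ok₂ rfl (by decide) (fun i hi => ok₂.lt_of_grade hi rfl) fun m₃ ok₃ f₃ v₃ => ?_)
  refine Runs.then (D := 10) (D' := E.rebalanceTime + 2260 * (E.H * E.levels)) (by omega)
    (Runs.set ok₃ rfl (by decide) (fun i hi => ok₃.lt_of_grade hi rfl) fun m₄ ok₄ f₄ v₄ => ?_)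
  have g₄ : ∀ a, a ∉ [11, 12, 14, 15] → m₄ a = m a := fun a ha => by
    simp only [List.mem_cons, List.not_mem_nil, or_false, not_or] at ha
    rw [f₄ a (by tauto), f₃ a (by tauto), f₂ a (by tauto), f₁ a (by tauto)]
  have h₄ : E.Deleting m₀ (j + 1) m₄ := h.of_frame ok₄ fun a ha => g₄ a fun h' =>
    (by decide : ∀ a ∈ [3, 4, 5, 6, 23, 24], a ∉ [11, 12, 14, 15]) a ha h'
  have r11 : ∀ i < E.k, m₄ 11 i = m 23 i := fun i hi => by
    rw [f₄ 11 (by decide), f₃ 11 (by decide), f₂ 11 (by decide), v₁ i hi]; rfl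
  have r12 : ∀ i < E.k, m₄ 12 i = m 23 i := fun i hi => by
    rw [f₄ 12 (by decide), f₃ 12 (by decide), v₂ i hi]; simp only [Expr.nat]
    rw [f₁ 23 (by decide)]
  have r14 : ∀ i < E.k, m₄ 14 i = j := fun i hi => by
    rw [f₄ 14 (by decide), v₃ i hi]; simp only [Expr.nat]
    rw [f₂ 32 (by decide), f₁ 32 (by decide), h32]
  have r15 : ∀ i < E.k, (m₄ 15 i ≠ 0 ↔ m 24 i = j) := fun i hi => by
    rw [v₄ i hi, Expr.nat_eq_ne_zero]; simp only [Expr.nat]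
    rw [f₃ 24 (by decide), f₂ 24 (by decide), f₁ 24 (by decide), f₃ 32 (by decide),
      f₂ 32 (by decide), f₁ 32 (by decide), h32]
  have e23 : m₄ 23 = m 23 := g₄ 23 (by decide)
  have e24 : m₄ 24 = m 24 := g₄ 24 (by decide)
  have fixReq : ∀ u s, E.FixReq m₄ u s ↔ s = j ∧ ∃ i < E.k, m 23 i = u ∧ m 24 i = j := by
    intro u s
    constructor
    · rintro ⟨i, hi, hg, h1, h2, h3⟩
      exact ⟨by rw [← h3, r14 i hi], i, hi, by rw [← h2, r12 i hi], (r15 i hi).1 hg⟩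
    · rintro ⟨rfl, i, hi, h1, h2⟩
      exact ⟨i, hi, (r15 i hi).2 h2, by rw [r14 i hi]; omega, by rw [r12 i hi, h1], r14 i hi⟩
  have lt : ∀ u s, E.FixReq m₄ u s → u < E.n := by
    intro u s hs
    obtain ⟨-, i, hi, rfl, -⟩ := (fixReq u s).1 hs
    exact h.tail i hi
  have fp : E.FixPre m₄ := by
    refine ⟨fun u s s' h1 h2 => ?_, fun u s hs => ?_, fun u s hs => ⟨lt u s hs, ?_⟩⟩
    · rw [((fixReq u s).1 h1).1, ((fixReq u s').1 h2).1]
    · exact top_spec h₄.inv.treeOk fun x hx => h₄.inv.good u (lt u s hs) (E.H + 1) le_rfl x hx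
    · rw [h₄.phantom u (lt u s hs) s hs.lt, e23, e24]
      obtain ⟨rfl, hi⟩ := (fixReq u s).1 hs
      exact ⟨by omega, hi⟩
  refine Runs.then (D := 200) (D' := E.rebalanceTime + 2060 * (E.H * E.levels)) (by omega)
    ((runs_fixSlot ok₄ fp.unique).mono le_rfl fun m₅ fx => ?_)
  have w₅ := fx.wf fp h₄.inv.wf
  have h6 : m₅ 6 = m₄ 6 := fx.frame 6 (by decide)
  have t₅ : E.TreeOk m₅ := fun t z h1 h2 => by
    simp only [tree, h6]; exact h₄.inv.treeOk t z h1 h2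
  have s15 : m₅ 15 = m₄ 15 := fx.frame 15 (by decide)
  have s14 : m₅ 14 = m₄ 14 := fx.frame 14 (by decide)
  have s12 : m₅ 12 = m₄ 12 := fx.frame 12 (by decide)
  have s11 : m₅ 11 = m₄ 11 := fx.frame 11 (by decide)
  refine Runs.then (D := 2000 * (E.H * E.levels)) (D' := E.rebalanceTime + 60 * (E.H * E.levels))
    (by omega) ((runs_refresh fx.ok t₅ (fun i hi _ => ?_) w₅.out_le).mono le_rfl fun m₆ rf => ?_)
  · rw [s11, s12, s14, r11 i hi, r12 i hi, r14 i hi, fx.head i hi]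
    exact ⟨h.tail i hi, h.tail i hi, Nat.mod_lt _ (by omega), by omega⟩
  have i₆ : E.Inv m₆ := by
    refine h₄.inv.of_refreshed w₅ h6 rf (act := fun u => E.FixReq m₄ u j) ?_ ?_ ?_
    · rintro u hu ⟨i, hi, hg, _, h1, _⟩ s hs v ho
      exact ⟨i, hi, by rwa [s15], .inr (.inr (.inr (.inr ⟨.inl (by rw [s12, h1]), hs, ho⟩)))⟩
    · intro u hu hne
      by_contra hno
      exact hne (fx.deg_old u (.inl fun s hs => hno (((fixReq u s).1 hs).1 ▸ hs)))
    · intro u hu v hv hne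
      obtain ⟨s, hs, _, h2, h3, h4⟩ := fx.cls_change fp hv hne
      obtain rfl := ((fixReq u s).1 hs).1
      have hs' := hs
      obtain ⟨i, hi, hg, _, h5, _⟩ := hs
      have h13 : m₅ 13 i = v := by rw [fx.head i hi, h5, h2]
      exact ⟨hs', fun s' _ _ => by omega, fun _ => ⟨⟨i, hi, by rwa [s15],
        .inr (.inr (.inl ⟨h13.symm, rfl, by rw [s12, h5]⟩))⟩, ⟨i, hi, by rwa [s15],
        .inr (.inr (.inr (.inl ⟨by rw [s12, h5], rfl, h13.symm⟩)))⟩⟩⟩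
  refine Runs.then (D := 10) (D' := E.rebalanceTime) (by omega) (Runs.set rf.ok rfl
    (by decide) (fun i hi => rf.ok.lt_of_grade hi rfl) fun m₇ ok₇ f₇ v₇ => ?_)
  have c₇ : ∀ u v, E.cls m₇ u v = E.cls m₅ u v := fun u v => by
    rw [cls, f₇ 3 (by decide), rf.frame 3 (by decide)]
  have o₇ : ∀ u s, E.out m₇ u s = E.out m₅ u s := fun u v => by
    rw [out, f₇ 4 (by decide), rf.frame 4 (by decide)]
  have d₇ : ∀ u, deg m₇ u = deg m₅ u := fun u => by
    rw [deg, f₇ 5 (by decide), rf.frame 5 (by decide)]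
  have e₇ : ∀ a, a ∉ [3, 4, 5, 13, 27, 44] → a ∉ refreshArrs → a ≠ 10 → m₇ a = m₄ a :=
    fun a b1 b2 b3 => by rw [f₇ a b3, rf.frame a b2, fx.frame a b1]
  have l₇ : ∀ i < E.k, m₇ 10 i = m 23 i := fun i hi => by
    rw [v₇ i hi]; simp only [Expr.nat]
    rw [rf.frame 23 (by decide), fx.frame 23 (by decide), e23]
  -- each vertex loses at most this one slot, hence at most one unit of degree
  have dd : ∀ u < E.n, deg m₅ u ≤ deg m₄ u ∧ deg m₄ u ≤ deg m₅ u + 1 ∧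
      (deg m₅ u < deg m₄ u → E.FixReq m₄ u j) := by
    intro u hu
    by_cases hr : E.FixReq m₄ u j
    · by_cases hs : E.HasSurplus m₄ u
      · rw [fx.deg_of_surplus fp hs]
        exact ⟨le_rfl, by omega, fun _ => hr⟩
      · rw [fx.deg_of_not_surplus fp hr hs]
        exact ⟨by omega, by omega, fun _ => hr⟩
    · rw [fx.deg_old u (.inl fun s hs => hr (((fixReq u s).1 hs).1 ▸ hs))]
      exact ⟨le_rfl, by omega, fun h' => absurd h' (lt_irrefl _)⟩
  -- the vertices that have lost a slot hold the tokens; their processors know them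
  have low : E.Low (deg m₄) m₇ := by
    refine ⟨i₆.of_frame ok₇ (f₇ 3 (by decide)) (f₇ 4 (by decide)) (f₇ 5 (by decide))
      (f₇ 6 (by decide)), fun u hu => h₄.inv.wf.deg_le hu, fun u hu => ?_, fun u hu => ?_,
      fun u hu v hv hc => ?_, fun i hi => ?_, fun u hu hd => ?_⟩
    · rw [d₇]; exact (dd u hu).1
    · rw [d₇]; exact (dd u hu).2.1
    · rw [c₇] at hc
      exact h₄.balanced u hu v hv ((fx.cls_ne_zero fp hv).1 hc)
    · rw [l₇ i hi]; exact h.tail i hi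
    · rw [d₇] at hd
      obtain ⟨-, i, hi, h1, -⟩ := (fixReq u j).1 ((dd u hu).2.2 hd)
      exact ⟨i, hi, by rw [l₇ i hi, h1]⟩
  refine (runs_rebalanceLow low).mono le_rfl fun m₈ h₈ => ?_
  obtain ⟨low₈, sm, bal⟩ := h₈
  have e₈ : ∀ a, a ∉ [10, 11, 28, 29, 30, 46] → a ∉ moveArrs → a ∉ [3, 4, 5, 13, 27, 44] →
      a ∉ refreshArrs → a ∉ [11, 12, 14, 15] → a ≠ 10 → m₈ a = m a :=
    fun a b1 b2 b3 b4 b5 b6 => by rw [sm.frame a b1 b2, e₇ a b3 b4 b6, g₄ a b5]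
  have e23' : m₈ 23 = m 23 :=
    e₈ 23 (by decide) (by decide) (by decide) (by decide) (by decide) (by decide)
  have e24' : m₈ 24 = m 24 :=
    e₈ 24 (by decide) (by decide) (by decide) (by decide) (by decide) (by decide)
  refine ⟨⟨low₈.inv, bal, by omega, by rw [e23']; exact h.tail, fun u hu s hs => ?_,
    fun u hu v hv => ?_⟩,
    e₈ 32 (by decide) (by decide) (by decide) (by decide) (by decide) (by decide)⟩
  · have e : E.Phantom m₇ u s ↔ E.Phantom m₅ u s := by simp only [Phantom, c₇, o₇]
    rw [sm.phantom u hu s hs, e, fx.phantom_iff fp hs, h₄.phantom u hu s hs, fixReq, e23, e24,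
      e23', e24']
    constructor
    · rintro ⟨⟨h1, h2⟩, h3⟩
      have : s ≠ j := by rintro rfl; exact h3 ⟨rfl, h2⟩
      exact ⟨by omega, h2⟩
    · rintro ⟨h1, h2⟩
      exact ⟨⟨by omega, h2⟩, fun h3 => by omega⟩
  · rw [← h₄.adj u hu v hv]
    refine (sm.edge u hu v hv).trans ?_
    rw [c₇, c₇, fx.cls_ne_zero fp hv, fx.cls_ne_zero fp hu]

/-- A bound on the running time of a deletion. -/
def deleteTime (E : Env) : ℕ :=
  E.H * (E.rebalanceTime + 2300 * (E.H * E.levels) + 10) + 2200 * (E.H * E.levels)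

theorem runs_delete {m : Mem} (h : E.Stable m) (hb : E.IsBatch m)
    (hadj : ∀ i < E.k, E.Adj m (m 1 i) (m 2 i)) :
    E.Runs deleteProg m E.deleteTime fun m' => E.Stable m' ∧
      ∀ u < E.n, ∀ v < E.n, (E.Adj m' u v ↔ E.Adj m u v ∧ ¬ ∃ i < E.k, Joins m i u v) := by
  have hL : 1 ≤ E.H * E.levels := Nat.mul_pos E.one_le_H E.one_le_levels
  unfold deleteProg deleteTime
  set D := E.rebalanceTime + 2300 * (E.H * E.levels) with hD
  refine Runs.then (D := 2150 * (E.H * E.levels)) (D' := E.H * (D + 10) + 50 * (E.H * E.levels))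
    (by omega) ((runs_unlink h hb hadj).mono le_rfl fun m₁ h₁ => ?_)
  refine Runs.then (D := 10) (D' := E.H * (D + 10) + 2) (by omega) (Runs.setSca h₁.inv.ok rfl
    (by decide) (h₁.inv.ok.lt_of_grade E.one_le_k rfl) fun m₂ ok₂ f₂ v₂ => ?_)
  simp only [Expr.nat, h₁.inv.ok.H] at v₂
  refine (Runs.countdown (r := 32) (D := D) (by decide)
    (I := fun q m' => E.Deleting m q m' ∧ m' 32 0 = q)
    (fun q m' h' => h'.1.inv.ok) (fun q m' h' => h'.2) (fun q m₃ m₄ h₃ ok₄ f₄ v₄ => ?_) E.H m₂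
    ⟨h₁.of_frame ok₂ fun a ha => f₂ a ?_, v₂⟩).mono le_rfl fun m' h' => ?_
  · refine (runs_deleteStep (h₃.1.of_frame ok₄ fun a ha => f₄ a ?_) v₄).mono le_rfl
      fun m₅ h₅ => ⟨h₅.1, by rw [h₅.2, v₄]⟩
    rintro rfl
    exact absurd ha (by decide)
  · rintro rfl
    exact absurd ha (by decide)
  · exact ⟨⟨h'.1.inv, h'.1.balanced, fun u hu s hs hph =>
      absurd ((h'.1.phantom u hu s hs).1 hph).1 (Nat.not_lt_zero _)⟩, h'.1.adj⟩

end Env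

/-! ### Memories that represent a graph -/

namespace Env

/-- Stability concerns only `n`, `H` and the arrays `3` to `6`, hence survives the arrival of a new
batch. -/
theorem Stable.transfer {E E' : Env} {m m' : Mem} (h : E.Stable m) (hn : E'.n = E.n)
    (hH : E'.H = E.H) (ok : E'.Ok m') (h3 : m' 3 = m 3) (h4 : m' 4 = m 4) (h5 : m' 5 = m 5)
    (h6 : m' 6 = m 6) : E'.Stable m' := by
  obtain ⟨⟨-, ⟨w1, w2, w3, w4, w5, w6⟩, t, g⟩, b, f⟩ := h
  refine ⟨⟨ok, ⟨?_, ?_, ?_, ?_, ?_, ?_⟩, ?_, ?_⟩, ?_, ?_⟩ <;>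
    simpa only [TreeOk, Good, leafVal, Balanced, Phantom, cls, out, deg, tree, tid, h3, h4, h5, h6,
      hn, hH]

theorem stable_of_zero {E : Env} {m : Mem} (ok : E.Ok m) (h : ∀ a, 3 ≤ a → m a = fun _ => 0) :
    E.Stable m := by
  have e1 : ∀ u v, E.cls m u v = 0 := fun u v => by simp [cls, h 3]
  have e2 : ∀ u v, E.out m u v = 0 := fun u v => by simp [out, h 4]
  have e3 : ∀ u, deg m u = 0 := fun u => by simp [deg, h 5]
  have e4 : ∀ t z, E.tree m t z = 0 := fun t z => by simp [tree, h 6]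
  refine ⟨⟨ok, ⟨?_, ?_, ?_, ?_, ?_, ?_⟩, ?_, ?_⟩, ?_, ?_⟩ <;>
    simp [TreeOk, Good, leafVal, Balanced, Phantom, e1, e2, e3, e4]

/-- Between operations, the stored degree of a vertex is its out-degree, truncated at `H`. -/
theorem Stable.min_card_eq_deg {E : Env} {m : Mem} (h : E.Stable m) {u : ℕ} (hu : u < E.n) :
    min ((Finset.range E.n).filter fun v => E.cls m u v ≠ 0).card E.H = deg m u := by
  have wf := h.inv.wf
  have h1 : deg m u ≤ E.H := by
    rw [wf.deg_eq u hu]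
    exact (Finset.card_filter_le _ _).trans (by simp)
  have h2 : deg m u ≤ ((Finset.range E.n).filter fun v => E.cls m u v ≠ 0).card := by
    rw [wf.deg_eq u hu]
    refine (Finset.card_le_card fun s hs => ?_).trans (Finset.card_image_le
      (f := fun v => E.cls m u v - 1))
    obtain ⟨hs1, hs2⟩ := Finset.mem_filter.1 hs
    have h3 := h.full u hu s (Finset.mem_range.1 hs1)
    simp only [Phantom, not_and, not_forall, not_not] at h3
    obtain ⟨v, hv, hc⟩ := h3 hs2
    exact Finset.mem_image.2 ⟨v, Finset.mem_filter.2 ⟨Finset.mem_range.2 hv, by omega⟩, by omega⟩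
  by_cases hs : E.HasSurplus m u
  · obtain ⟨v, hv, hc⟩ := hs
    have := wf.surplus u hu v hv hc
    omega
  · have := wf.card_out_le hu hs
    omega

end Env

end PRAM

namespace BatchDynamic

open PRAM

/-- The memory `m` stores an orientation of `G` together with the auxiliary data. If there is at
most one vertex, then no operation is ever performed, and nothing has to be known about the
auxiliary data. -/
structure Represents {n : ℕ} (H : ℕ) (G : SimpleGraph (Fin n)) (m : Mem) : Prop where
  adj : ∀ u v : Fin n, G.Adj u v ↔ m 3 (u * n + v) ≠ 0 ∨ m 3 (v * n + u) ≠ 0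
  stable : 2 ≤ n → ∃ (E : Env) (m₀ : Mem), E.n = n ∧ E.H = H ∧ E.Stable m₀ ∧
    ∀ a, 3 ≤ a → m a = m₀ a

theorem two_le_of_ne {n : ℕ} {u v : Fin n} (h : u ≠ v) : 2 ≤ n := by
  have := Fin.val_ne_of_ne h
  omega

theorem two_le_of_adj {n : ℕ} {G : SimpleGraph (Fin n)} {u v : Fin n} (h : G.Adj u v) : 2 ≤ n :=
  two_le_of_ne h.ne

theorem Represents.isOrientationOf {n H : ℕ} {G : SimpleGraph (Fin n)} {m : Mem}
    (h : Represents H G m) : IsOrientationOf (storedOrientation n m) G := by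
  refine ⟨h.adj, fun u v huv hvu => ?_⟩
  obtain ⟨E, m₀, rfl, -, hs, e⟩ := h.stable (two_le_of_adj ((h.adj u v).2 (.inl huv)))
  simp only [storedOrientation, e 3 le_rfl] at huv hvu
  exact hvu (hs.inv.wf.asymm u u.2 v v.2 huv)

theorem Represents.isHBalanced {n H : ℕ} {G : SimpleGraph (Fin n)} {m : Mem}
    (h : Represents H G m) : IsHBalanced (storedOrientation n m) H := by
  intro u v huv
  obtain ⟨E, m₀, rfl, rfl, hs, e⟩ := h.stable (two_le_of_adj ((h.adj u v).2 (.inl huv)))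
  have key : ∀ x : Fin E.n, outDeg (storedOrientation E.n m) x =
      ((Finset.range E.n).filter fun y => E.cls m₀ x y ≠ 0).card := fun x => by
    rw [outDeg, ← Set.ncard_image_of_injective _ Fin.val_injective, ← Set.ncard_coe_finset]
    congr 1
    ext y
    simp only [storedOrientation, e 3 le_rfl, Set.mem_image, Set.mem_ofPred_eq, Finset.coe_filter,
      Finset.mem_range, Env.cls]
    constructor
    · rintro ⟨z, hz, rfl⟩
      exact ⟨z.2, hz⟩
    · rintro ⟨hy, hc⟩
      exact ⟨⟨y, hy⟩, hc, rfl⟩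
  rw [key, key, hs.min_card_eq_deg u.2, hs.min_card_eq_deg v.2]
  simp only [storedOrientation, e 3 le_rfl] at huv
  exact hs.balanced u u.2 v v.2 huv

/-! ### The input of an operation -/

theorem length_le_sq {n : ℕ} {b : Batch n} (hb : b.edgeList.Nodup) : b.length ≤ n ^ 2 := by
  have h1 : b.length ≤ Fintype.card (Fin n × Fin n) := (List.Nodup.of_map _ hb).length_le_card
  simpa [sq] using h1

theorem ok_withInput {E : Env} {b : Batch E.n} {m : Mem} (hk : b.length = E.k)
    (hm : ∀ a, 3 ≤ a → ∀ i, m a i < E.Q ^ arrGrade a) : E.Ok (withInput E.w E.n E.H b m) := by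
  have hQ := E.two_le_Q
  have hlt : ∀ {x}, x < E.Q ^ 2 → x < 2 ^ E.w := fun h =>
    h.trans_le ((Nat.pow_le_pow_right (by omega) (by norm_num)).trans E.word)
  have hn : E.n < E.Q ^ 2 := by have := E.one_le_H; unfold Env.Q at *; nlinarith
  have hH : E.H < E.Q ^ 2 := by have := E.two_le_n; unfold Env.Q at *; nlinarith
  have hQ0 : 0 < E.Q ^ 2 := by positivity
  have hend : ∀ (f : Fin E.n × Fin E.n → Fin E.n) i,
      (b.map fun p => (f p : ℕ)).getD i 0 % 2 ^ E.w < E.Q ^ 2 := fun f i => by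
    refine (Nat.mod_le _ _).trans_lt ?_
    rw [List.getD_eq_getElem?_getD, List.getElem?_map]
    cases b[i]? with
    | none => exact hQ0
    | some p => exact (f p).2.trans hn
  refine ⟨Nat.mod_eq_of_lt (hlt hn), Nat.mod_eq_of_lt (hlt hH), ?_, fun a i => ?_⟩
  · rw [← hk]; exact Nat.mod_eq_of_lt (hlt (hk ▸ E.k_lt))
  · match a with
    | 0 =>
      refine (Nat.mod_le _ _).trans_lt ?_
      match i with
      | 0 => exact hn
      | 1 => exact hH
      | 2 => exact hk ▸ E.k_lt
      | _ + 3 => exact hQ0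
    | 1 => exact hend _ i
    | 2 => exact hend _ i
    | a + 3 => exact hm _ (by omega) i

theorem withInput_fst {E : Env} (b : Batch E.n) (m : Mem) {i : ℕ} (hi : i < b.length) :
    withInput E.w E.n E.H b m 1 i = b[i].1 := by
  have h : E.n ≤ 2 ^ E.w :=
    (Nat.le_add_right _ _).trans ((Nat.le_self_pow (by norm_num) _).trans E.word)
  simp only [withInput, List.getD_eq_getElem?_getD, List.getElem?_map, List.getElem?_eq_getElem hi,
    Option.map_some, Option.getD_some]
  exact Nat.mod_eq_of_lt (b[i].1.2.trans_le h)

theorem withInput_snd {E : Env} (b : Batch E.n) (m : Mem) {i : ℕ} (hi : i < b.length) :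
    withInput E.w E.n E.H b m 2 i = b[i].2 := by
  have h : E.n ≤ 2 ^ E.w :=
    (Nat.le_add_right _ _).trans ((Nat.le_self_pow (by norm_num) _).trans E.word)
  simp only [withInput, List.getD_eq_getElem?_getD, List.getElem?_map, List.getElem?_eq_getElem hi,
    Option.map_some, Option.getD_some]
  exact Nat.mod_eq_of_lt (b[i].2.2.trans_le h)

theorem joins_withInput {E : Env} (b : Batch E.n) (m : Mem) {i : ℕ} (hi : i < b.length)
    (u v : Fin E.n) : Env.Joins (withInput E.w E.n E.H b m) i u v ↔
      s(b[i].1, b[i].2) = s(u, v) := by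
  rw [Env.Joins, withInput_fst b m hi, withInput_snd b m hi, Sym2.eq_iff]
  simp only [Fin.ext_iff]

theorem exists_joins_withInput {E : Env} {b : Batch E.n} (hk : b.length = E.k) (m : Mem)
    (u v : Fin E.n) : (∃ i < E.k, Env.Joins (withInput E.w E.n E.H b m) i u v) ↔
      s(u, v) ∈ b.edges := by
  simp only [Batch.edges, Batch.edgeList, Set.mem_ofPred_eq, List.mem_map]
  constructor
  · rintro ⟨i, hi, hj⟩
    exact ⟨b[i], List.getElem_mem _, (joins_withInput b m (hk ▸ hi) u v).1 hj⟩
  · rintro ⟨p, hp, h⟩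
    obtain ⟨i, hi, rfl⟩ := List.getElem_of_mem hp
    exact ⟨i, hk ▸ hi, (joins_withInput b m hi u v).2 h⟩

theorem isBatch_withInput {E : Env} {b : Batch E.n} (hk : b.length = E.k)
    (hb : b.edgeList.Nodup) (hne : ∀ p ∈ b, p.1 ≠ p.2) (m : Mem) :
    E.IsBatch (withInput E.w E.n E.H b m) := by
  refine ⟨fun i hi => ?_, fun i hi => ?_, fun i hi i' hi' u v hj hj' => ?_⟩
  · rw [withInput_fst b m (hk ▸ hi), withInput_snd b m (hk ▸ hi)]
    exact ⟨Fin.is_lt _, Fin.is_lt _⟩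
  · rw [withInput_fst b m (hk ▸ hi), withInput_snd b m (hk ▸ hi)]
    exact Fin.val_ne_of_ne (hne _ (List.getElem_mem _))
  · have hi₁ : i < b.length := hk ▸ hi
    have hi₂ : i' < b.length := hk ▸ hi'
    have e : s(b[i].1, b[i].2) = s(b[i'].1, b[i'].2) := by
      rw [Env.Joins, withInput_fst b m hi₁, withInput_snd b m hi₁] at hj
      rw [Env.Joins, withInput_fst b m hi₂, withInput_snd b m hi₂] at hj'
      rw [Sym2.eq_iff]
      simp only [Fin.ext_iff]
      omega
    refine (hb.getElem_inj_iff (hi := by simpa [Batch.edgeList] using hi₁)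
      (hj := by simpa [Batch.edgeList] using hi₂)).1 ?_
    simpa [Batch.edgeList] using e

/-- The parameters of an operation on a batch of a represented graph. -/
theorem Represents.exists_env {n H w : ℕ} {G : SimpleGraph (Fin n)} {m : Mem}
    (h : Represents H G m) (hH : 1 ≤ H) (hw : (n + H) ^ 24 ≤ 2 ^ w) {b : Batch n} (hne : b ≠ [])
    (hb : b.edgeList.Nodup) (hloop : ∀ p ∈ b, p.1 ≠ p.2) :
    ∃ E : Env, E.n = n ∧ E.H = H ∧ E.w = w ∧ E.k = b.length ∧
      E.Stable (withInput w n H b m) := by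
  obtain ⟨p, hp⟩ := List.exists_mem_of_ne_nil b hne
  have hn := two_le_of_ne (hloop p hp)
  obtain ⟨E₀, m₀, rfl, rfl, hs, e⟩ := h.stable hn
  let E : Env := ⟨E₀.n, E₀.H, b.length, w, hn, hH, List.length_pos_of_ne_nil hne,
    length_le_sq hb, hw⟩
  refine ⟨E, rfl, rfl, rfl, rfl, hs.transfer rfl rfl (ok_withInput (E := E) rfl fun a ha i => ?_)
    (e 3 (by decide)) (e 4 (by decide)) (e 5 (by decide)) (e 6 (by decide))⟩
  rw [e a ha]
  exact hs.inv.ok.bdd a i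

/-! ### The operations -/

/-- Zero-initialized memory represents the empty graph, so that the initialization is a parallel
round without processors. -/
def initProg : Prog := .round (.const 0) (.const 0) 3 (.const 0) (.const 0)

theorem exec_initProg (w : ℕ) (σ : ℕ → ℕ → ℕ) (m : Mem) : Exec w σ initProg 0 m m 1 5 := by
  have h : roundMem w 0 (σ 0) (.const 0) 3 (.const 0) (.const 0) m = m := by
    simp [roundMem, resolve, writers]
  have := Exec.round (w := w) (σ := σ) (.const 0) (.const 0) 3 (.const 0) (.const 0) 0 m
  simp only [Expr.eval, Expr.cost, Nat.zero_mod, h] at this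
  exact this

theorem represents_bot {n H w : ℕ} (hH : 1 ≤ H) (hw : (n + H) ^ 24 ≤ 2 ^ w) :
    Represents H (⊥ : SimpleGraph (Fin n)) (withInput w n H [] fun _ _ => 0) := by
  refine ⟨fun u v => by simp [withInput], fun hn => ?_⟩
  let E : Env := ⟨n, H, 1, w, hn, hH, le_rfl, Nat.one_le_pow _ _ (by omega), hw⟩
  refine ⟨E, withInput w n H [(⟨0, by omega⟩, ⟨0, by omega⟩)] fun _ _ => 0, rfl, rfl,
    Env.stable_of_zero (ok_withInput (E := E) rfl fun a _ i =>
      Nat.pow_pos (zero_lt_two.trans_le E.two_le_Q)) ?_, ?_⟩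
  · rintro (_ | _ | _ | a) ha
    · omega
    · omega
    · omega
    · rfl
  · rintro (_ | _ | _ | a) ha
    · omega
    · omega
    · omega
    · rfl

/-- The outcome of an insertion, for every resolution of the write conflicts. -/
theorem Represents.insert {n H w : ℕ} {G : SimpleGraph (Fin n)} {m : Mem}
    (h : Represents H G m) (hH : 1 ≤ H) (hw : (n + H) ^ 24 ≤ 2 ^ w) {b : Batch n}
    (hb : IsInsertion G b) : ∃ E : Env, E.n = n ∧ E.H = H ∧ E.k = b.length ∧ ∀ σ, ∃ m' W D,
      Exec w σ insertProg 0 (withInput w n H b m) m' W D ∧ W ≤ b.length * D ∧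
      D ≤ E.insertTime ∧ Represents H (insertBatch G b) m' := by
  obtain ⟨hne, hnd, hp⟩ := hb
  obtain ⟨E, rfl, rfl, rfl, hk, hs⟩ := h.exists_env hH hw hne hnd fun p hq => (hp p hq).1
  have hB := isBatch_withInput hk.symm hnd (fun p hq => (hp p hq).1) m
  have hadj : ∀ u v : Fin E.n, E.Adj (withInput E.w E.n E.H b m) u v ↔ G.Adj u v :=
    fun u v => (h.adj u v).symm
  refine ⟨E, rfl, rfl, hk, fun σ => ?_⟩
  obtain ⟨m', W, D, h1, h2, h3, h4, h5⟩ := Env.runs_insert hs hB (fun i hi u v hj ha => by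
    have hlt := hB.lt i hi
    have hu : u < E.n := by unfold Env.Joins at hj; omega
    have hv : v < E.n := by unfold Env.Joins at hj; omega
    lift u to Fin E.n using hu
    lift v to Fin E.n using hv
    rw [hadj] at ha
    have he := (joins_withInput b m (hk ▸ hi) u v).1 hj
    refine (hp _ (List.getElem_mem (hk ▸ hi))).2 ?_
    rwa [← SimpleGraph.mem_edgeSet, he, SimpleGraph.mem_edgeSet]) σ 0
  refine ⟨m', W, D, h1, hk ▸ h2, h3, fun u v => ?_, fun _ => ⟨E, m', rfl, rfl, h4, fun _ _ => rfl⟩⟩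
  have h6 := h5 u u.2 v v.2
  rw [hadj, exists_joins_withInput hk.symm] at h6
  refine Iff.trans ?_ h6.symm
  simp only [insertBatch, SimpleGraph.sup_adj, SimpleGraph.fromEdgeSet_adj]
  refine or_congr_right ⟨And.left, fun hm => ⟨hm, ?_⟩⟩
  obtain ⟨p, hq, e⟩ := List.mem_map.1 hm
  rintro rfl
  exact (hp p hq).1 (by simpa using congrArg Sym2.IsDiag e)

/-- The outcome of a deletion, for every resolution of the write conflicts. -/
theorem Represents.delete {n H w : ℕ} {G : SimpleGraph (Fin n)} {m : Mem}
    (h : Represents H G m) (hH : 1 ≤ H) (hw : (n + H) ^ 24 ≤ 2 ^ w) {b : Batch n}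
    (hb : IsDeletion G b) : ∃ E : Env, E.n = n ∧ E.H = H ∧ E.k = b.length ∧ ∀ σ, ∃ m' W D,
      Exec w σ deleteProg 0 (withInput w n H b m) m' W D ∧ W ≤ b.length * D ∧
      D ≤ E.deleteTime ∧ Represents H (deleteBatch G b) m' := by
  obtain ⟨hne, hnd, hp⟩ := hb
  obtain ⟨E, rfl, rfl, rfl, hk, hs⟩ := h.exists_env hH hw hne hnd fun p hq => (hp p hq).ne
  have hB := isBatch_withInput hk.symm hnd (fun p hq => (hp p hq).ne) m
  have hadj : ∀ u v : Fin E.n, E.Adj (withInput E.w E.n E.H b m) u v ↔ G.Adj u v :=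
    fun u v => (h.adj u v).symm
  refine ⟨E, rfl, rfl, hk, fun σ => ?_⟩
  obtain ⟨m', W, D, h1, h2, h3, h4, h5⟩ := Env.runs_delete hs hB (fun i hi => by
    rw [withInput_fst b m (hk ▸ hi), withInput_snd b m (hk ▸ hi), hadj]
    exact hp _ (List.getElem_mem _)) σ 0
  refine ⟨m', W, D, h1, hk ▸ h2, h3, fun u v => ?_, fun _ => ⟨E, m', rfl, rfl, h4, fun _ _ => rfl⟩⟩
  have h6 := h5 u u.2 v v.2
  rw [hadj, exists_joins_withInput hk.symm] at h6
  exact SimpleGraph.deleteEdges_adj.trans h6.symm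

/-- The data structure `Balanced(H)`. -/
def balanced : DataStructure := ⟨initProg, insertProg, deleteProg⟩

theorem Reachable.represents {n H w : ℕ} (hH : 1 ≤ H) (hw : (n + H) ^ 24 ≤ 2 ^ w)
    {G : SimpleGraph (Fin n)} {m : Mem} (h : Reachable balanced w n H G m) : Represents H G m := by
  induction h with
  | init h =>
    obtain ⟨rfl, -, -⟩ := h.det (exec_initProg w _ _)
    exact represents_bot hH hw
  | insert _ hb hx ih =>
    obtain ⟨E, -, -, -, hE⟩ := ih.insert hH hw hb
    obtain ⟨m', W, D, h1, -, -, h4⟩ := hE _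
    obtain ⟨rfl, -, -⟩ := hx.det h1
    exact h4
  | delete _ hb hx ih =>
    obtain ⟨E, -, -, -, hE⟩ := ih.delete hH hw hb
    obtain ⟨m', W, D, h1, -, -, h4⟩ := hE _
    obtain ⟨rfl, -, -⟩ := hx.det h1
    exact h4

end BatchDynamic

/-! ### The time bounds -/

namespace PRAM.Env

variable (E : Env)

theorem rebalanceTime_le : rebalanceTime E ≤ 38180 * (E.H ^ 4 * E.levels) := by
  have hH := E.one_le_H
  have hL : 1 ≤ E.levels := E.one_le_levels
  have h1 : (E.H + 1) * (2 * E.H + 1) + 1 ≤ 7 * E.H ^ 2 := by nlinarith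
  have h3 : E.H ≤ E.H ^ 2 * E.levels :=
    (Nat.le_self_pow two_ne_zero _).trans (Nat.le_mul_of_pos_right _ hL)
  have h2 : (E.H + 1) * (2700 * (E.H * E.levels) + 10) + 30 ≤ 5450 * (E.H ^ 2 * E.levels) := by
    have : E.H * E.levels ≤ E.H ^ 2 * E.levels :=
      Nat.mul_le_mul_right _ (Nat.le_self_pow two_ne_zero _)
    nlinarith
  have h4 : 1 ≤ E.H ^ 4 * E.levels := Nat.mul_pos (by positivity) hL
  have := Nat.mul_le_mul h1 h2
  unfold rebalanceTime
  calc _ ≤ 7 * E.H ^ 2 * (5450 * (E.H ^ 2 * E.levels)) + 30 := by omega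
    _ = 38150 * (E.H ^ 4 * E.levels) + 30 := by ring
    _ ≤ _ := by omega

theorem rebalanceTime_add_le {c : ℕ} (hc : c ≤ 2400) :
    rebalanceTime E + c * (E.H * E.levels) + 10 ≤ 40590 * (E.H ^ 4 * E.levels) := by
  have h1 := rebalanceTime_le E
  have h2 : E.H * E.levels ≤ E.H ^ 4 * E.levels :=
    Nat.mul_le_mul_right _ (Nat.le_self_pow (by norm_num) _)
  have h3 : 1 ≤ E.H * E.levels := Nat.mul_pos E.one_le_H E.one_le_levels
  have h4 : c * (E.H * E.levels) ≤ 2400 * (E.H * E.levels) := Nat.mul_le_mul_right _ hc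
  omega

theorem insertTime_le : E.insertTime ≤ 300000 * (E.H ^ 6 * E.levels) := by
  have hH := E.one_le_H
  have h1 : 2 * (E.H * E.H + 2 * E.H) + 1 ≤ 7 * E.H ^ 2 := by nlinarith
  have h2 := Nat.mul_le_mul h1 (E.rebalanceTime_add_le le_rfl)
  have h3 : E.H * E.levels ≤ E.H ^ 6 * E.levels :=
    Nat.mul_le_mul_right _ (Nat.le_self_pow (by norm_num) _)
  have h4 : 7 * E.H ^ 2 * (40590 * (E.H ^ 4 * E.levels)) = 284130 * (E.H ^ 6 * E.levels) := by ring
  unfold insertTime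
  omega

theorem deleteTime_le : E.deleteTime ≤ 300000 * (E.H ^ 5 * E.levels) := by
  have h2 := Nat.mul_le_mul_left E.H (E.rebalanceTime_add_le (c := 2300) (by norm_num))
  have h3 : E.H * E.levels ≤ E.H ^ 5 * E.levels :=
    Nat.mul_le_mul_right _ (Nat.le_self_pow (by norm_num) _)
  have h4 : E.H * (40590 * (E.H ^ 4 * E.levels)) = 40590 * (E.H ^ 5 * E.levels) := by ring
  unfold deleteTime
  omega

theorem levels_le : (E.levels : ℝ) ≤ 3 * Real.log E.n := by
  have hn : (2 : ℝ) ≤ E.n := by exact_mod_cast E.two_le_n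
  have h1 := Real.log_two_gt_d9
  have h2 : Real.log 2 ≤ Real.log E.n := Real.log_le_log two_pos hn
  have h3 : (Nat.log 2 E.n : ℝ) * Real.log 2 ≤ Real.log E.n := by
    rw [← Real.log_pow]
    refine Real.log_le_log (by positivity) ?_
    exact_mod_cast Nat.pow_log_le_self 2 (by have := E.two_le_n; omega)
  have h4 : (0 : ℝ) ≤ Nat.log 2 E.n := Nat.cast_nonneg _
  simp only [levels, Nat.cast_add, Nat.cast_one]
  nlinarith

/-- At most `k` processors are at work at any time, so that the bound on the depth bounds the
work. -/
theorem cost_le {j W D : ℕ} (hW : W ≤ E.k * D) (hD : D ≤ 300000 * (E.H ^ j * E.levels)) :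
    (W : ℝ) ≤ 900000 * (E.H : ℝ) ^ j * Real.log E.n * E.k ∧
      (D : ℝ) ≤ 900000 * (E.H : ℝ) ^ j * Real.log E.n := by
  have h1 : (D : ℝ) ≤ 300000 * ((E.H : ℝ) ^ j * E.levels) := by exact_mod_cast hD
  have h2 : (E.H : ℝ) ^ j * E.levels ≤ (E.H : ℝ) ^ j * (3 * Real.log E.n) :=
    mul_le_mul_of_nonneg_left E.levels_le (by positivity)
  have h3 : (D : ℝ) ≤ 900000 * (E.H : ℝ) ^ j * Real.log E.n := by linarith
  have h4 : (W : ℝ) ≤ E.k * D := by exact_mod_cast hW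
  refine ⟨h4.trans ?_, h3⟩
  rw [mul_comm]
  exact mul_le_mul_of_nonneg_right h3 (Nat.cast_nonneg _)

end PRAM.Env

theorem mainTheorem3 :
    ∃ (A : BatchDynamic.DataStructure) (c : ℕ) (C : ℝ),
      ∀ n H w : ℕ, 1 ≤ H → (n + H) ^ c ≤ 2 ^ w →
        BatchDynamic.RunsWithin w A.init
            (BatchDynamic.withInput w n H [] fun _ _ => 0) C C ∧
        ∀ (G : SimpleGraph (Fin n)) (m : PRAM.Mem), BatchDynamic.Reachable A w n H G m →
          IsOrientationOf (BatchDynamic.storedOrientation n m) G ∧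
          IsHBalanced (BatchDynamic.storedOrientation n m) H ∧
          (∀ b : BatchDynamic.Batch n, BatchDynamic.IsInsertion G b →
            BatchDynamic.RunsWithin w A.insert (BatchDynamic.withInput w n H b m)
              (C * (H : ℝ) ^ 6 * Real.log n * b.length) (C * (H : ℝ) ^ 6 * Real.log n)) ∧
          (∀ b : BatchDynamic.Batch n, BatchDynamic.IsDeletion G b →
            BatchDynamic.RunsWithin w A.delete (BatchDynamic.withInput w n H b m)
              (C * (H : ℝ) ^ 5 * Real.log n * b.length) (C * (H : ℝ) ^ 5 * Real.log n)) := by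
  refine ⟨BatchDynamic.balanced, 24, 900000, fun n H w hH hw => ⟨fun σ => ?_, fun G m hm => ?_⟩⟩
  · exact ⟨_, _, _, BatchDynamic.exec_initProg w σ _, by norm_num, by norm_num⟩
  have h := hm.represents hH hw
  refine ⟨h.isOrientationOf, h.isHBalanced, fun b hb σ => ?_, fun b hb σ => ?_⟩
  · obtain ⟨E, rfl, rfl, hk, hE⟩ := h.insert hH hw hb
    obtain ⟨m', W, D, h1, h2, h3, -⟩ := hE σ
    have := E.cost_le (hk ▸ h2) (h3.trans E.insertTime_le)
    exact ⟨m', W, D, h1, hk ▸ this.1, this.2⟩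
  · obtain ⟨E, rfl, rfl, hk, hE⟩ := h.delete hH hw hb
    obtain ⟨m', W, D, h1, h2, h3, -⟩ := hE σ
    have := E.cost_le (hk ▸ h2) (h3.trans E.deleteTime_le)
    exact ⟨m', W, D, h1, hk ▸ this.1, this.2⟩
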